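/- **Setting.** Let $\mathbb T=\mathbb R/\mathbb Z$ and $e_m(t)=e^{2\pi i m t}$. One observes $$y(u,t)=\int_0^1 g(u,t-x)f(u,x)\,dx+\varepsilon z(u,t),\qquad (u,t)\in\mathbb T^2,$$ where $z$ is Gaussian white noise on $\mathbb T^2$ (so that for $\chi\in L^2(\mathbb T^2)$ the variables $\iint\chi z$ form a centred Gaussian family with covariance $\langle\chi_1,\chi_2\rangle$), $f$ is real and unknown, and $g$ is real, known, measurable, with $g(u,\cdot)\in L^1(\mathbb T)$ for every $u$. Subscripts $m$ denote Fourier coefficients in the second variable. Assume that for some constants $\nu,C_1,C_2>0$ $$C_1(|m|\vee 1)^{-2\nu}\le |g_m(u)|^2\le C_2(|m|\vee1)^{-2\nu}\qquad\text{for all } m\in\mathbb Z,\ u\in\mathbb T.$$ **Bases.** For $\chi:\mathbb R\to\mathbb R$ let $\chi_{j,k}(x)=\sum_{n\in\mathbb Z}2^{j/2}\chi(2^j(x+n)-k)$. Let $\varphi,\psi\in L^1(\mathbb R)$ be real functions such that $\varphi_{m_0,k}$ ($0\le k<2^{m_0}$) and $\psi_{j,k}$ ($j\ge m_0$, $0\le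 k<2^j$) form an orthonormal basis of $L^2(\mathbb T)$ of Meyer type, that is, $\int\psi(x)e^{-i\omega x}dx$ vanishes unless $2\pi/3\le|\omega|\le 8\pi/3$ and $\int\varphi(x)e^{-i\omega x}dx$ vanishes unless $|\omega|\le4\pi/3$. Let $\varphi',\eta$ be real, integrable and compactly supported functions (for instance of Daubechies type) that in the same way generate an orthonormal basis of $L^2(\mathbb T)$ with lowest level $m_0'$. Write $\psi_{m_0-1,k}=\varphi_{m_0,k}$ ($0\le k<2^{m_0}$) and $\eta_{m_0'-1,k'}=\varphi'_{m_0',k'}$ ($0\le k'<2^{m_0'}$); let $\psi_{j,k,m}$ be the Fourier coefficients of $\psi_{j,k}$, and $\beta_{j,k,j',k'}=\iint f(u,x)\psi_{j,k}(x)\eta_{j',k'}(u)\,dx\,du$. **Besov balls.** For $1\le p,q\le\infty$ and $A>0$ let $B^{s_1,s_2}_{p,q}(A)$ be the set of $f\in L^2(\mathbb T^2)$ with $$\Bigl(\sum_{j\ge m_0-1,\;j'\ge m_0'-1}2^{(js_1^*+j's_2^*)q}\Bigl(\sum_{k,k'}|\beta_{j,k,j',k'}|^p\Bigr)^{q/p}\Bigr)^{1/q}\le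 A,\qquad s_i^*=s_i+\tfrac12-\tfrac1p,$$ with the usual modification by suprema if $p=\infty$ or $q=\infty$. **Estimator.** Put $$\widetilde\beta_{j,k,j',k'}=\sum_{m:\,\psi_{j,k,m}\ne0}\overline{\psi_{j,k,m}}\int\frac{y_m(u)}{g_m(u)}\eta_{j',k'}(u)\,du,\qquad \lambda_{j\varepsilon}=C_\beta\sqrt{\ln(1/\varepsilon)}\,2^{j\nu}\varepsilon,$$ $$\widehat f(u,t)=\sum_{j=m_0-1}^{J-1}\ \sum_{j'=m_0'-1}^{J'-1}\ \sum_{k,k'}\widetilde\beta_{j,k,j',k'}\,\mathbf 1\bigl(|\widetilde\beta_{j,k,j',k'}|>\lambda_{j\varepsilon}\bigr)\psi_{j,k}(t)\eta_{j',k'}(u),$$ where $2^J=(\varepsilon^2)^{-1/(2\nu+1)}$ and $2^{J'}=(\varepsilon^2)^{-1}$, with $J$ and $J'$ each rounded down or up to an integer. Thus $\widehat f$ does not depend on $s_1,s_2,p,q,A$. **Theorem.** Let $1\le p,q\le\infty$, $\min\{s_1,s_2\}\ge\max\{1/p,1/2\}$, and let $C_\beta>0$ satisfy $C_\beta^2\ge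 80\,C_1^{-1}(2\pi/3)^{2\nu}$. Put $s_1'=s_1+\frac12-\frac1{\min\{p,2\}}$, $$d=\min\Bigl(\frac{2s_2}{2s_2+1},\ \frac{2s_1}{2s_1+2\nu+1},\ \frac{2s_1'}{2s_1'+2\nu}\Bigr),\qquad d_1=\mathbf 1\bigl(s_1=s_2(2\nu+1)\bigr)+\mathbf 1\bigl(s_1=(2\nu+1)(\tfrac1p-\tfrac12)\bigr).$$ Then there is a constant $C>0$, independent of $\varepsilon$ and $A$, such that for every $A>0$ and all sufficiently small $\varepsilon>0$ $$\sup_{f\in B^{s_1,s_2}_{p,q}(A)}\mathbf E\|\widehat f-f\|^2\le C A^2\Bigl(\frac{\varepsilon^2\ln(1/\varepsilon)}{A^2}\Bigr)^d\bigl(\ln(1/\varepsilon)\bigr)^{d_1},$$ where $\|\cdot\|$ is the norm of $L^2(\mathbb T^2)$. -/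

import Mathlib

open MeasureTheory ProbabilityTheory Filter Topology
open scoped ENNReal FourierTransform ComplexConjugate

noncomputable section

namespace FunctionalDeconvolution

/-- The periodic unit square; a point is a pair `(u, t)`. Its volume is the product of the
Lebesgue probability measures of the two circles. -/
abbrev Torus2 : Type := UnitAddCircle × UnitAddCircle

/-- The real Hilbert space `L²` of the periodic unit square. -/
abbrev L2Torus2 : Type := Lp ℝ 2 (volume : Measure Torus2)

/-! ### Periodized wavelet bases -/

theorem periodizedLine_periodic (χ : ℝ → ℝ) (j k : ℕ) :
    Function.Periodic
      (fun x : ℝ => ∑' n : ℤ, (2 : ℝ) ^ ((j : ℝ) / 2) * χ (2 ^ j * (x + n) - k)) 1 := by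
  intro x
  refine Eq.trans ?_ ((Equiv.addRight (1 : ℤ)).tsum_eq
    (fun n : ℤ => (2 : ℝ) ^ ((j : ℝ) / 2) * χ (2 ^ j * (x + n) - k)))
  refine tsum_congr fun n => ?_
  simp only [Equiv.coe_addRight, Int.cast_add, Int.cast_one]
  congr 4
  ring

/-- `χ_{j,k}^{per}(x) = ∑_{n ∈ ℤ} 2^{j/2} χ(2^j (x + n) - k)`. -/
def periodized (χ : ℝ → ℝ) (j k : ℕ) : UnitAddCircle → ℝ :=
  (periodizedLine_periodic χ j k).lift

/-- The levels of a wavelet basis with lowest resolution level `m₀` are `m₀ - 1, m₀, m₀ + 1, …`;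
they are enumerated by `a = 0, 1, 2, …`. The entry `a = 0`, that is, level `m₀ - 1`, stands for
the `2 ^ m₀` scaling functions; an entry `a ≥ 1` stands for the `2 ^ j` wavelets of level
`j = m₀ - 1 + a`. -/
def level (m₀ a : ℕ) : ℝ := (m₀ : ℝ) - 1 + a

/-- The number of basis functions at the level enumerated by `a`. -/
def translates (m₀ : ℕ) : ℕ → ℕ
  | 0 => 2 ^ m₀
  | a + 1 => 2 ^ (m₀ + a)

/-- The basis functions: periodized translates of the scaling function `φ` at resolution `m₀`
for `a = 0`, periodized translates of the wavelet `ψ` at resolution `m₀ - 1 + a` for `a ≥ 1`. -/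
def waveletFun (φ ψ : ℝ → ℝ) (m₀ : ℕ) : ℕ → ℕ → UnitAddCircle → ℝ
  | 0, k => periodized φ m₀ k
  | a + 1, k => periodized ψ (m₀ + a) k

/-- `φ` (scaling function) and `ψ` (wavelet) generate a periodized orthonormal wavelet basis of
`L²([0,1])` with lowest resolution level `m₀`. -/
structure IsPeriodizedWaveletBasis (φ ψ : ℝ → ℝ) (m₀ : ℕ) : Prop where
  integrable_scaling : Integrable φ
  integrable_wavelet : Integrable ψ
  basis : ∃ b : HilbertBasis (Σ a : ℕ, Fin (translates m₀ a)) ℝ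
      (Lp ℝ 2 (volume : Measure UnitAddCircle)),
    ∀ i, (b i : UnitAddCircle → ℝ) =ᵐ[volume] waveletFun φ ψ m₀ i.1 i.2

/-- A Meyer-type basis: in angular frequency `ω = 2πξ` the Fourier transform of the wavelet lives
on `2π/3 ≤ |ω| ≤ 8π/3` and that of the scaling function on `|ω| ≤ 4π/3`. -/
structure IsMeyerBasis (φ ψ : ℝ → ℝ) (m₀ : ℕ) : Prop
    extends IsPeriodizedWaveletBasis φ ψ m₀ where
  band_scaling : ∀ ξ : ℝ, 𝓕 (fun x : ℝ => (φ x : ℂ)) ξ ≠ 0 →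
    2 * Real.pi * |ξ| ≤ 4 * Real.pi / 3
  band_wavelet : ∀ ξ : ℝ, 𝓕 (fun x : ℝ => (ψ x : ℂ)) ξ ≠ 0 →
    2 * Real.pi / 3 ≤ 2 * Real.pi * |ξ| ∧ 2 * Real.pi * |ξ| ≤ 8 * Real.pi / 3

/-- A periodized wavelet basis whose generators have compact support (Daubechies-type). -/
structure IsFinitelySupportedBasis (φ ψ : ℝ → ℝ) (m₀ : ℕ) : Prop
    extends IsPeriodizedWaveletBasis φ ψ m₀ where
  compact_scaling : HasCompactSupport φ
  compact_wavelet : HasCompactSupport ψ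

/-- A hyperbolic wavelet system: a Meyer-type basis (generators `φ, ψ`, lowest level `m₀`) in the
variable `t`, a finitely supported basis (generators `φ', η`, lowest level `m₀'`) in `u`. -/
structure WaveletSystem where
  φ : ℝ → ℝ
  ψ : ℝ → ℝ
  m₀ : ℕ
  φ' : ℝ → ℝ
  η : ℝ → ℝ
  m₀' : ℕ
  meyer : IsMeyerBasis φ ψ m₀
  finite : IsFinitelySupportedBasis φ' η m₀'

namespace WaveletSystem

variable (w : WaveletSystem)

/-- `ψ_{j,k}(t)`, `j = level m₀ a`. -/
def psi (a k : ℕ) : UnitAddCircle → ℝ := waveletFun w.φ w.ψ w.m₀ a k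

/-- `η_{j',k'}(u)`, `j' = level m₀' a'`. -/
def eta (a' k' : ℕ) : UnitAddCircle → ℝ := waveletFun w.φ' w.η w.m₀' a' k'

/-- Fourier coefficients `ψ_{j,k,m}`. -/
def psiCoeff (a k : ℕ) (m : ℤ) : ℂ := fourierCoeff (fun t => (w.psi a k t : ℂ)) m

/-- The frequencies at which `ψ_{j,k}` does not vanish. -/
def band (a k : ℕ) : Set ℤ := {m | w.psiCoeff a k m ≠ 0}

/-- Wavelet coefficients `β_{j,k,j',k'} = ⟨⟨f(u, ·), ψ_{j,k}⟩, η_{j',k'}⟩`. -/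
def coeff (f : Torus2 → ℝ) (a k a' k' : ℕ) : ℝ :=
  ∫ u : UnitAddCircle, (∫ x : UnitAddCircle, f (u, x) * w.psi a k x) * w.eta a' k' u

end WaveletSystem

/-! ### Besov balls of mixed regularity -/

/-- The `ℓ^p` (quasi-)norm, `0 < p ≤ ∞`, of a family in `[0, ∞]`. -/
def ellNorm {ι : Type*} (p : ℝ≥0∞) (c : ι → ℝ≥0∞) : ℝ≥0∞ :=
  if p = ∞ then ⨆ i, c i else (∑' i, c i ^ p.toReal) ^ (1 / p.toReal)

/-- `s + 1/2 - 1/p`, with `1/∞ = 0`. -/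
def shifted (s : ℝ) (p : ℝ≥0∞) : ℝ := s + 1 / 2 - (p⁻¹).toReal

/-- The Besov norm
`(∑_{j,j'} 2^{(j s₁* + j' s₂*) q} (∑_{k,k'} |β_{j,k,j',k'}|^p)^{q/p})^{1/q}`
with `s_i* = s_i + 1/2 - 1/p` and the usual suprema for `p = ∞` or `q = ∞`. -/
def besovNorm (w : WaveletSystem) (s₁ s₂ : ℝ) (p q : ℝ≥0∞) (f : Torus2 → ℝ) : ℝ≥0∞ :=
  ellNorm q fun a : ℕ × ℕ =>
    ENNReal.ofReal
        ((2 : ℝ) ^ (level w.m₀ a.1 * shifted s₁ p + level w.m₀' a.2 * shifted s₂ p)) *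
      ellNorm p fun k : Fin (translates w.m₀ a.1) × Fin (translates w.m₀' a.2) =>
        ‖w.coeff f a.1 k.1 a.2 k.2‖ₑ

/-- The Besov ball `B^{s₁,s₂}_{p,q}(A)`. -/
def besovBall (w : WaveletSystem) (s₁ s₂ : ℝ) (p q : ℝ≥0∞) (A : ℝ) : Set (Torus2 → ℝ) :=
  {f | MemLp f 2 volume ∧ besovNorm w s₁ s₂ p q f ≤ ENNReal.ofReal A}

/-! ### The observation model -/

/-- Functional Fourier coefficients `g_m(u)`. -/
def kernelCoeff (g : UnitAddCircle → UnitAddCircle → ℝ) (m : ℤ) (u : UnitAddCircle) : ℂ :=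
  fourierCoeff (fun t => (g u t : ℂ)) m

/-- The known convolution kernel: jointly measurable, integrable in the second variable, and
`C₁ |m|^{-2ν} ≤ |g_m(u)|² ≤ C₂ |m|^{-2ν}` for all `u` and `m`, where at `m = 0` the factor
`|m|` is read as `1`. -/
structure IsRegularKernel (g : UnitAddCircle → UnitAddCircle → ℝ) (ν C₁ C₂ : ℝ) : Prop where
  measurable : Measurable (Function.uncurry g)
  integrable : ∀ u, Integrable (g u)
  lower : ∀ (m : ℤ) (u : UnitAddCircle),
    C₁ * (max 1 |(m : ℝ)|) ^ (-(2 * ν)) ≤ ‖kernelCoeff g m u‖ ^ 2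
  upper : ∀ (m : ℤ) (u : UnitAddCircle),
    ‖kernelCoeff g m u‖ ^ 2 ≤ C₂ * (max 1 |(m : ℝ)|) ^ (-(2 * ν))

/-- `h(u, t) = ∫ g(u, t - x) f(u, x) dx`. -/
def convolved (g : UnitAddCircle → UnitAddCircle → ℝ) (f : Torus2 → ℝ) (x : Torus2) : ℝ :=
  ∫ y : UnitAddCircle, g x.1 (x.2 - y) * f (x.1, y)

/-- Gaussian white noise on the periodic unit square: a centred Gaussian family `Z(χ)`,
`χ ∈ L²`, thought of as `∬ χ(u, t) z(u, t) du dt`, with covariance `E[Z(χ₁) Z(χ₂)] = ⟨χ₁, χ₂⟩`. -/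
structure IsWhiteNoise {Ω : Type*} [MeasurableSpace Ω] (P : Measure Ω)
    (Z : L2Torus2 → Ω → ℝ) : Prop where
  gaussian : IsGaussianProcess Z P
  mean : ∀ χ, ∫ ω, Z χ ω ∂P = 0
  covariance : ∀ χ₁ χ₂, ∫ ω, Z χ₁ ω * Z χ₂ ω ∂P = inner ℝ χ₁ χ₂

/-- The observed data `y = h + ε z`, acting on test functions `χ ∈ L²`:
`y(χ) = ∬ h(u, t) χ(u, t) du dt + ε Z(χ)`. -/
def observation {Ω : Type*} (g : UnitAddCircle → UnitAddCircle → ℝ) (f : Torus2 → ℝ) (ε : ℝ)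
    (Z : L2Torus2 → Ω → ℝ) (ω : Ω) (χ : L2Torus2) : ℝ :=
  (∫ x, convolved g f x * χ x) + ε * Z χ ω

/-! ### The estimator, a function of the data `y : L2Torus2 → ℝ` -/

open Classical in
/-- The class in `L²` of a square-integrable function. -/
def toL2 (F : Torus2 → ℝ) : L2Torus2 :=
  if h : MemLp F 2 volume then h.toLp F else 0

/-- The data tested against a complex function, `∬ y(u, t) F(u, t) du dt`. -/
def pairing (y : L2Torus2 → ℝ) (F : Torus2 → ℂ) : ℂ :=
  (y (toL2 fun x => (F x).re) : ℂ) + Complex.I * (y (toL2 fun x => (F x).im) : ℂ)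

/-- `∑_{m ∈ W_j} conj ψ_{j,k,m} ∫ (y_m(u) / g_m(u)) η_{j',k'}(u) du`, where `y_m(u)` is the `m`-th
Fourier coefficient of `y(u, ·)`. -/
def coeffEst (w : WaveletSystem) (g : UnitAddCircle → UnitAddCircle → ℝ) (y : L2Torus2 → ℝ)
    (a k a' k' : ℕ) : ℂ :=
  ∑ᶠ m ∈ w.band a k, conj (w.psiCoeff a k m) *
    pairing y fun x => fourier (-m) x.2 / kernelCoeff g m x.1 * (w.eta a' k' x.1 : ℂ)

/-- The threshold `λ_{j,ε} = C_β √(ln(1/ε)) 2^{jν} ε`, `j = level m₀ a`. -/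
def threshold (w : WaveletSystem) (ν Cβ ε : ℝ) (a : ℕ) : ℝ :=
  Cβ * √(Real.log (1 / ε)) * (2 : ℝ) ^ (level w.m₀ a * ν) * ε

open Classical in
/-- The hard-thresholded coefficient. -/
def coeffThr (w : WaveletSystem) (g : UnitAddCircle → UnitAddCircle → ℝ) (ν Cβ ε : ℝ)
    (y : L2Torus2 → ℝ) (a k a' k' : ℕ) : ℂ :=
  if threshold w ν Cβ ε a < ‖coeffEst w g y a k a' k'‖ then coeffEst w g y a k a' k' else 0

/-- The hyperbolic wavelet estimator, with levels `m₀ - 1 ≤ j ≤ J - 1` in `t` and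
`m₀' - 1 ≤ j' ≤ J' - 1` in `u`. -/
def estimator (w : WaveletSystem) (g : UnitAddCircle → UnitAddCircle → ℝ) (ν Cβ ε : ℝ)
    (J J' : ℕ) (y : L2Torus2 → ℝ) (x : Torus2) : ℂ :=
  ∑ a ∈ Finset.range (J + 1 - w.m₀), ∑ a' ∈ Finset.range (J' + 1 - w.m₀'),
    ∑ k ∈ Finset.range (translates w.m₀ a), ∑ k' ∈ Finset.range (translates w.m₀' a'),
      coeffThr w g ν Cβ ε y a k a' k' * (w.psi a k x.2 : ℂ) * (w.eta a' k' x.1 : ℂ)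

/-- `J` is one of the two integer roundings of the number `L` for which `2 ^ L = X`
(and `J = L` if `L` is an integer). -/
def IsLevelFor (J : ℕ) (X : ℝ) : Prop := |(J : ℝ) - Real.logb 2 X| < 1

/-- The risk `E ‖f̂ - f‖²`. -/
def risk {Ω : Type*} [MeasurableSpace Ω] (P : Measure Ω) (Z : L2Torus2 → Ω → ℝ)
    (w : WaveletSystem) (g : UnitAddCircle → UnitAddCircle → ℝ) (ν Cβ ε : ℝ) (J J' : ℕ)
    (f : Torus2 → ℝ) : ℝ≥0∞ :=
  ∫⁻ ω, ∫⁻ x : Torus2,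
    ‖estimator w g ν Cβ ε J J' (observation g f ε Z ω) x - (f x : ℂ)‖ₑ ^ 2 ∂volume ∂P

/-! ### The rate -/

/-- `d = min (2s₂/(2s₂+1)) (2s₁/(2s₁+2ν+1)) (2s₁'/(2s₁'+2ν))`, `s₁' = s₁ + 1/2 - 1/min(p,2)`. -/
def rateExp (s₁ s₂ ν : ℝ) (p : ℝ≥0∞) : ℝ :=
  min (2 * s₂ / (2 * s₂ + 1)) (min (2 * s₁ / (2 * s₁ + 2 * ν + 1))
    (2 * shifted s₁ (min p 2) / (2 * shifted s₁ (min p 2) + 2 * ν)))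

open Classical in
/-- `d₁ = 1(s₁ = s₂(2ν+1)) + 1(s₁ = (2ν+1)(1/p - 1/2))`. -/
def logExp (s₁ s₂ ν : ℝ) (p : ℝ≥0∞) : ℕ :=
  (if s₁ = s₂ * (2 * ν + 1) then 1 else 0) +
    (if s₁ = (2 * ν + 1) * ((p⁻¹).toReal - 1 / 2) then 1 else 0)

end FunctionalDeconvolution

end

noncomputable section

namespace FunctionalDeconvolution

/-! ### Parseval identities -/

section Parseval

variable {α β ι κ : Type*} [MeasurableSpace α] [MeasurableSpace β] {μ : Measure α} {ν : Measure β}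

/-! By Parseval in the tensor wavelet basis the risk is a sum over single coefficients: the mean
squared error of each thresholded coefficient on the retained levels, and the energy `β²` of each
coefficient on the others (`risk_le_tsum`).

Convolution multiplies the `m`-th Fourier coefficient at `u` by `g_m(u)`, so division by `g_m(u)`
undoes it. The Meyer wavelet of level `j` only involves frequencies of order at most `2^j`, where
`|g_m(u)|⁻²` is at most of order `2^{2jν}`. Hence an estimated coefficient is `β` plus `ε` times a
centred Gaussian variable of variance at most `σ_j² = C₁⁻¹ (2π/3)^{2ν} 2^{2jν}`
(`exists_coeffEst_eq`). The condition on `Cβ` gives `λ/2 ≥ √(20 ln(1/ε)) σ_j ε`. When the noise is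
below `λ/2`, hard thresholding errs by at most `(9/4) min(β², λ²)`; the opposite event costs `O(ε⁵
(σ_j² ε² + β²))` by a Gaussian tail bound (`lintegral_coeffThr_le`). Only the law of each single
coefficient enters, not the dependence between coefficients.

Put `r = min(p, 2)`, `σᵢ = sᵢ + 1/2 - 1/r` and `τ = ε² ln(1/ε) / A²`. On a Besov ball the `ℓ^r` norm
of the coefficients of a pair of levels is `O(A 2^{-(aσ₁ + a'σ₂)})`. The sum of `min(β², λ²)` there
has three bounds: the whole energy, the interpolation `∑ |β|^r λ^{2-r}`, and the number of
coefficients times `λ²`. Each is `A²` times an exponential in `a`, `a'` and `T = log₂(1/τ)`. Summing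
the minimum of the three over both levels (`tsum_tsum_min_twoPow_le`) is the heart of the proof. Two
exponents cross at one level and the sum is dominated by that level; the signs of two slopes decide
which crossing matters, and so which of the three fractions defining `d` appears. A vanishing slope
means that about `T` levels contribute equally, whence a logarithm.

The other terms are smaller. The noise outside the good event contributes `ε⁷ 2^{(2ν+1)J + J'}`, of
order `ε³`; the truncated levels contribute `A² (2^{-2σ₁J} + 2^{-2σ₂J'})`, which is `O(A² ε^{2d})`
because `σ₁, σ₂ ≥ 1/2` (`exists_risk_le_rate`). -/

theorem enorm_sq_eq_ofReal (x : ℝ) : ‖x‖ₑ ^ 2 = ENNReal.ofReal (x ^ 2) := by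
  rw [← ofReal_norm, ← ENNReal.ofReal_pow (norm_nonneg _), Real.norm_eq_abs, sq_abs]

theorem complex_enorm_sq (z : ℂ) : ‖z‖ₑ ^ 2 = ‖z.re‖ₑ ^ 2 + ‖z.im‖ₑ ^ 2 := by
  rw [enorm_sq_eq_ofReal, enorm_sq_eq_ofReal, ← ENNReal.ofReal_add (sq_nonneg _) (sq_nonneg _),
    ← ofReal_norm, ← ENNReal.ofReal_pow (norm_nonneg _), Complex.sq_norm,
    Complex.normSq_apply]
  ring_nf

theorem lintegral_enorm_sq_eq {F : α → ℝ} (hF : MemLp F 2 μ) :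
    ∫⁻ x, ‖F x‖ₑ ^ 2 ∂μ = ENNReal.ofReal (∫ x, F x ^ 2 ∂μ) := by
  rw [ofReal_integral_eq_lintegral_ofReal hF.integrable_sq (ae_of_all _ fun x => sq_nonneg _)]
  exact lintegral_congr fun x => enorm_sq_eq_ofReal _

theorem memLp_two_of_lintegral_lt_top {E : Type*} [NormedAddCommGroup E] {F : α → E}
    (hF : AEStronglyMeasurable F μ)
    (h : ∫⁻ x, ‖F x‖ₑ ^ 2 ∂μ < ∞) : MemLp F 2 μ := by
  refine ⟨hF, ?_⟩
  rw [eLpNorm_lt_top_iff_lintegral_rpow_enorm_lt_top (by simp) (by simp)]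
  simpa using h

theorem lintegral_enorm_sq_lt_top {E : Type*} [NormedAddCommGroup E] {F : α → E}
    (hF : MemLp F 2 μ) : ∫⁻ x, ‖F x‖ₑ ^ 2 ∂μ < ∞ := by
  have := hF.2
  rw [eLpNorm_lt_top_iff_lintegral_rpow_enorm_lt_top (by simp) (by simp)] at this
  simpa using this

theorem memLp_two_mul_prod {𝕜 : Type*} [NormedField 𝕜] [SFinite ν] {f : α → 𝕜} {g : β → 𝕜}
    (hf : MemLp f 2 μ) (hg : MemLp g 2 ν) :
    MemLp (fun z : α × β => f z.1 * g z.2) 2 (μ.prod ν) := by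
  refine memLp_two_of_lintegral_lt_top (hf.1.comp_fst.mul hg.1.comp_snd) ?_
  simp only [enorm_mul, mul_pow]
  rw [lintegral_prod_mul (hf.1.enorm.pow_const _) (hg.1.enorm.pow_const _)]
  exact ENNReal.mul_lt_top (lintegral_enorm_sq_lt_top hf) (lintegral_enorm_sq_lt_top hg)

/-- `b` is a family of functions representing an orthonormal basis of `L²(μ)`. -/
def IsL2Basis (μ : Measure α) (h : ι → α → ℝ) : Prop :=
  ∃ b : HilbertBasis ι ℝ (Lp ℝ 2 μ), ∀ i, (b i : α → ℝ) =ᵐ[μ] h i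

namespace IsL2Basis

variable {h : ι → α → ℝ} {k : κ → β → ℝ}

theorem memLp (hb : IsL2Basis μ h) (i : ι) : MemLp (h i) 2 μ := by
  obtain ⟨b, hb⟩ := hb
  exact (memLp_congr_ae (hb i)).1 (Lp.memLp (b i))

theorem integral_mul [DecidableEq ι] (hb : IsL2Basis μ h) (i j : ι) :
    ∫ x, h i x * h j x ∂μ = if i = j then 1 else 0 := by
  obtain ⟨b, hb⟩ := hb
  rw [← orthonormal_iff_ite.1 b.orthonormal i j, L2.inner_def]
  refine integral_congr_ae ?_
  filter_upwards [hb i, hb j] with x hi hj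
  simp [hi, hj, mul_comm]

theorem tsum_enorm_sq (hb : IsL2Basis μ h) {F : α → ℝ} (hF : MemLp F 2 μ) :
    ∑' i, ‖∫ x, F x * h i x ∂μ‖ₑ ^ 2 = ∫⁻ x, ‖F x‖ₑ ^ 2 ∂μ := by
  obtain ⟨b, hb⟩ := hb
  have h1 : ∀ i, ∫ x, F x * h i x ∂μ = inner ℝ (b i) (hF.toLp F) := fun i => by
    rw [L2.inner_def]
    refine integral_congr_ae ?_
    filter_upwards [hb i, hF.coeFn_toLp] with x hi hj
    simp [hi, hj]
  have h2 : ∫ x, F x ^ 2 ∂μ = inner ℝ (hF.toLp F) (hF.toLp F) := by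
    rw [L2.inner_def]
    refine integral_congr_ae ?_
    filter_upwards [hF.coeFn_toLp] with x hj
    simp [hj, sq]
  have h3 := b.hasSum_inner_mul_inner (hF.toLp F) (hF.toLp F)
  rw [lintegral_enorm_sq_eq hF, h2, ← h3.tsum_eq, ENNReal.ofReal_tsum_of_nonneg _ h3.summable]
  · refine tsum_congr fun i => ?_
    rw [enorm_sq_eq_ofReal, h1, real_inner_comm (b i) (hF.toLp F), sq]
  · intro i
    rw [real_inner_comm (b i) (hF.toLp F)]
    exact mul_self_nonneg _

variable [SFinite ν]

theorem _root_.MeasureTheory.MemLp.ae_memLp_two_section {E : Type*} [NormedAddCommGroup E]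
    {F : α × β → E} (hF : MemLp F 2 (μ.prod ν)) :
    ∀ᵐ u ∂μ, MemLp (fun x => F (u, x)) 2 ν := by
  have h1 := lintegral_enorm_sq_lt_top hF
  rw [lintegral_prod _ (hF.1.enorm.pow_const _)] at h1
  have h2 : AEMeasurable (fun u => ∫⁻ x, ‖F (u, x)‖ₑ ^ 2 ∂ν) μ :=
    (hF.1.enorm.pow_const _).lintegral_prod_right'
  filter_upwards [ae_lt_top' h2 h1.ne, hF.1.prodMk_left] with u hu hu'
  exact memLp_two_of_lintegral_lt_top hu' hu

/-- Cauchy–Schwarz on almost every section bounds the squared integral by the product of two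
energies, and the energy of the section is integrable in `u`. -/
theorem memLp_section_coeff {𝕜 : Type*} [RCLike 𝕜] {k : β → 𝕜} (hk : MemLp k 2 ν)
    {F : α × β → 𝕜}
    (hF : MemLp F 2 (μ.prod ν)) : MemLp (fun u => ∫ x, F (u, x) * k x ∂ν) 2 μ := by
  have hm : AEStronglyMeasurable (fun z : α × β => F z * k z.2) (μ.prod ν) :=
    hF.1.mul hk.1.comp_snd
  refine memLp_two_of_lintegral_lt_top hm.integral_prod_right' ?_
  have h1 := lintegral_enorm_sq_lt_top hF
  rw [lintegral_prod _ (hF.1.enorm.pow_const _)] at h1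
  have h2 := lintegral_enorm_sq_lt_top hk
  have key : ∀ᵐ u ∂μ, ‖∫ x, F (u, x) * k x ∂ν‖ₑ ^ 2 ≤
      (∫⁻ x, ‖F (u, x)‖ₑ ^ 2 ∂ν) * ∫⁻ x, ‖k x‖ₑ ^ 2 ∂ν := by
    filter_upwards [hF.1.prodMk_left] with u hu
    have h3 : ‖∫ x, F (u, x) * k x ∂ν‖ₑ ≤ ∫⁻ x, ‖F (u, x)‖ₑ * ‖k x‖ₑ ∂ν := by
      refine (enorm_integral_le_lintegral_enorm _).trans_eq ?_
      simp only [enorm_mul]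
    have h4 := ENNReal.lintegral_mul_le_Lp_mul_Lq ν Real.HolderConjugate.two_two
      hu.enorm hk.1.enorm
    simp only [Pi.mul_apply] at h4
    refine (pow_le_pow_left' (h3.trans h4) 2).trans_eq ?_
    rw [mul_pow, ← ENNReal.rpow_natCast, ← ENNReal.rpow_natCast, ← ENNReal.rpow_mul,
      ← ENNReal.rpow_mul]
    norm_num
  refine (lintegral_mono_ae key).trans_lt ?_
  rw [lintegral_mul_const' _ _ h2.ne]
  exact ENNReal.mul_lt_top h1 h2

/-- Parseval is used twice, in `u` for each fixed `j` and then in `x` on almost every section, so no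
Hilbert basis of the product space has to be built. -/
theorem tsum_tsum_enorm_sq [SFinite μ] [Countable κ] (hh : IsL2Basis μ h) (hk : IsL2Basis ν k)
    {F : α × β → ℝ}
    (hF : MemLp F 2 (μ.prod ν)) :
    ∑' j, ∑' i, ‖∫ u, (∫ x, F (u, x) * k j x ∂ν) * h i u ∂μ‖ₑ ^ 2 =
      ∫⁻ z, ‖F z‖ₑ ^ 2 ∂(μ.prod ν) := by
  have h1 : ∀ j, ∑' i, ‖∫ u, (∫ x, F (u, x) * k j x ∂ν) * h i u ∂μ‖ₑ ^ 2 =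
      ∫⁻ u, ‖∫ x, F (u, x) * k j x ∂ν‖ₑ ^ 2 ∂μ := fun j =>
    hh.tsum_enorm_sq (memLp_section_coeff (hk.memLp j) hF)
  simp_rw [h1]
  rw [← lintegral_tsum fun j => (memLp_section_coeff (hk.memLp j) hF).1.enorm.pow_const _,
    lintegral_prod _ (hF.1.enorm.pow_const _)]
  refine lintegral_congr_ae ?_
  filter_upwards [hF.ae_memLp_two_section] with u hu
  exact hk.tsum_enorm_sq hu

end IsL2Basis

end Parseval

/-! ### The tensor product basis and the loss of a truncated wavelet series -/

namespace WaveletSystem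

variable (w : WaveletSystem)

theorem isL2Basis_psi :
    IsL2Basis volume fun i : Σ a : ℕ, Fin (translates w.m₀ a) => w.psi i.1 i.2 :=
  w.meyer.basis

theorem isL2Basis_eta :
    IsL2Basis volume fun i : Σ a : ℕ, Fin (translates w.m₀' a) => w.eta i.1 i.2 :=
  w.finite.basis

variable {w}

theorem memLp_psi {a k : ℕ} (hk : k < translates w.m₀ a) : MemLp (w.psi a k) 2 volume :=
  w.isL2Basis_psi.memLp ⟨a, k, hk⟩

theorem memLp_eta {a k : ℕ} (hk : k < translates w.m₀' a) : MemLp (w.eta a k) 2 volume :=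
  w.isL2Basis_eta.memLp ⟨a, k, hk⟩

theorem sigma_fin_eq_iff {t : ℕ → ℕ} {a b k l : ℕ} (hk : k < t a) (hl : l < t b) :
    (⟨a, k, hk⟩ : Σ a, Fin (t a)) = ⟨b, l, hl⟩ ↔ a = b ∧ k = l := by
  constructor
  · intro h
    obtain rfl : a = b := congrArg Sigma.fst h
    simpa using h
  · rintro ⟨rfl, rfl⟩
    rfl

theorem integral_psi_mul_psi {a k b l : ℕ} (hk : k < translates w.m₀ a)
    (hl : l < translates w.m₀ b) :
    ∫ x, w.psi a k x * w.psi b l x = if a = b ∧ k = l then 1 else 0 := by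
  classical
  have := w.isL2Basis_psi.integral_mul ⟨a, k, hk⟩ ⟨b, l, hl⟩
  simp only [sigma_fin_eq_iff] at this
  exact this

theorem integral_eta_mul_eta {a k b l : ℕ} (hk : k < translates w.m₀' a)
    (hl : l < translates w.m₀' b) :
    ∫ x, w.eta a k x * w.eta b l x = if a = b ∧ k = l then 1 else 0 := by
  classical
  have := w.isL2Basis_eta.integral_mul ⟨a, k, hk⟩ ⟨b, l, hl⟩
  simp only [sigma_fin_eq_iff] at this
  exact this

theorem memLp_psi_mul_eta {a k a' k' : ℕ} (hk : k < translates w.m₀ a)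
    (hk' : k' < translates w.m₀' a') :
    MemLp (fun x : Torus2 => w.psi a k x.2 * w.eta a' k' x.1) 2 volume := by
  have h := memLp_two_mul_prod (memLp_eta hk') (memLp_psi hk)
  rw [Measure.volume_eq_prod]
  simpa only [mul_comm] using h

theorem coeff_eq_integral {f : Torus2 → ℝ} (hf : MemLp f 2 volume) {a k a' k' : ℕ}
    (hk : k < translates w.m₀ a) (hk' : k' < translates w.m₀' a') :
    w.coeff f a k a' k' = ∫ x : Torus2, f x * (w.psi a k x.2 * w.eta a' k' x.1) := by
  have hi : Integrable (fun x : Torus2 => f x * (w.psi a k x.2 * w.eta a' k' x.1)) volume :=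
    hf.integrable_mul (memLp_psi_mul_eta hk hk')
  rw [Measure.volume_eq_prod] at hi ⊢
  rw [integral_prod _ hi]
  simp only [coeff, ← integral_mul_const, mul_assoc]

theorem tsum_tsum_coeff {f : Torus2 → ℝ} (hf : MemLp f 2 volume) :
    ∑' a, ∑' a', ∑ k ∈ Finset.range (translates w.m₀ a),
      ∑ k' ∈ Finset.range (translates w.m₀' a'), ‖w.coeff f a k a' k'‖ₑ ^ 2 =
        ∫⁻ x, ‖f x‖ₑ ^ 2 := by
  rw [Measure.volume_eq_prod] at hf ⊢
  rw [← w.isL2Basis_eta.tsum_tsum_enorm_sq w.isL2Basis_psi hf,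
    ENNReal.summable.tsum_sigma' fun _ => ENNReal.summable]
  refine tsum_congr fun a => ?_
  simp_rw [ENNReal.summable.tsum_sigma' fun _ => ENNReal.summable, tsum_fintype]
  rw [← Summable.tsum_finsetSum fun _ _ => ENNReal.summable]
  refine tsum_congr fun a' => ?_
  rw [Finset.sum_range]
  refine Finset.sum_congr rfl fun k _ => ?_
  rw [Finset.sum_range]
  rfl

/-- The real wavelet sum over the levels `a < R`, `a' < R'`. -/
def partialSum (w : WaveletSystem) (R R' : ℕ) (c : ℕ → ℕ → ℕ → ℕ → ℝ) (x : Torus2) : ℝ :=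
  ∑ a ∈ Finset.range R, ∑ a' ∈ Finset.range R',
    ∑ k ∈ Finset.range (translates w.m₀ a), ∑ k' ∈ Finset.range (translates w.m₀' a'),
      c a k a' k' * (w.psi a k x.2 * w.eta a' k' x.1)

theorem memLp_partialSum (R R' : ℕ) (c : ℕ → ℕ → ℕ → ℕ → ℝ) :
    MemLp (w.partialSum R R' c) 2 volume := by
  unfold partialSum
  refine memLp_finsetSum _ fun a _ => memLp_finsetSum _ fun a' _ => memLp_finsetSum _ fun k hk =>
    memLp_finsetSum _ fun k' hk' => ?_
  exact (memLp_psi_mul_eta (Finset.mem_range.1 hk) (Finset.mem_range.1 hk')).const_mul _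

theorem coeff_sub {f g : Torus2 → ℝ} (hf : MemLp f 2 volume) (hg : MemLp g 2 volume)
    {a k a' k' : ℕ} (hk : k < translates w.m₀ a) (hk' : k' < translates w.m₀' a') :
    w.coeff (fun x => f x - g x) a k a' k' = w.coeff f a k a' k' - w.coeff g a k a' k' := by
  rw [coeff_eq_integral hf hk hk', coeff_eq_integral hg hk hk',
    coeff_eq_integral (f := fun x => f x - g x) (hf.sub hg) hk hk', ← integral_sub]
  · simp only [sub_mul]
  · exact hf.integrable_mul (memLp_psi_mul_eta hk hk')
  · exact hg.integrable_mul (memLp_psi_mul_eta hk hk')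

/-- The integral of each summand factorises over the two variables, and orthonormality in both
leaves only the term with matching indices, if it is present. -/
theorem coeff_partialSum (R R' : ℕ) (c : ℕ → ℕ → ℕ → ℕ → ℝ) {a k a' k' : ℕ}
    (hk : k < translates w.m₀ a) (hk' : k' < translates w.m₀' a') :
    w.coeff (w.partialSum R R' c) a k a' k' =
      if a < R ∧ a' < R' then c a k a' k' else 0 := by
  have hi : ∀ b l b' l', l < translates w.m₀ b → l' < translates w.m₀' b' →
      Integrable (fun x : Torus2 => c b l b' l' * (w.psi b l x.2 * w.eta b' l' x.1) *
        (w.psi a k x.2 * w.eta a' k' x.1)) volume := fun b l b' l' hl hl' =>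
    ((memLp_psi_mul_eta hl hl').const_mul _).integrable_mul (memLp_psi_mul_eta hk hk')
  have hone : ∀ b l b' l', l < translates w.m₀ b → l' < translates w.m₀' b' →
      ∫ x : Torus2, c b l b' l' * (w.psi b l x.2 * w.eta b' l' x.1) *
        (w.psi a k x.2 * w.eta a' k' x.1) =
      if b = a then if b' = a' then if l = k then if l' = k' then c b l b' l' else 0 else 0
        else 0 else 0 := by
    intro b l b' l' hl hl'
    have h1 := integral_prod_mul (μ := (volume : Measure UnitAddCircle))
      (ν := (volume : Measure UnitAddCircle))
      (fun u => w.eta b' l' u * w.eta a' k' u) (fun x => w.psi b l x * w.psi a k x)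
    rw [integral_psi_mul_psi hl hk, integral_eta_mul_eta hl' hk'] at h1
    rw [Measure.volume_eq_prod]
    have h2 : ∀ x : Torus2, c b l b' l' * (w.psi b l x.2 * w.eta b' l' x.1) *
        (w.psi a k x.2 * w.eta a' k' x.1) = c b l b' l' *
        ((w.eta b' l' x.1 * w.eta a' k' x.1) * (w.psi b l x.2 * w.psi a k x.2)) :=
      fun x => by ring
    simp_rw [h2]
    rw [integral_const_mul, h1]
    by_cases e1 : b = a <;> by_cases e2 : b' = a' <;> by_cases e3 : l = k <;>
      by_cases e4 : l' = k' <;> simp [e1, e2, e3, e4]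
  rw [coeff_eq_integral (memLp_partialSum R R' c) hk hk']
  simp only [partialSum, Finset.sum_mul]
  rw [integral_finsetSum]
  swap
  · exact fun b _ => integrable_finsetSum _ fun b' _ => integrable_finsetSum _ fun l hl =>
      integrable_finsetSum _ fun l' hl' =>
        hi b l b' l' (Finset.mem_range.1 hl) (Finset.mem_range.1 hl')
  have hsum : ∀ b ∈ Finset.range R, ∫ x : Torus2, ∑ b' ∈ Finset.range R',
      ∑ l ∈ Finset.range (translates w.m₀ b), ∑ l' ∈ Finset.range (translates w.m₀' b'),
        c b l b' l' * (w.psi b l x.2 * w.eta b' l' x.1) * (w.psi a k x.2 * w.eta a' k' x.1) =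
      ∑ b' ∈ Finset.range R', ∑ l ∈ Finset.range (translates w.m₀ b),
        ∑ l' ∈ Finset.range (translates w.m₀' b'), if b = a then if b' = a' then
          if l = k then if l' = k' then c b l b' l' else 0 else 0 else 0 else 0 := by
    intro b _
    rw [integral_finsetSum]
    swap
    · exact fun b' _ => integrable_finsetSum _ fun l hl => integrable_finsetSum _ fun l' hl' =>
        hi b l b' l' (Finset.mem_range.1 hl) (Finset.mem_range.1 hl')
    refine Finset.sum_congr rfl fun b' _ => ?_
    rw [integral_finsetSum]
    swap
    · exact fun l hl => integrable_finsetSum _ fun l' hl' =>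
        hi b l b' l' (Finset.mem_range.1 hl) (Finset.mem_range.1 hl')
    refine Finset.sum_congr rfl fun l hl => ?_
    rw [integral_finsetSum]
    swap
    · exact fun l' hl' => hi b l b' l' (Finset.mem_range.1 hl) (Finset.mem_range.1 hl')
    exact Finset.sum_congr rfl fun l' hl' =>
      hone b l b' l' (Finset.mem_range.1 hl) (Finset.mem_range.1 hl')
  rw [Finset.sum_congr rfl hsum]
  by_cases hR : a < R
  · rw [Finset.sum_eq_single_of_mem a (Finset.mem_range.2 hR) (fun b _ hb => by simp [hb])]
    by_cases hR' : a' < R'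
    · rw [Finset.sum_eq_single_of_mem a' (Finset.mem_range.2 hR') (fun b _ hb => by simp [hb])]
      rw [Finset.sum_eq_single_of_mem k (Finset.mem_range.2 hk) (fun b _ hb => by simp [hb])]
      rw [Finset.sum_eq_single_of_mem k' (Finset.mem_range.2 hk') (fun b _ hb => by simp [hb])]
      simp [hR, hR']
    · rw [Finset.sum_eq_zero]
      · simp [hR']
      · intro b hb
        have : b ≠ a' := fun h => hR' (h ▸ Finset.mem_range.1 hb)
        simp [this]
  · rw [Finset.sum_eq_zero]
    · simp [hR]
    · intro b hb
      have : b ≠ a := fun h => hR (h ▸ Finset.mem_range.1 hb)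
      simp [this]

theorem lintegral_partialSum_sub (R R' : ℕ) (c : ℕ → ℕ → ℕ → ℕ → ℝ) {f : Torus2 → ℝ}
    (hf : MemLp f 2 volume) :
    ∫⁻ x, ‖w.partialSum R R' c x - f x‖ₑ ^ 2 =
      ∑' a, ∑' a', ∑ k ∈ Finset.range (translates w.m₀ a),
        ∑ k' ∈ Finset.range (translates w.m₀' a'),
          ‖(if a < R ∧ a' < R' then c a k a' k' else 0) - w.coeff f a k a' k'‖ₑ ^ 2 := by
  rw [← tsum_tsum_coeff (w := w) (f := fun x => w.partialSum R R' c x - f x)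
    ((memLp_partialSum R R' c).sub hf)]
  refine tsum_congr fun a => tsum_congr fun a' => Finset.sum_congr rfl fun k hk =>
    Finset.sum_congr rfl fun k' hk' => ?_
  have hk := Finset.mem_range.1 hk
  have hk' := Finset.mem_range.1 hk'
  rw [← coeff_partialSum R R' c hk hk', ← coeff_sub (memLp_partialSum R R' c) hf hk hk']

end WaveletSystem

/-- The squared loss of a truncated wavelet series, in terms of its coefficients. -/
theorem lintegral_waveletSum_sub (w : WaveletSystem) (R R' : ℕ) (c : ℕ → ℕ → ℕ → ℕ → ℂ)
    {f : Torus2 → ℝ} (hf : MemLp f 2 volume) :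
    ∫⁻ x : Torus2, ‖(∑ a ∈ Finset.range R, ∑ a' ∈ Finset.range R',
      ∑ k ∈ Finset.range (translates w.m₀ a), ∑ k' ∈ Finset.range (translates w.m₀' a'),
        c a k a' k' * (w.psi a k x.2 : ℂ) * (w.eta a' k' x.1 : ℂ)) - (f x : ℂ)‖ₑ ^ 2 =
      ∑' a, ∑' a', ∑ k ∈ Finset.range (translates w.m₀ a),
        ∑ k' ∈ Finset.range (translates w.m₀' a'),
          ‖(if a < R ∧ a' < R' then c a k a' k' else 0) - (w.coeff f a k a' k' : ℂ)‖ₑ ^ 2 := by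
  -- The basis and `f` are real, so a complex series splits into a real one compared with `f` and
  -- another one compared with `0`.
  have hre : ∀ x : Torus2, ‖(∑ a ∈ Finset.range R, ∑ a' ∈ Finset.range R',
      ∑ k ∈ Finset.range (translates w.m₀ a), ∑ k' ∈ Finset.range (translates w.m₀' a'),
        c a k a' k' * (w.psi a k x.2 : ℂ) * (w.eta a' k' x.1 : ℂ)) - (f x : ℂ)‖ₑ ^ 2 =
      ‖w.partialSum R R' (fun a k a' k' => (c a k a' k').re) x - f x‖ₑ ^ 2 +
      ‖w.partialSum R R' (fun a k a' k' => (c a k a' k').im) x - 0‖ₑ ^ 2 := by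
    intro x
    rw [complex_enorm_sq]
    simp only [WaveletSystem.partialSum, Complex.sub_re, Complex.re_sum, Complex.sub_im,
      Complex.im_sum, mul_assoc, ← Complex.ofReal_mul, Complex.re_mul_ofReal,
      Complex.im_mul_ofReal, Complex.ofReal_re, Complex.ofReal_im]
  simp_rw [hre]
  rw [lintegral_add_left', WaveletSystem.lintegral_partialSum_sub R R' _ hf,
    WaveletSystem.lintegral_partialSum_sub R R' _ (MemLp.zero' (p := 2)), ← ENNReal.tsum_add]
  · refine tsum_congr fun a => ?_
    rw [← ENNReal.tsum_add]
    refine tsum_congr fun a' => ?_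
    rw [← Finset.sum_add_distrib]
    refine Finset.sum_congr rfl fun k _ => ?_
    rw [← Finset.sum_add_distrib]
    refine Finset.sum_congr rfl fun k' _ => ?_
    rw [complex_enorm_sq]
    have h0 : w.coeff (fun _ => 0) a k a' k' = 0 := by simp [WaveletSystem.coeff]
    rw [h0]
    split_ifs <;> simp
  · exact ((WaveletSystem.memLp_partialSum R R' _).1.sub hf.1).enorm.pow_const _

/-! ### Fourier coefficients of periodized functions -/

theorem volume_eq_haarAddCircle :
    (volume : Measure UnitAddCircle) = AddCircle.haarAddCircle := by
  rw [AddCircle.volume_eq_smul_haarAddCircle, ENNReal.ofReal_one, one_smul]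

theorem fourierCoeff_eq_integral (f : UnitAddCircle → ℂ) (m : ℤ) :
    fourierCoeff f m = ∫ t, fourier (-m) t * f t := by
  rw [volume_eq_haarAddCircle]
  rfl

/-- Unfolding: `e_{-m}` has period one, so the integral over a period of the sum of integer
translates is an integral over the whole line. -/
theorem fourierCoeff_periodized {χ : ℝ → ℝ} (hχ : Integrable χ) (j k : ℕ) (m : ℤ) :
    fourierCoeff (fun t => (periodized χ j k t : ℂ)) m =
      ∫ x : ℝ, Complex.exp (-(2 * Real.pi * m * x * Complex.I)) *
        (((2 : ℝ) ^ ((j : ℝ) / 2) * χ (2 ^ j * x - k) : ℝ) : ℂ) := by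
  set F : ℝ → ℂ := fun x => Complex.exp (-(2 * Real.pi * m * x * Complex.I)) *
        (((2 : ℝ) ^ ((j : ℝ) / 2) * χ (2 ^ j * x - k) : ℝ) : ℂ) with hF
  have hχ' : Integrable fun x : ℝ => (2 : ℝ) ^ ((j : ℝ) / 2) * χ (2 ^ j * x - k) :=
    ((hχ.comp_sub_right (k : ℝ)).comp_mul_left' (R := (2 : ℝ) ^ j) (by positivity)).const_mul _
  have hFi : Integrable F := by
    refine Integrable.bdd_mul (c := 1) hχ'.ofReal (by fun_prop) (ae_of_all _ fun x => ?_)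
    rw [show -(2 * Real.pi * m * x * Complex.I) = ((-(2 * Real.pi * m * x) : ℝ) : ℂ) * Complex.I by
      push_cast; ring, Complex.norm_exp_ofReal_mul_I]
  rw [fourierCoeff_eq_intervalIntegral _ _ 0]
  simp only [div_one, one_smul, zero_add, smul_eq_mul]
  have hpt : ∀ x : ℝ, fourier (-m) (x : UnitAddCircle) * (periodized χ j k x : ℂ) =
      ∑' n : ℤ, F (x + n) := by
    intro x
    have h1 : periodized χ j k (x : UnitAddCircle) =
        ∑' n : ℤ, (2 : ℝ) ^ ((j : ℝ) / 2) * χ (2 ^ j * (x + n) - k) :=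
      Function.Periodic.lift_coe _ _
    rw [h1, Complex.ofReal_tsum, ← tsum_mul_left]
    refine tsum_congr fun n => ?_
    simp only [hF]
    rw [fourier_coe_apply]
    congr 1
    rw [Complex.exp_eq_exp_iff_exists_int]
    refine ⟨m * n, ?_⟩
    push_cast
    ring
  simp_rw [hpt]
  rw [← hFi.hasSum_intervalIntegral_comp_add_int.tsum_eq]
  simp only [intervalIntegral.integral_of_le zero_le_one]
  rw [integral_tsum_of_summable_integral_norm]
  · intro n
    exact (hFi.comp_add_right (n : ℝ)).integrableOn
  · have := hFi.norm.hasSum_intervalIntegral_comp_add_int.summable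
    simpa only [intervalIntegral.integral_of_le zero_le_one] using this

/-- The substitution `y = 2^j x - k` turns the integral over the line into a constant times the
Fourier transform of `χ` at `m / 2^j`. -/
theorem fourierCoeff_periodized_eq_zero {χ : ℝ → ℝ} (hχ : Integrable χ) (j k : ℕ) (m : ℤ)
    (h : 𝓕 (fun x : ℝ => (χ x : ℂ)) (m / 2 ^ j) = 0) :
    fourierCoeff (fun t => (periodized χ j k t : ℂ)) m = 0 := by
  rw [fourierCoeff_periodized hχ]
  rw [Real.fourier_real_eq_integral_exp_smul] at h
  have h2 : (2 : ℝ) ^ j ≠ 0 := by positivity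
  set G : ℝ → ℂ := fun y =>
    Complex.exp (-(2 * Real.pi * m * ((y + k) / 2 ^ j) * Complex.I)) *
      (((2 : ℝ) ^ ((j : ℝ) / 2) * χ y : ℝ) : ℂ) with hG
  have h3 : ∀ x : ℝ, Complex.exp (-(2 * Real.pi * m * x * Complex.I)) *
        (((2 : ℝ) ^ ((j : ℝ) / 2) * χ (2 ^ j * x - k) : ℝ) : ℂ) = G (2 ^ j * x - k) := by
    intro x
    simp only [hG]
    congr 4
    push_cast
    rw [sub_add_cancel, mul_div_cancel_left₀ _ (pow_ne_zero _ two_ne_zero)]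
  simp_rw [h3]
  rw [Measure.integral_comp_mul_left (fun x => G (x - k)), integral_sub_right_eq_self]
  have h4 : ∀ y, G y = (Complex.exp (-(2 * Real.pi * m * (k / 2 ^ j) * Complex.I)) *
      (((2 : ℝ) ^ ((j : ℝ) / 2) : ℝ) : ℂ)) *
      (Complex.exp (((-2 * Real.pi * y * (m / 2 ^ j) : ℝ) : ℂ) * Complex.I) • (χ y : ℂ)) := by
    intro y
    simp only [hG, smul_eq_mul]
    have : Complex.exp (-(2 * Real.pi * m * ((y + k) / 2 ^ j) * Complex.I)) =
        Complex.exp (-(2 * Real.pi * m * (k / 2 ^ j) * Complex.I)) *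
        Complex.exp (((-2 * Real.pi * y * (m / 2 ^ j) : ℝ) : ℂ) * Complex.I) := by
      rw [← Complex.exp_add]
      congr 1
      push_cast
      ring
    rw [this]
    push_cast
    ring
  simp_rw [h4]
  rw [integral_const_mul, h, mul_zero, smul_zero]

theorem neg_one_le_level (m₀ a : ℕ) : -1 ≤ level m₀ a := by
  unfold level
  have : (0 : ℝ) ≤ m₀ := by positivity
  have : (0 : ℝ) ≤ a := by positivity
  linarith

namespace WaveletSystem

variable {w : WaveletSystem}

/-- The scaling functions have resolution `m₀` and half the bandwidth of the wavelets; assigning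
them to level `m₀ - 1` gives both the same constant `4/3`. -/
theorem abs_le_of_mem_band {a k : ℕ} {m : ℤ} (hm : m ∈ w.band a k) :
    |(m : ℝ)| ≤ 4 / 3 * (2 : ℝ) ^ level w.m₀ a := by
  have hm' : w.psiCoeff a k m ≠ 0 := hm
  have hpi := Real.pi_pos
  cases a with
  | zero =>
    have h1 : 𝓕 (fun x : ℝ => (w.φ x : ℂ)) (m / 2 ^ w.m₀) ≠ 0 := fun h => hm'
      (fourierCoeff_periodized_eq_zero w.meyer.integrable_scaling _ _ _ h)
    have h2 := w.meyer.band_scaling _ h1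
    have h3 : |(m : ℝ) / 2 ^ w.m₀| ≤ 2 / 3 := by nlinarith
    rw [abs_div, abs_of_pos (by positivity : (0 : ℝ) < 2 ^ w.m₀), div_le_iff₀ (by positivity)] at h3
    have h4 : (2 : ℝ) ^ level w.m₀ 0 = 2 ^ w.m₀ / 2 := by
      simp only [level, CharP.cast_eq_zero, add_zero]
      rw [Real.rpow_sub_one (by norm_num), Real.rpow_natCast]
    rw [h4]
    linarith
  | succ a =>
    have h1 : 𝓕 (fun x : ℝ => (w.ψ x : ℂ)) (m / 2 ^ (w.m₀ + a)) ≠ 0 := fun h => hm'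
      (fourierCoeff_periodized_eq_zero w.meyer.integrable_wavelet _ _ _ h)
    have h2 := (w.meyer.band_wavelet _ h1).2
    have h3 : |(m : ℝ) / 2 ^ (w.m₀ + a)| ≤ 4 / 3 := by nlinarith
    rw [abs_div, abs_of_pos (by positivity : (0 : ℝ) < 2 ^ (w.m₀ + a)),
      div_le_iff₀ (by positivity)] at h3
    have h4 : (2 : ℝ) ^ level w.m₀ (a + 1) = 2 ^ (w.m₀ + a) := by
      rw [← Real.rpow_natCast]
      simp only [level]
      push_cast
      congr 1
      ring
    rwa [h4]

theorem finite_band (a k : ℕ) : (w.band a k).Finite := by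
  obtain ⟨N, hN⟩ := exists_nat_ge (4 / 3 * (2 : ℝ) ^ level w.m₀ a)
  refine (Set.finite_Icc (-(N : ℤ)) N).subset fun m hm => ?_
  have h := (abs_le_of_mem_band hm).trans hN
  rw [abs_le] at h
  constructor <;> [exact_mod_cast h.1; exact_mod_cast h.2]

/-- The constant `2π/3` has to exceed `4/3`, for the band, and `2`, because the level can be `-1`
while the left side is at least `1`. Both follow from `π > 3`. -/
theorem max_one_abs_le_of_mem_band {a k : ℕ} {m : ℤ} (hm : m ∈ w.band a k) :
    max 1 |(m : ℝ)| ≤ 2 * Real.pi / 3 * (2 : ℝ) ^ level w.m₀ a := by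
  have hpi := Real.pi_gt_three
  have h1 : (2 : ℝ)⁻¹ ≤ (2 : ℝ) ^ level w.m₀ a := by
    rw [← Real.rpow_neg_one]
    exact Real.rpow_le_rpow_of_exponent_le one_le_two (neg_one_le_level _ _)
  refine max_le (by nlinarith) ((abs_le_of_mem_band hm).trans ?_)
  nlinarith

theorem conj_psiCoeff (a k : ℕ) (m : ℤ) : conj (w.psiCoeff a k m) = w.psiCoeff a k (-m) := by
  unfold psiCoeff
  rw [fourierCoeff_eq_integral, fourierCoeff_eq_integral, ← integral_conj]
  refine integral_congr_ae (ae_of_all _ fun t => ?_)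
  simp only [map_mul, Complex.conj_ofReal, neg_neg]
  rw [← fourier_neg, neg_neg]

theorem neg_mem_band {a k : ℕ} {m : ℤ} : -m ∈ w.band a k ↔ m ∈ w.band a k := by
  change w.psiCoeff a k (-m) ≠ 0 ↔ w.psiCoeff a k m ≠ 0
  rw [← conj_psiCoeff, ne_eq, map_eq_zero]

end WaveletSystem

/-! ### Fourier series on the circle and convolutions -/

theorem memLp_fourier (m : ℤ) : MemLp (fun t : UnitAddCircle => fourier m t) 2 volume := by
  refine MemLp.of_bound (by fun_prop) 1 (ae_of_all _ fun t => (Circle.norm_coe _).le)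

theorem hasSum_conj_fourierCoeff_mul {F G : UnitAddCircle → ℂ} (hF : MemLp F 2 volume)
    (hG : MemLp G 2 volume) :
    HasSum (fun m => conj (fourierCoeff G m) * fourierCoeff F m) (∫ t, F t * conj (G t)) := by
  rw [volume_eq_haarAddCircle] at *
  have h := fourierBasis.hasSum_inner_mul_inner (hG.toLp G) (hF.toLp F)
  have key : ∀ {H : UnitAddCircle → ℂ} (hH : MemLp H 2 AddCircle.haarAddCircle) (m : ℤ),
      inner ℂ (fourierBasis m) (hH.toLp H) = fourierCoeff H m := by
    intro H hH m
    rw [← HilbertBasis.repr_apply_apply, fourierBasis_repr]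
    refine integral_congr_ae ?_
    filter_upwards [hH.coeFn_toLp] with t ht
    rw [ht]
  have h2 : inner ℂ (hG.toLp G) (hF.toLp F) = ∫ t, F t * conj (G t) ∂AddCircle.haarAddCircle := by
    rw [L2.inner_def]
    refine integral_congr_ae ?_
    filter_upwards [hF.coeFn_toLp, hG.coeFn_toLp] with t ht ht'
    simp [ht, ht']
  rw [h2] at h
  refine h.congr_fun fun m => ?_
  rw [key hF m, ← inner_conj_symm, key hG m]

theorem tsum_enorm_sq_fourierCoeff {F : UnitAddCircle → ℂ} (hF : MemLp F 2 volume) :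
    ∑' m, ‖fourierCoeff F m‖ₑ ^ 2 = ∫⁻ t, ‖F t‖ₑ ^ 2 := by
  have h := hasSum_conj_fourierCoeff_mul hF hF
  have h1 : HasSum (fun m => ‖fourierCoeff F m‖ ^ 2) (∫ t, ‖F t‖ ^ 2) := by
    rw [← Complex.hasSum_ofReal]
    have e : ((∫ t, ‖F t‖ ^ 2 : ℝ) : ℂ) = ∫ t, F t * conj (F t) := by
      rw [← integral_complex_ofReal]
      refine integral_congr_ae (ae_of_all _ fun t => ?_)
      simp only [Complex.mul_conj']
      norm_cast
    rw [e]
    refine h.congr_fun fun m => ?_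
    rw [Complex.conj_mul']
    norm_cast
  have h2 : ∫⁻ t, ‖F t‖ₑ ^ 2 = ENNReal.ofReal (∫ t, ‖F t‖ ^ 2) := by
    rw [ofReal_integral_eq_lintegral_ofReal (hF.integrable_norm_pow (by simp))
      (ae_of_all _ fun t => by positivity)]
    refine lintegral_congr fun t => ?_
    rw [ENNReal.ofReal_pow (norm_nonneg _), ofReal_norm]
  rw [h2, ← h1.tsum_eq, ENNReal.ofReal_tsum_of_nonneg (fun _ => by positivity) h1.summable]
  refine tsum_congr fun m => ?_
  rw [ENNReal.ofReal_pow (norm_nonneg _), ofReal_norm]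

/-- Cauchy–Schwarz for the splitting `a b = √a · (√a b)`, that is, with `a` as a weight. -/
theorem lintegral_mul_sq_le {α : Type*} [MeasurableSpace α] {μ : Measure α} {a b : α → ℝ≥0∞}
    (ha : AEMeasurable a μ) (hb : AEMeasurable b μ) :
    (∫⁻ x, a x * b x ∂μ) ^ 2 ≤ (∫⁻ x, a x ∂μ) * ∫⁻ x, a x * b x ^ 2 ∂μ := by
  have h := ENNReal.lintegral_mul_le_Lp_mul_Lq μ Real.HolderConjugate.two_two
    (ha.pow_const (1 / 2 : ℝ)) ((ha.pow_const (1 / 2 : ℝ)).mul hb)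
  have e1 : ∀ x, a x ^ (1 / 2 : ℝ) * (a x ^ (1 / 2 : ℝ) * b x) = a x * b x := fun x => by
    rw [← mul_assoc, ← ENNReal.rpow_add_of_nonneg _ _ (by norm_num) (by norm_num)]
    norm_num
  have e2 : ∀ x, (a x ^ (1 / 2 : ℝ)) ^ (2 : ℝ) = a x := fun x => by
    rw [← ENNReal.rpow_mul]; norm_num
  have e3 : ∀ x, (a x ^ (1 / 2 : ℝ) * b x) ^ (2 : ℝ) = a x * b x ^ 2 := fun x => by
    rw [ENNReal.mul_rpow_of_nonneg _ _ (by norm_num), e2]; norm_num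
  simp only [Pi.mul_apply, e1, e2, e3] at h
  refine (pow_le_pow_left' h 2).trans_eq ?_
  rw [mul_pow, ← ENNReal.rpow_natCast, ← ENNReal.rpow_natCast, ← ENNReal.rpow_mul,
    ← ENNReal.rpow_mul]
  norm_num

/-- Young's inequality for `L¹ * L²`: Cauchy–Schwarz with weight `|g(t - y)|`, then Tonelli and
translation invariance. -/
theorem memLp_two_circle_convolution {g f : UnitAddCircle → ℝ} (hgm : Measurable g)
    (hg : Integrable g) (hf : MemLp f 2 volume) :
    MemLp (fun t => ∫ y, g (t - y) * f y) 2 volume := by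
  have hm : AEStronglyMeasurable (fun t => ∫ y, g (t - y) * f y) volume := by
    have := ((hf.integrable one_le_two).integrable_convolution (ContinuousLinearMap.mul ℝ ℝ)
      hg).1
    refine this.congr (ae_of_all _ fun t => ?_)
    simp only [convolution_def, ContinuousLinearMap.mul_apply', mul_comm]
  refine memLp_two_of_lintegral_lt_top hm ?_
  have hG : ∫⁻ y, ‖g y‖ₑ < ∞ := hg.2
  have h1 : ∀ t, ‖∫ y, g (t - y) * f y‖ₑ ^ 2 ≤
      (∫⁻ y, ‖g y‖ₑ) * ∫⁻ y, ‖g (t - y)‖ₑ * ‖f y‖ₑ ^ 2 := by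
    intro t
    have h2 : ‖∫ y, g (t - y) * f y‖ₑ ≤ ∫⁻ y, ‖g (t - y)‖ₑ * ‖f y‖ₑ := by
      refine (enorm_integral_le_lintegral_enorm _).trans_eq ?_
      simp only [enorm_mul]
    refine (pow_le_pow_left' h2 2).trans ((lintegral_mul_sq_le ?_ hf.1.enorm).trans_eq ?_)
    · exact (hgm.comp (measurable_const.sub measurable_id)).enorm.aemeasurable
    · rw [lintegral_sub_left_eq_self (fun y => ‖g y‖ₑ) t]
  refine (lintegral_mono h1).trans_lt ?_
  rw [lintegral_const_mul' _ _ hG.ne, lintegral_lintegral_swap]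
  · have h3 : ∀ y, ∫⁻ t, ‖g (t - y)‖ₑ * ‖f y‖ₑ ^ 2 = (∫⁻ t, ‖g t‖ₑ) * ‖f y‖ₑ ^ 2 := by
      intro y
      have hgy : Measurable fun t => g (t - y) := by fun_prop
      rw [lintegral_mul_const _ hgy.enorm, lintegral_sub_right_eq_self (fun t => ‖g t‖ₑ) y]
    simp_rw [h3]
    rw [lintegral_const_mul' _ _ hG.ne]
    exact ENNReal.mul_lt_top hG (ENNReal.mul_lt_top hG (lintegral_enorm_sq_lt_top hf))
  · exact (hgm.comp (measurable_fst.sub measurable_snd)).enorm.aemeasurable.mul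
      (hf.1.comp_snd.enorm.pow_const 2)

theorem fourier_sub_arg (m : ℤ) (t y : UnitAddCircle) :
    (fourier m y : ℂ) * fourier m (t - y) = fourier m t := by
  simp only [fourier_apply]
  rw [← Circle.coe_mul, ← AddCircle.toCircle_add, ← smul_add, add_sub_cancel]

theorem integrable_fourier_mul {f : UnitAddCircle → ℝ} (hf : Integrable f) (m : ℤ) :
    Integrable fun t => (fourier m t : ℂ) * (f t : ℂ) := by
  refine Integrable.bdd_mul (c := 1) hf.ofReal (by fun_prop) (ae_of_all _ fun x =>
    (Circle.norm_coe _).le)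

/-- A character splits over `t = y + (t - y)`, so `e_{-m}` times the convolution is the convolution
of `e_{-m} f` and `e_{-m} g`, whose integral is the product of the integrals. -/
theorem fourierCoeff_circle_convolution {g f : UnitAddCircle → ℝ} (hg : Integrable g)
    (hf : Integrable f) (m : ℤ) :
    fourierCoeff (fun t => ((∫ y, g (t - y) * f y : ℝ) : ℂ)) m =
      fourierCoeff (fun t => (g t : ℂ)) m * fourierCoeff (fun t => (f t : ℂ)) m := by
  have h := integral_convolution (ContinuousLinearMap.mul ℂ ℂ)
    (integrable_fourier_mul hf (-m)) (integrable_fourier_mul hg (-m))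
  simp only [fourierCoeff_eq_integral]
  rw [mul_comm]
  simp only [ContinuousLinearMap.mul_apply'] at h
  rw [← h]
  refine integral_congr_ae (ae_of_all _ fun t => ?_)
  simp only [convolution_def, ContinuousLinearMap.mul_apply']
  rw [← integral_complex_ofReal, ← integral_const_mul]
  refine integral_congr_ae (ae_of_all _ fun y => ?_)
  simp only
  rw [← fourier_sub_arg (-m) t y]
  push_cast
  ring

/-! ### Inversion of the convolution in the Fourier domain -/

theorem enorm_complex_ofReal (x : ℝ) : ‖(x : ℂ)‖ₑ = ‖x‖ₑ := by
  rw [← ofReal_norm, Complex.norm_real, ofReal_norm]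

namespace IsRegularKernel

variable {g : UnitAddCircle → UnitAddCircle → ℝ} {ν C₁ C₂ : ℝ}

theorem measurable_kernelCoeff (hg : IsRegularKernel g ν C₁ C₂) (m : ℤ) :
    Measurable (kernelCoeff g m) := by
  have h : StronglyMeasurable (fun z : UnitAddCircle × UnitAddCircle =>
      (fourier (-m) z.2 : ℂ) * (g z.1 z.2 : ℂ)) := by
    refine Measurable.stronglyMeasurable (Measurable.mul ?_ ?_)
    · fun_prop
    · exact Complex.measurable_ofReal.comp hg.measurable
  have h2 := (h.integral_prod_right' (ν := (volume : Measure UnitAddCircle))).measurable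
  convert h2 using 1
  funext u
  exact fourierCoeff_eq_integral _ _

theorem enorm_kernelCoeff_sq_le (hg : IsRegularKernel g ν C₁ C₂) (hν : 0 < ν) (hC₂ : 0 < C₂)
    (m : ℤ) (u : UnitAddCircle) : ‖kernelCoeff g m u‖ₑ ^ 2 ≤ ENNReal.ofReal C₂ := by
  rw [← ofReal_norm, ← ENNReal.ofReal_pow (norm_nonneg _)]
  refine ENNReal.ofReal_le_ofReal ((hg.upper m u).trans ?_)
  refine mul_le_of_le_one_right hC₂.le ?_
  exact Real.rpow_le_one_of_one_le_of_nonpos (le_max_left _ _) (by linarith)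

theorem kernelCoeff_ne_zero (hg : IsRegularKernel g ν C₁ C₂) (hC₁ : 0 < C₁) (m : ℤ)
    (u : UnitAddCircle) : kernelCoeff g m u ≠ 0 := by
  intro h
  have h1 := hg.lower m u
  rw [h, norm_zero] at h1
  have h2 : 0 < C₁ * (max 1 |(m : ℝ)|) ^ (-(2 * ν)) :=
    mul_pos hC₁ (Real.rpow_pos_of_pos (lt_max_of_lt_left one_pos) _)
  norm_num at h1
  linarith

theorem norm_inv_kernelCoeff_sq_le (hg : IsRegularKernel g ν C₁ C₂) (hC₁ : 0 < C₁) (m : ℤ)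
    (u : UnitAddCircle) :
    ‖(kernelCoeff g m u)⁻¹‖ ^ 2 ≤ C₁⁻¹ * (max 1 |(m : ℝ)|) ^ (2 * ν) := by
  have h0 : (0 : ℝ) < max 1 |(m : ℝ)| := lt_max_of_lt_left one_pos
  rw [norm_inv, inv_pow]
  have h1 := inv_anti₀ (mul_pos hC₁ (Real.rpow_pos_of_pos h0 _)) (hg.lower m u)
  rwa [mul_inv, Real.rpow_neg h0.le, inv_inv] at h1

theorem conj_kernelCoeff (m : ℤ) (u : UnitAddCircle) :
    conj (kernelCoeff g m u) = kernelCoeff g (-m) u := by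
  unfold kernelCoeff
  rw [fourierCoeff_eq_integral, fourierCoeff_eq_integral, ← integral_conj]
  refine integral_congr_ae (ae_of_all _ fun t => ?_)
  simp only [map_mul, Complex.conj_ofReal, neg_neg]
  rw [← fourier_neg, neg_neg]

theorem measurable_section (hg : IsRegularKernel g ν C₁ C₂) (u : UnitAddCircle) :
    Measurable (g u) :=
  hg.measurable.comp measurable_prodMk_left

theorem memLp_div_kernelCoeff (hg : IsRegularKernel g ν C₁ C₂) (hC₁ : 0 < C₁) (m : ℤ)
    {e : UnitAddCircle → ℝ} (he : MemLp e 2 volume) :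
    MemLp (fun u => (kernelCoeff g m u)⁻¹ * (e u : ℂ)) 2 volume := by
  have h := he.ofReal (K := ℂ)
  refine MemLp.of_le_mul (c := √(C₁⁻¹ * (max 1 |(m : ℝ)|) ^ (2 * ν))) h ?_
    (ae_of_all _ fun u => ?_)
  · exact (hg.measurable_kernelCoeff m).inv.aestronglyMeasurable.mul h.1
  · rw [norm_mul]
    exact mul_le_mul_of_nonneg_right
      (Real.le_sqrt_of_sq_le (hg.norm_inv_kernelCoeff_sq_le hC₁ m u)) (norm_nonneg _)

theorem aestronglyMeasurable_convolved (hg : IsRegularKernel g ν C₁ C₂) {f : Torus2 → ℝ}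
    (hf : AEStronglyMeasurable f volume) : AEStronglyMeasurable (convolved g f) volume := by
  obtain ⟨f', hf', hff'⟩ := hf
  refine ⟨convolved g f', ?_, ?_⟩
  · have h : StronglyMeasurable (fun z : Torus2 × UnitAddCircle =>
        g z.1.1 (z.1.2 - z.2) * f' (z.1.1, z.2)) := by
      refine Measurable.stronglyMeasurable (Measurable.mul ?_ ?_)
      · exact hg.measurable.comp (by fun_prop :
          Measurable fun z : Torus2 × UnitAddCircle => (z.1.1, z.1.2 - z.2))
      · exact hf'.measurable.comp (by fun_prop)
    exact h.integral_prod_right'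
  · rw [Measure.volume_eq_prod] at hff' ⊢
    have h := Measure.quasiMeasurePreserving_fst (μ := (volume : Measure UnitAddCircle))
      (ν := (volume : Measure UnitAddCircle)) |>.ae (Measure.ae_ae_of_ae_prod hff')
    filter_upwards [h] with z hz
    refine integral_congr_ae ?_
    filter_upwards [hz] with y hy
    rw [hy]

theorem ae_fourierCoeff_convolved (hg : IsRegularKernel g ν C₁ C₂) {f : Torus2 → ℝ}
    (hf : MemLp f 2 volume) :
    ∀ᵐ u, MemLp (fun t => convolved g f (u, t)) 2 volume ∧ ∀ m,
      fourierCoeff (fun t => (convolved g f (u, t) : ℂ)) m =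
        kernelCoeff g m u * fourierCoeff (fun t => (f (u, t) : ℂ)) m := by
  rw [Measure.volume_eq_prod] at hf
  filter_upwards [hf.ae_memLp_two_section] with u hu
  have h1 := memLp_two_circle_convolution (hg.measurable_section u) (hg.integrable u) hu
  have h2 := fourierCoeff_circle_convolution (hg.integrable u) (hu.integrable one_le_two)
  exact ⟨h1, h2⟩

/-- The `L¹` norm of `g(u, ·)` need not be bounded in `u`, so Young's inequality is not uniform over
sections. Parseval in `t` together with `|g_m(u)|² ≤ C₂` is. -/
theorem memLp_convolved (hg : IsRegularKernel g ν C₁ C₂) (hν : 0 < ν) (hC₂ : 0 < C₂)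
    {f : Torus2 → ℝ} (hf : MemLp f 2 volume) : MemLp (convolved g f) 2 volume := by
  have hm := hg.aestronglyMeasurable_convolved hf.1
  refine memLp_two_of_lintegral_lt_top hm ?_
  have h0 := hg.ae_fourierCoeff_convolved hf
  have hfin := lintegral_enorm_sq_lt_top hf
  rw [Measure.volume_eq_prod] at *
  rw [lintegral_prod _ (hf.1.enorm.pow_const _)] at hfin
  rw [lintegral_prod _ (hm.enorm.pow_const _)]
  refine (lintegral_mono_ae
    (g := fun u => ENNReal.ofReal C₂ * ∫⁻ t, ‖f (u, t)‖ₑ ^ 2) ?_).trans_lt ?_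
  · filter_upwards [h0, hf.ae_memLp_two_section] with u ⟨hu, hu'⟩ hfu
    have e1 := tsum_enorm_sq_fourierCoeff (hu.ofReal (K := ℂ))
    have e2 := tsum_enorm_sq_fourierCoeff (hfu.ofReal (K := ℂ))
    simp only [RCLike.ofReal_eq_complex_ofReal, enorm_complex_ofReal] at e1 e2
    rw [← e1, ← e2, ← ENNReal.tsum_mul_left]
    refine ENNReal.tsum_le_tsum fun m => ?_
    rw [hu' m, enorm_mul, mul_pow]
    gcongr
    exact hg.enorm_kernelCoeff_sq_le hν hC₂ m u
  · rw [lintegral_const_mul' _ _ ENNReal.ofReal_ne_top]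
    exact ENNReal.mul_lt_top ENNReal.ofReal_lt_top hfin

end IsRegularKernel

/-- The test function `e_{-m}(t) / g_m(u) · e(u)`. -/
def testFun (g : UnitAddCircle → UnitAddCircle → ℝ) (m : ℤ) (e : UnitAddCircle → ℝ)
    (x : Torus2) : ℂ :=
  fourier (-m) x.2 / kernelCoeff g m x.1 * (e x.1 : ℂ)

namespace IsRegularKernel

variable {g : UnitAddCircle → UnitAddCircle → ℝ} {ν C₁ C₂ : ℝ}

theorem memLp_testFun (hg : IsRegularKernel g ν C₁ C₂) (hC₁ : 0 < C₁) (m : ℤ)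
    {e : UnitAddCircle → ℝ} (he : MemLp e 2 volume) : MemLp (testFun g m e) 2 volume := by
  have h := memLp_two_mul_prod (hg.memLp_div_kernelCoeff hC₁ m he) (memLp_fourier (-m))
  rw [Measure.volume_eq_prod]
  refine (memLp_congr_ae (ae_of_all _ fun x => ?_)).1 h
  simp only [testFun]
  ring

/-- After Fubini the inner integral produces `g_m(u)` times the Fourier coefficient of `f(u, ·)`,
and the factor `1 / g_m(u)` of the test function cancels it. -/
theorem integral_convolved_mul_testFun (hg : IsRegularKernel g ν C₁ C₂) (hν : 0 < ν)
    (hC₁ : 0 < C₁) (hC₂ : 0 < C₂) {f : Torus2 → ℝ} (hf : MemLp f 2 volume) (m : ℤ)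
    {e : UnitAddCircle → ℝ} (he : MemLp e 2 volume) :
    ∫ x, (convolved g f x : ℂ) * testFun g m e x =
      ∫ u, fourierCoeff (fun t => (f (u, t) : ℂ)) m * (e u : ℂ) := by
  have h0 := hg.ae_fourierCoeff_convolved hf
  have hi : Integrable (fun x => (convolved g f x : ℂ) * testFun g m e x) volume :=
    (hg.memLp_convolved hν hC₂ hf).ofReal.integrable_mul (hg.memLp_testFun hC₁ m he)
  rw [Measure.volume_eq_prod] at hi ⊢
  rw [integral_prod _ hi]
  refine integral_congr_ae ?_
  filter_upwards [h0] with u hu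
  have h1 : ∀ t, (convolved g f (u, t) : ℂ) * testFun g m e (u, t) =
      ((kernelCoeff g m u)⁻¹ * (e u : ℂ)) *
        ((fourier (-m) t : ℂ) * (convolved g f (u, t) : ℂ)) := fun t => by
    simp only [testFun]
    ring
  simp_rw [h1]
  rw [integral_const_mul, ← fourierCoeff_eq_integral, hu.2 m]
  have := hg.kernelCoeff_ne_zero hC₁ m u
  field_simp

end IsRegularKernel

/-- Parseval in `x` on almost every section. The series is a finite sum because the wavelet is
band-limited, so it can be moved through the integral in `u`. This makes the estimated coefficient
unbiased. -/
theorem sum_conj_psiCoeff_mul_integral (w : WaveletSystem) {f : Torus2 → ℝ}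
    (hf : MemLp f 2 volume) {a k a' k' : ℕ} (hk : k < translates w.m₀ a)
    (hk' : k' < translates w.m₀' a') :
    ∑ᶠ m ∈ w.band a k, conj (w.psiCoeff a k m) *
      ∫ u, fourierCoeff (fun t => (f (u, t) : ℂ)) m * (w.eta a' k' u : ℂ) =
        (w.coeff f a k a' k' : ℂ) := by
  rw [finsum_mem_eq_finite_toFinset_sum _ (WaveletSystem.finite_band a k)]
  have hf' := hf
  rw [Measure.volume_eq_prod] at hf'
  have hi : ∀ m, Integrable (fun u => fourierCoeff (fun t => (f (u, t) : ℂ)) m *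
      (w.eta a' k' u : ℂ)) volume := fun m => by
    have h1 := IsL2Basis.memLp_section_coeff (memLp_fourier (-m)) (hf'.ofReal (K := ℂ))
    refine MemLp.integrable_mul (p := 2) (q := 2) ?_
      ((WaveletSystem.memLp_eta hk').ofReal (K := ℂ))
    refine (memLp_congr_ae (ae_of_all _ fun u => ?_)).1 h1
    simp only [fourierCoeff_eq_integral, RCLike.ofReal_eq_complex_ofReal, mul_comm]
  simp_rw [← integral_const_mul]
  rw [← integral_finsetSum _ fun m _ => (hi m).const_mul _, WaveletSystem.coeff,
    ← integral_complex_ofReal]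
  refine integral_congr_ae ?_
  filter_upwards [hf'.ae_memLp_two_section] with u hu
  have h2 := hasSum_conj_fourierCoeff_mul (hu.ofReal (K := ℂ))
    ((WaveletSystem.memLp_psi hk).ofReal (K := ℂ))
  have h3 : (∫ x, f (u, x) * w.psi a k x : ℝ) =
      ∑ m ∈ (WaveletSystem.finite_band (w := w) a k).toFinset, conj (w.psiCoeff a k m) *
        fourierCoeff (fun t => (f (u, t) : ℂ)) m := by
    rw [← integral_complex_ofReal]
    refine Eq.trans ?_ (h2.unique (hasSum_sum_of_ne_finset_zero (fun m hm => ?_)))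
    · refine integral_congr_ae (ae_of_all _ fun x => ?_)
      simp
    · have : w.psiCoeff a k m = 0 := by
        by_contra h
        exact hm ((Set.Finite.mem_toFinset _).2 h)
      unfold WaveletSystem.psiCoeff at this
      simp only [RCLike.ofReal_eq_complex_ofReal]
      rw [this]
      simp
  rw [Complex.ofReal_mul, h3, Finset.sum_mul]
  exact Finset.sum_congr rfl fun m _ => by ring

/-! ### Gaussian tails -/

theorem lintegral_exp_gaussian {Ω : Type*} [MeasurableSpace Ω] {P : Measure Ω} {X : Ω → ℝ}
    {v : NNReal} (hX : P.map X = gaussianReal 0 v) (t : ℝ) :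
    ∫⁻ ω, ENNReal.ofReal (Real.exp (t * X ω)) ∂P = ENNReal.ofReal (Real.exp (v * t ^ 2 / 2)) := by
  have hm : AEMeasurable X P := aemeasurable_of_map_neZero (by rw [hX]; infer_instance)
  have h1 := mgf_gaussianReal hX t
  rw [zero_mul, zero_add] at h1
  rw [← h1, mgf, ofReal_integral_eq_lintegral_ofReal _ (ae_of_all _ fun _ => (Real.exp_pos _).le)]
  have h2 := integrable_exp_mul_gaussianReal (μ := 0) (v := v) t
  rw [← hX] at h2
  exact h2.comp_aemeasurable hm

/-- A Chernoff bound that also absorbs the factor `x²`, through `x² ≤ 2σ² exp(|x|/σ)`. -/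
theorem lintegral_sq_indicator_gaussian_le {Ω : Type*} [MeasurableSpace Ω] {P : Measure Ω}
    {X : Ω → ℝ} {v : NNReal} (hX : P.map X = gaussianReal 0 v) {σ L c : ℝ} (hσ : 0 < σ)
    (hv : (v : ℝ) ≤ σ ^ 2) (hL : 0 ≤ L) (hc : √(20 * L) * σ ≤ c) :
    ∫⁻ ω, {x : ℝ | c < |x|}.indicator (fun x => ENNReal.ofReal (x ^ 2)) (X ω) ∂P ≤
      ENNReal.ofReal (4 * Real.exp (3 / 2) * σ ^ 2 * Real.exp (-(5 * L))) := by
  set r := √(20 * L) with hr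
  have hr0 : 0 ≤ r := Real.sqrt_nonneg _
  have hr2 : r ^ 2 = 20 * L := Real.sq_sqrt (by linarith)
  -- One unit of `r + 1` pays for `exp(|x|/σ)`; the other `r` units give the tail, since `|x|/σ ≥ r`
  -- on the event.
  set s := (r + 1) / σ with hs
  have hs0 : 0 ≤ s := by positivity
  have hm : AEMeasurable X P := aemeasurable_of_map_neZero (by rw [hX]; infer_instance)
  set K := 2 * σ ^ 2 * Real.exp (-(r * r)) with hK
  have hK0 : 0 ≤ K := by positivity
  have hpt : ∀ x : ℝ, {x : ℝ | c < |x|}.indicator (fun x => ENNReal.ofReal (x ^ 2)) x ≤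
      ENNReal.ofReal K *
        (ENNReal.ofReal (Real.exp (s * x)) + ENNReal.ofReal (Real.exp (-s * x))) := by
    intro x
    by_cases hx : c < |x|
    · rw [Set.indicator_of_mem (by exact hx), ← ENNReal.ofReal_add (Real.exp_pos _).le
        (Real.exp_pos _).le, ← ENNReal.ofReal_mul hK0]
      refine ENNReal.ofReal_le_ofReal ?_
      have h1 : x ^ 2 ≤ 2 * σ ^ 2 * Real.exp (|x| / σ) := by
        have h := Real.quadratic_le_exp_of_nonneg (x := |x| / σ) (by positivity)
        have h' : (|x| / σ) ^ 2 / 2 ≤ Real.exp (|x| / σ) := by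
          have : 0 ≤ |x| / σ := by positivity
          linarith
        rw [div_pow, sq_abs, div_div, div_le_iff₀ (by positivity)] at h'
        linarith
      have h2 : Real.exp (|x| / σ) ≤ Real.exp (-(r * r)) * Real.exp (s * |x|) := by
        rw [← Real.exp_add]
        refine Real.exp_le_exp.2 ?_
        have h3 : r * σ ≤ |x| := hc.trans hx.le
        have h4 : s * |x| = |x| / σ + r * (|x| / σ) := by rw [hs]; ring
        have h5 : r ≤ |x| / σ := by rwa [le_div_iff₀ hσ]
        have := mul_le_mul_of_nonneg_left h5 hr0
        linarith
      have h3 : Real.exp (s * |x|) ≤ Real.exp (s * x) + Real.exp (-s * x) := by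
        rcases abs_cases x with h | h <;> rw [h.1]
        · linarith [Real.exp_pos (-s * x)]
        · rw [mul_neg, neg_mul]
          linarith [Real.exp_pos (s * x)]
      calc x ^ 2 ≤ 2 * σ ^ 2 * Real.exp (|x| / σ) := h1
        _ ≤ 2 * σ ^ 2 * (Real.exp (-(r * r)) * Real.exp (s * |x|)) := by gcongr
        _ = K * Real.exp (s * |x|) := by rw [hK]; ring
        _ ≤ _ := by gcongr
    · rw [Set.indicator_of_notMem (by exact hx)]
      exact bot_le
  refine (lintegral_mono fun ω => hpt (X ω)).trans ?_
  rw [lintegral_const_mul' _ _ ENNReal.ofReal_ne_top, lintegral_add_left',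
    lintegral_exp_gaussian hX, lintegral_exp_gaussian hX, neg_sq,
    ← ENNReal.ofReal_add (Real.exp_pos _).le (Real.exp_pos _).le, ← ENNReal.ofReal_mul hK0]
  · refine ENNReal.ofReal_le_ofReal ?_
    have h1 : v * s ^ 2 / 2 ≤ (r + 1) ^ 2 / 2 := by
      have : v * s ^ 2 ≤ σ ^ 2 * s ^ 2 := by gcongr
      have e : σ ^ 2 * s ^ 2 = (r + 1) ^ 2 := by
        rw [hs, div_pow]
        field_simp
      linarith
    have h2 : Real.exp (v * s ^ 2 / 2) ≤ Real.exp ((r + 1) ^ 2 / 2) := Real.exp_le_exp.2 h1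
    have h3 : Real.exp (-(r * r)) * Real.exp ((r + 1) ^ 2 / 2) ≤
        Real.exp (3 / 2) * Real.exp (-(5 * L)) := by
      rw [← Real.exp_add, ← Real.exp_add]
      refine Real.exp_le_exp.2 ?_
      -- The exponent `-r² + (r + 1)²/2` equals `3/2 - r²/4 - (r - 2)²/4`, and `r²/4 = 5L`.
      nlinarith [sq_nonneg (r - 2)]
    calc K * (Real.exp (v * s ^ 2 / 2) + Real.exp (v * s ^ 2 / 2))
        ≤ K * (Real.exp ((r + 1) ^ 2 / 2) + Real.exp ((r + 1) ^ 2 / 2)) := by gcongr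
      _ = 4 * σ ^ 2 * (Real.exp (-(r * r)) * Real.exp ((r + 1) ^ 2 / 2)) := by rw [hK]; ring
      _ ≤ 4 * σ ^ 2 * (Real.exp (3 / 2) * Real.exp (-(5 * L))) := by gcongr
      _ = _ := by ring
  · exact (Real.measurable_exp.comp_aemeasurable (hm.const_mul s)).ennreal_ofReal

/-! ### White noise -/

namespace IsWhiteNoise

variable {Ω : Type*} [MeasurableSpace Ω] {P : Measure Ω} {Z : L2Torus2 → Ω → ℝ}

theorem memLp (hZ : IsWhiteNoise P Z) (χ : L2Torus2) : MemLp (Z χ) 2 P :=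
  (hZ.gaussian.hasGaussianLaw_eval χ).memLp_two

/-- Linearity of the noise is not part of its definition. The covariance forces it almost surely:
the second moment of the defect expands to the squared norm of the zero vector. -/
theorem ae_linear (hZ : IsWhiteNoise P Z) (a b : ℝ) (χ₁ χ₂ : L2Torus2) :
    Z (a • χ₁ + b • χ₂) =ᵐ[P] fun ω => a * Z χ₁ ω + b * Z χ₂ ω := by
  set χ := a • χ₁ + b • χ₂ with hχ
  have hi : ∀ χ₁ χ₂, Integrable (fun ω => Z χ₁ ω * Z χ₂ ω) P := fun χ₁ χ₂ =>
    (hZ.memLp χ₁).integrable_mul (hZ.memLp χ₂)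
  have hD : MemLp (fun ω => Z χ ω - (a * Z χ₁ ω + b * Z χ₂ ω)) 2 P :=
    (hZ.memLp χ).sub (((hZ.memLp χ₁).const_mul a).add ((hZ.memLp χ₂).const_mul b))
  have h0 : ∫ ω, (Z χ ω - (a * Z χ₁ ω + b * Z χ₂ ω)) ^ 2 ∂P = 0 := by
    have e : ∀ ω, (Z χ ω - (a * Z χ₁ ω + b * Z χ₂ ω)) ^ 2 =
        Z χ ω * Z χ ω + (-2 * a) * (Z χ ω * Z χ₁ ω) + (-2 * b) * (Z χ ω * Z χ₂ ω) +
        a ^ 2 * (Z χ₁ ω * Z χ₁ ω) + (2 * a * b) * (Z χ₁ ω * Z χ₂ ω) +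
        b ^ 2 * (Z χ₂ ω * Z χ₂ ω) := fun ω => by ring
    simp_rw [e]
    have i1 := hi χ χ
    have i2 := (hi χ χ₁).const_mul (-2 * a)
    have i3 := (hi χ χ₂).const_mul (-2 * b)
    have i4 := (hi χ₁ χ₁).const_mul (a ^ 2)
    have i5 := (hi χ₁ χ₂).const_mul (2 * a * b)
    have i6 := (hi χ₂ χ₂).const_mul (b ^ 2)
    rw [integral_add, integral_add, integral_add, integral_add, integral_add]
    rotate_left
    all_goals first | assumption | skip
    · exact i1.add i2
    · exact (i1.add i2).add i3
    · exact ((i1.add i2).add i3).add i4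
    · exact (((i1.add i2).add i3).add i4).add i5
    simp only [integral_const_mul, hZ.covariance]
    simp only [hχ, inner_add_left, inner_add_right, real_inner_smul_left, real_inner_smul_right]
    rw [real_inner_comm χ₂ χ₁]
    ring
  rw [integral_eq_zero_iff_of_nonneg (fun ω => sq_nonneg _) hD.integrable_sq] at h0
  filter_upwards [h0] with ω hω
  have := pow_eq_zero_iff (two_ne_zero) |>.1 hω
  linarith

theorem ae_zero (hZ : IsWhiteNoise P Z) : Z 0 =ᵐ[P] fun _ => 0 := by
  have h := hZ.ae_linear 0 0 0 0
  simpa using h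

theorem ae_sum (hZ : IsWhiteNoise P Z) {ι : Type*} (s : Finset ι) (a b : ι → ℝ)
    (χ₁ χ₂ : ι → L2Torus2) :
    Z (∑ i ∈ s, (a i • χ₁ i + b i • χ₂ i)) =ᵐ[P]
      fun ω => ∑ i ∈ s, (a i * Z (χ₁ i) ω + b i * Z (χ₂ i) ω) := by
  classical
  induction s using Finset.induction_on with
  | empty => simpa using hZ.ae_zero
  | insert i s hi ih =>
    have h1 := hZ.ae_linear 1 1 (a i • χ₁ i + b i • χ₂ i) (∑ i ∈ s, (a i • χ₁ i + b i • χ₂ i))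
    simp only [one_smul, one_mul] at h1
    simp only [Finset.sum_insert hi]
    filter_upwards [h1, ih, hZ.ae_linear (a i) (b i) (χ₁ i) (χ₂ i)] with ω e1 e2 e3
    rw [e1, e2, e3]

theorem map_eq_gaussianReal (hZ : IsWhiteNoise P Z) (χ : L2Torus2) :
    P.map (Z χ) = gaussianReal 0 (‖χ‖ ^ 2).toNNReal := by
  have := hZ.gaussian.isProbabilityMeasure
  have h := (hZ.gaussian.hasGaussianLaw_eval χ).map_eq_gaussianReal
  rw [h, hZ.mean, variance_of_integral_eq_zero (hZ.memLp χ).1.aemeasurable (hZ.mean χ)]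
  congr 2
  rw [← real_inner_self_eq_norm_sq, ← hZ.covariance]
  exact integral_congr_ae (ae_of_all _ fun ω => sq _)

end IsWhiteNoise

/-! ### The estimated coefficients are the true ones plus Gaussian noise -/

theorem toL2_of_memLp {F : Torus2 → ℝ} (hF : MemLp F 2 volume) : toL2 F = hF.toLp F :=
  dif_pos hF

theorem memLp_complex_re {F : Torus2 → ℂ} (hF : MemLp F 2 volume) :
    MemLp (fun x => (F x).re) 2 volume :=
  hF.re

theorem memLp_complex_im {F : Torus2 → ℂ} (hF : MemLp F 2 volume) :
    MemLp (fun x => (F x).im) 2 volume :=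
  hF.im

theorem memLp_linear {F G : Torus2 → ℝ} (hF : MemLp F 2 volume) (hG : MemLp G 2 volume)
    (a b : ℝ) : MemLp (fun x => a * F x + b * G x) 2 volume :=
  (hF.const_mul a).add (hG.const_mul b)

theorem toL2_linear {F G : Torus2 → ℝ} (hF : MemLp F 2 volume) (hG : MemLp G 2 volume)
    (a b : ℝ) : toL2 (fun x => a * F x + b * G x) = a • toL2 F + b • toL2 G := by
  rw [toL2_of_memLp hF, toL2_of_memLp hG, ← MemLp.toLp_const_smul, ← MemLp.toLp_const_smul,
    ← MemLp.toLp_add, toL2_of_memLp (memLp_linear hF hG a b)]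
  rfl

theorem toL2_sum {ι : Type*} (s : Finset ι) {F : ι → Torus2 → ℝ}
    (hF : ∀ i, MemLp (F i) 2 volume) :
    toL2 (fun x => ∑ i ∈ s, F i x) = ∑ i ∈ s, toL2 (F i) := by
  classical
  induction s using Finset.induction_on with
  | empty =>
    simp only [Finset.sum_empty]
    rw [toL2_of_memLp MemLp.zero']
    exact MemLp.toLp_zero _
  | insert i s hi ih =>
    have h := toL2_linear (hF i) (memLp_finsetSum s fun j _ => hF j) 1 1
    simp only [one_mul, one_smul] at h
    simp only [Finset.sum_insert hi]
    rw [h, ih]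

theorem ofReal_norm_toL2_sq {F : Torus2 → ℝ} (hF : MemLp F 2 volume) :
    ENNReal.ofReal (‖toL2 F‖ ^ 2) = ∫⁻ x, ‖F x‖ₑ ^ 2 := by
  rw [lintegral_enorm_sq_eq hF, toL2_of_memLp hF, ← real_inner_self_eq_norm_sq, L2.inner_def]
  congr 1
  refine integral_congr_ae ?_
  filter_upwards [hF.coeFn_toLp] with x hx
  simp [hx, sq]

theorem integral_mul_toL2 {h F : Torus2 → ℝ} (hF : MemLp F 2 volume) :
    ∫ x, h x * toL2 F x = ∫ x, h x * F x := by
  rw [toL2_of_memLp hF]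
  refine integral_congr_ae ?_
  filter_upwards [hF.coeFn_toLp] with x hx
  rw [hx]

theorem pairing_observation {Ω : Type*} (g : UnitAddCircle → UnitAddCircle → ℝ) {f : Torus2 → ℝ}
    (hh : MemLp (convolved g f) 2 volume) (ε : ℝ) (Z : L2Torus2 → Ω → ℝ) (ω : Ω)
    {F : Torus2 → ℂ} (hF : MemLp F 2 volume) :
    pairing (observation g f ε Z ω) F = (∫ x, (convolved g f x : ℂ) * F x) +
      ε * ((Z (toL2 fun x => (F x).re) ω : ℂ) +
        Complex.I * (Z (toL2 fun x => (F x).im) ω : ℂ)) := by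
  have hi : Integrable (fun x => (convolved g f x : ℂ) * F x) volume :=
    hh.ofReal.integrable_mul hF
  have e1 := integral_re_add_im hi
  have e2 : ∫ x, RCLike.re ((convolved g f x : ℂ) * F x) = ∫ x, convolved g f x * (F x).re := by
    simp
  have e3 : ∫ x, RCLike.im ((convolved g f x : ℂ) * F x) = ∫ x, convolved g f x * (F x).im := by
    simp
  rw [e2, e3] at e1
  rw [← e1]
  simp only [pairing, observation]
  rw [integral_mul_toL2 (memLp_complex_re hF), integral_mul_toL2 (memLp_complex_im hF)]
  simp only [RCLike.ofReal_eq_complex_ofReal, RCLike.I_to_complex]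
  push_cast
  ring

theorem lintegral_enorm_sq_trigPolynomial (s : Finset ℤ) (d : ℤ → ℂ) :
    ∫⁻ t : UnitAddCircle, ‖∑ m ∈ s, d m * (fourier (-m) t : ℂ)‖ₑ ^ 2 = ∑ m ∈ s, ‖d m‖ₑ ^ 2 := by
  have hL : MemLp (fun t : UnitAddCircle => ∑ m ∈ s, d m * (fourier (-m) t : ℂ)) 2 volume :=
    memLp_finsetSum s fun m _ => (memLp_fourier (-m)).const_mul (d m)
  rw [← tsum_enorm_sq_fourierCoeff hL]
  have hc : ∀ n, fourierCoeff (fun t : UnitAddCircle => ∑ m ∈ s, d m * (fourier (-m) t : ℂ)) n =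
      ∑ m ∈ s, if n = -m then d m else 0 := by
    intro n
    rw [fourierCoeff_eq_integral]
    simp_rw [Finset.mul_sum]
    rw [integral_finsetSum]
    · refine Finset.sum_congr rfl fun m _ => ?_
      have h1 := congrFun (fourierCoeff_fourier (T := 1) (-m)) n
      rw [fourierCoeff_eq_integral] at h1
      have h2 : ∀ t : UnitAddCircle, (fourier (-n) t : ℂ) * (d m * (fourier (-m) t : ℂ)) =
          d m * ((fourier (-n) t : ℂ) * (fourier (-m) t : ℂ)) := fun t => by ring
      simp_rw [h2]
      rw [integral_const_mul, h1, Pi.single_apply]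
      split_ifs <;> simp
    · intro m _
      exact (memLp_fourier (-n)).integrable_mul ((memLp_fourier (-m)).const_mul (d m))
  simp_rw [hc]
  rw [← (Equiv.neg ℤ).tsum_eq]
  simp only [Equiv.neg_apply, neg_inj]
  rw [tsum_eq_sum (s := s)]
  · exact Finset.sum_congr rfl fun m hm => by rw [Finset.sum_ite_eq s m d, if_pos hm]
  · intro m hm
    rw [Finset.sum_ite_eq s m d, if_neg hm]
    simp

section Noise

variable {w : WaveletSystem} {g : UnitAddCircle → UnitAddCircle → ℝ} {ν C₁ C₂ : ℝ}

/-- The function against which the noise is tested in the estimated coefficient. -/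
def noiseKernel (w : WaveletSystem) (g : UnitAddCircle → UnitAddCircle → ℝ) (a k a' k' : ℕ)
    (x : Torus2) : ℂ :=
  ∑ m ∈ (WaveletSystem.finite_band (w := w) a k).toFinset,
    conj (w.psiCoeff a k m) * testFun g m (w.eta a' k') x

/-- Both `ψ` and `g` are real, so conjugation replaces `m` by `-m` in every factor, and the band is
symmetric. -/
theorem noiseKernel_im (a k a' k' : ℕ) (x : Torus2) : (noiseKernel w g a k a' k' x).im = 0 := by
  rw [← Complex.conj_eq_iff_im, noiseKernel, map_sum]
  refine Finset.sum_nbij' (fun m => -m) (fun m => -m) ?_ ?_ ?_ ?_ ?_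
  · intro m hm
    rw [Set.Finite.mem_toFinset] at hm ⊢
    exact WaveletSystem.neg_mem_band.2 hm
  · intro m hm
    rw [Set.Finite.mem_toFinset] at hm ⊢
    exact WaveletSystem.neg_mem_band.2 hm
  · simp
  · simp
  · intro m _
    simp only [testFun, map_mul, map_div₀, Complex.conj_ofReal, WaveletSystem.conj_psiCoeff,
      IsRegularKernel.conj_kernelCoeff]
    rw [← fourier_neg]

theorem memLp_noiseKernel (hg : IsRegularKernel g ν C₁ C₂) (hC₁ : 0 < C₁) (a k : ℕ) {a' k' : ℕ}
    (hk' : k' < translates w.m₀' a') : MemLp (noiseKernel w g a k a' k') 2 volume :=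
  memLp_finsetSum _ fun m _ =>
    (hg.memLp_testFun hC₁ m (WaveletSystem.memLp_eta hk')).const_mul _

theorem tsum_enorm_sq_psiCoeff {a k : ℕ} (hk : k < translates w.m₀ a) :
    ∑' m, ‖w.psiCoeff a k m‖ₑ ^ 2 = 1 := by
  have h1 := WaveletSystem.memLp_psi hk
  have h2 := tsum_enorm_sq_fourierCoeff (h1.ofReal (K := ℂ))
  simp only [RCLike.ofReal_eq_complex_ofReal, enorm_complex_ofReal] at h2
  refine h2.trans ?_
  rw [lintegral_enorm_sq_eq h1]
  simp only [sq]
  rw [WaveletSystem.integral_psi_mul_psi hk hk]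
  simp

theorem lintegral_enorm_sq_eta {a k : ℕ} (hk : k < translates w.m₀' a) :
    ∫⁻ u, ‖w.eta a k u‖ₑ ^ 2 = 1 := by
  rw [lintegral_enorm_sq_eq (WaveletSystem.memLp_eta hk)]
  simp only [sq]
  rw [WaveletSystem.integral_eta_mul_eta hk hk]
  simp

/-- For fixed `u` the kernel is a trigonometric polynomial in `t`. Parseval in `t`, the lower bound
on `|g_m(u)|` over the band and the normalisation of `ψ` and `η` give the variance bound. -/
theorem lintegral_noiseKernel_le (hg : IsRegularKernel g ν C₁ C₂) (hν : 0 < ν) (hC₁ : 0 < C₁)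
    {a k a' k' : ℕ} (hk : k < translates w.m₀ a) (hk' : k' < translates w.m₀' a') :
    ∫⁻ x, ‖noiseKernel w g a k a' k' x‖ₑ ^ 2 ≤
      ENNReal.ofReal (C₁⁻¹ * (2 * Real.pi / 3 * (2 : ℝ) ^ level w.m₀ a) ^ (2 * ν)) := by
  have hm := memLp_noiseKernel (w := w) hg hC₁ a k hk'
  set S := (WaveletSystem.finite_band (w := w) a k).toFinset with hS
  set B := C₁⁻¹ * (2 * Real.pi / 3 * (2 : ℝ) ^ level w.m₀ a) ^ (2 * ν) with hB
  rw [Measure.volume_eq_prod] at hm ⊢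
  rw [lintegral_prod _ (hm.1.enorm.pow_const _)]
  have h1 : ∀ u, ∫⁻ t, ‖noiseKernel w g a k a' k' (u, t)‖ₑ ^ 2 ≤
      ENNReal.ofReal B * ‖w.eta a' k' u‖ₑ ^ 2 := by
    intro u
    have e : ∀ t, noiseKernel w g a k a' k' (u, t) = ∑ m ∈ S,
        (conj (w.psiCoeff a k m) * (kernelCoeff g m u)⁻¹ * (w.eta a' k' u : ℂ)) *
          (fourier (-m) t : ℂ) := fun t => by
      refine Finset.sum_congr rfl fun m _ => ?_
      simp only [testFun]
      ring
    simp_rw [e]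
    rw [lintegral_enorm_sq_trigPolynomial]
    calc ∑ m ∈ S, ‖conj (w.psiCoeff a k m) * (kernelCoeff g m u)⁻¹ * (w.eta a' k' u : ℂ)‖ₑ ^ 2
        ≤ ∑ m ∈ S, ‖w.psiCoeff a k m‖ₑ ^ 2 * ENNReal.ofReal B * ‖w.eta a' k' u‖ₑ ^ 2 := by
          refine Finset.sum_le_sum fun m hm => ?_
          rw [enorm_mul, enorm_mul, mul_pow, mul_pow, enorm_complex_ofReal]
          gcongr
          · rw [← ofReal_norm, RCLike.norm_conj, ofReal_norm]
          · rw [← ofReal_norm, ← ENNReal.ofReal_pow (norm_nonneg _)]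
            refine ENNReal.ofReal_le_ofReal ((hg.norm_inv_kernelCoeff_sq_le hC₁ m u).trans ?_)
            rw [hB]
            gcongr
            exact WaveletSystem.max_one_abs_le_of_mem_band ((Set.Finite.mem_toFinset _).1 hm)
      _ = (∑ m ∈ S, ‖w.psiCoeff a k m‖ₑ ^ 2) * (ENNReal.ofReal B * ‖w.eta a' k' u‖ₑ ^ 2) := by
          rw [Finset.sum_mul]
          simp only [mul_assoc]
      _ ≤ 1 * (ENNReal.ofReal B * ‖w.eta a' k' u‖ₑ ^ 2) := by
          gcongr
          rw [← tsum_enorm_sq_psiCoeff hk]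
          exact ENNReal.sum_le_tsum S
      _ = _ := one_mul _
  refine (lintegral_mono h1).trans_eq ?_
  rw [lintegral_const_mul' _ _ ENNReal.ofReal_ne_top, lintegral_enorm_sq_eta hk', mul_one]

/-- The estimated coefficient is the true coefficient plus `ε` times a centred Gaussian variable
whose variance is at most `C₁⁻¹ (2π/3)^{2ν} 2^{2jν}`. -/
theorem exists_coeffEst_eq {Ω : Type*} [MeasurableSpace Ω] {P : Measure Ω}
    {Z : L2Torus2 → Ω → ℝ} (hZ : IsWhiteNoise P Z) (hν : 0 < ν) (hC₁ : 0 < C₁) (hC₂ : 0 < C₂)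
    (hg : IsRegularKernel g ν C₁ C₂) {f : Torus2 → ℝ} (hf : MemLp f 2 volume) (ε : ℝ)
    {a k a' k' : ℕ} (hk : k < translates w.m₀ a) (hk' : k' < translates w.m₀' a') :
    ∃ χ : L2Torus2,
      ‖χ‖ ^ 2 ≤ C₁⁻¹ * (2 * Real.pi / 3 * (2 : ℝ) ^ level w.m₀ a) ^ (2 * ν) ∧
      ∀ᵐ ω ∂P, coeffEst w g (observation g f ε Z ω) a k a' k' =
        ((w.coeff f a k a' k' + ε * Z χ ω : ℝ) : ℂ) := by
  set S := (WaveletSystem.finite_band (w := w) a k).toFinset with hS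
  have hη := WaveletSystem.memLp_eta (w := w) hk'
  have hT := fun m => hg.memLp_testFun hC₁ m hη
  have hTr := fun m => memLp_complex_re (hT m)
  have hTi := fun m => memLp_complex_im (hT m)
  have hh := hg.memLp_convolved hν hC₂ hf
  have hΦ := memLp_noiseKernel (w := w) hg hC₁ a k hk'
  set c : ℤ → ℂ := fun m => conj (w.psiCoeff a k m) with hc
  set R : ℤ → L2Torus2 := fun m => toL2 fun x => (testFun g m (w.eta a' k') x).re with hR
  set I : ℤ → L2Torus2 := fun m => toL2 fun x => (testFun g m (w.eta a' k') x).im with hI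
  refine ⟨toL2 fun x => (noiseKernel w g a k a' k' x).re, ?_, ?_⟩
  · rw [← ENNReal.ofReal_le_ofReal_iff (by positivity), ofReal_norm_toL2_sq (memLp_complex_re hΦ)]
    refine le_trans (lintegral_mono fun x => ?_) (lintegral_noiseKernel_le hg hν hC₁ hk hk')
    rw [complex_enorm_sq (noiseKernel w g a k a' k' x)]
    exact le_self_add
  · have hre : toL2 (fun x => (noiseKernel w g a k a' k' x).re) =
        ∑ m ∈ S, ((c m).re • R m + (-(c m).im) • I m) := by
      have e : ∀ x, (noiseKernel w g a k a' k' x).re = ∑ m ∈ S,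
          ((c m).re * (testFun g m (w.eta a' k') x).re +
            (-(c m).im) * (testFun g m (w.eta a' k') x).im) := fun x => by
        rw [noiseKernel, Complex.re_sum]
        refine Finset.sum_congr rfl fun m _ => ?_
        rw [Complex.mul_re]
        ring
      simp_rw [e]
      rw [toL2_sum _ fun m => memLp_linear (hTr m) (hTi m) _ _]
      exact Finset.sum_congr rfl fun m _ => toL2_linear (hTr m) (hTi m) _ _
    -- This combination represents the imaginary part of the real noise kernel, so the noise tested
    -- against it vanishes almost surely and the estimated coefficient is almost surely real.
    have him : (0 : L2Torus2) = ∑ m ∈ S, ((c m).re • I m + (c m).im • R m) := by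
      have e : ∀ x, (0 : ℝ) = ∑ m ∈ S,
          ((c m).re * (testFun g m (w.eta a' k') x).im +
            (c m).im * (testFun g m (w.eta a' k') x).re) := fun x => by
        rw [← noiseKernel_im (w := w) (g := g) a k a' k' x, noiseKernel, Complex.im_sum]
        refine Finset.sum_congr rfl fun m _ => ?_
        rw [Complex.mul_im]
      have e0 : (0 : L2Torus2) = toL2 fun _ => 0 := by
        rw [toL2_of_memLp MemLp.zero']
        exact (MemLp.toLp_zero _).symm
      rw [e0, funext e,
        toL2_sum _ fun m => memLp_linear (hTi m) (hTr m) _ _]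
      exact Finset.sum_congr rfl fun m _ => toL2_linear (hTi m) (hTr m) _ _
    have h1 := hZ.ae_sum S (fun m => (c m).re) (fun m => -(c m).im) R I
    have h2 := hZ.ae_sum S (fun m => (c m).re) (fun m => (c m).im) I R
    rw [← hre] at h1
    rw [← him] at h2
    filter_upwards [h1, h2, hZ.ae_zero] with ω e1 e2 e3
    have hpair : ∀ m, pairing (observation g f ε Z ω) (testFun g m (w.eta a' k')) =
        (∫ u, fourierCoeff (fun t => (f (u, t) : ℂ)) m * (w.eta a' k' u : ℂ)) +
          ε * ((Z (R m) ω : ℂ) + Complex.I * (Z (I m) ω : ℂ)) := fun m => by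
      rw [pairing_observation g hh ε Z ω (hT m),
        hg.integral_convolved_mul_testFun hν hC₁ hC₂ hf m hη]
    have hβ := sum_conj_psiCoeff_mul_integral w hf hk hk'
    rw [finsum_mem_eq_finite_toFinset_sum _ (WaveletSystem.finite_band a k)] at hβ
    have hnoise : ∑ m ∈ S, c m * ((Z (R m) ω : ℂ) + Complex.I * (Z (I m) ω : ℂ)) =
        ((Z (toL2 fun x => (noiseKernel w g a k a' k' x).re) ω : ℝ) : ℂ) := by
      apply Complex.ext
      · rw [Complex.ofReal_re, e1, Complex.re_sum]
        refine Finset.sum_congr rfl fun m _ => ?_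
        simp
        ring
      · rw [Complex.ofReal_im, ← e3, e2, Complex.im_sum]
        refine Finset.sum_congr rfl fun m _ => ?_
        simp
    rw [coeffEst, finsum_mem_eq_finite_toFinset_sum _ (WaveletSystem.finite_band a k)]
    calc ∑ m ∈ S, c m * pairing (observation g f ε Z ω) (testFun g m (w.eta a' k'))
        = (∑ m ∈ S, c m * ∫ u, fourierCoeff (fun t => (f (u, t) : ℂ)) m * (w.eta a' k' u : ℂ)) +
          ε * ∑ m ∈ S, c m * ((Z (R m) ω : ℂ) + Complex.I * (Z (I m) ω : ℂ)) := by
          rw [Finset.mul_sum, ← Finset.sum_add_distrib]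
          refine Finset.sum_congr rfl fun m _ => ?_
          rw [hpair m]
          ring
      _ = _ := by
          rw [hnoise, hβ]
          push_cast
          ring

end Noise

/-! ### The risk of hard thresholding, coefficient by coefficient -/

/-- Let `|n| ≤ t/2`. A kept coefficient has `|b| > t/2 ≥ |n|`, so the error `n²` is below both `b²`
and `t²`. A killed one has `|b| ≤ 3t/2`, which is where `9/4` comes from. For `|n| > t/2` the error
is `n²` or `b²`. -/
theorem hardThreshold_sub_sq_le (b n t : ℝ) (ht : 0 ≤ t) :
    ((if t < |b + n| then b + n else 0) - b) ^ 2 ≤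
      9 / 4 * min (b ^ 2) (t ^ 2) + if t / 2 < |n| then n ^ 2 + b ^ 2 else 0 := by
  have hmin : 0 ≤ min (b ^ 2) (t ^ 2) := le_min (sq_nonneg _) (sq_nonneg _)
  by_cases hn : t / 2 < |n|
  · rw [if_pos hn]
    split_ifs
    · have : (b + n - b) ^ 2 = n ^ 2 := by ring
      rw [this]
      nlinarith [sq_nonneg b]
    · have : (0 - b) ^ 2 = b ^ 2 := by ring
      rw [this]
      nlinarith [sq_nonneg n]
  · rw [if_neg hn, add_zero]
    push Not at hn
    have h1 := abs_add_le b n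
    split_ifs with h
    · have hb : t / 2 < |b| := by linarith
      have e : (b + n - b) ^ 2 = |n| ^ 2 := by rw [sq_abs]; ring
      rw [e]
      rcases min_choice (b ^ 2) (t ^ 2) with h2 | h2 <;> rw [h2]
      · rw [← sq_abs b]
        nlinarith [abs_nonneg n]
      · nlinarith [abs_nonneg n]
    · push Not at h
      have hb : |b| ≤ 3 / 2 * t := by
        have := abs_sub_abs_le_abs_sub b (-n)
        rw [abs_neg, sub_neg_eq_add] at this
        linarith
      have e : (0 - b) ^ 2 = |b| ^ 2 := by rw [sq_abs]; ring
      rw [e]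
      rcases min_choice (b ^ 2) (t ^ 2) with h2 | h2 <;> rw [h2]
      · rw [← sq_abs b]
        nlinarith [abs_nonneg b]
      · nlinarith [abs_nonneg b]

/-- On the bad event `|X| > c ≥ σ`, hence `b² ≤ (b²/σ²) X²`, and both exceptional terms reduce to
the same truncated second moment. The inequality `c ≥ σ` is where `L ≥ 1` matters. -/
theorem lintegral_hardThreshold_le {Ω : Type*} [MeasurableSpace Ω] {P : Measure Ω}
    [IsProbabilityMeasure P] {X : Ω → ℝ} {v : NNReal} (hX : P.map X = gaussianReal 0 v)
    {σ L ε t : ℝ} (b : ℝ) (hσ : 0 < σ) (hv : (v : ℝ) ≤ σ ^ 2) (hL : 1 ≤ L) (hε : 0 < ε)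
    (ht : √(20 * L) * σ * (2 * ε) ≤ t) :
    ∫⁻ ω, ‖(if t < |b + ε * X ω| then b + ε * X ω else 0) - b‖ₑ ^ 2 ∂P ≤
      ENNReal.ofReal (9 / 4 * min (b ^ 2) (t ^ 2) +
        4 * Real.exp (3 / 2) * Real.exp (-(5 * L)) * (σ ^ 2 * ε ^ 2 + b ^ 2)) := by
  have hm : AEMeasurable X P := aemeasurable_of_map_neZero (by rw [hX]; infer_instance)
  have hmin : 0 ≤ min (b ^ 2) (t ^ 2) := le_min (sq_nonneg _) (sq_nonneg _)
  set c := t / (2 * ε) with hc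
  have hcs : √(20 * L) * σ ≤ c := by rwa [hc, le_div_iff₀ (by positivity)]
  have h20 : 1 ≤ √(20 * L) := by
    rw [Real.one_le_sqrt]
    linarith
  have hcσ : σ ≤ c := (le_mul_of_one_le_left hσ.le h20).trans hcs
  have hc0 : 0 < c := hσ.trans_le hcσ
  have htc : t = 2 * ε * c := by rw [hc]; field_simp
  have ht0 : 0 ≤ t := by rw [htc]; positivity
  have hpt : ∀ x : ℝ, ‖(if t < |b + ε * x| then b + ε * x else 0) - b‖ₑ ^ 2 ≤
      ENNReal.ofReal (9 / 4 * min (b ^ 2) (t ^ 2)) + ENNReal.ofReal (ε ^ 2 + b ^ 2 / σ ^ 2) *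
        {x : ℝ | c < |x|}.indicator (fun x => ENNReal.ofReal (x ^ 2)) x := by
    intro x
    rw [enorm_sq_eq_ofReal]
    refine (ENNReal.ofReal_le_ofReal (hardThreshold_sub_sq_le b (ε * x) t ht0)).trans ?_
    rw [ENNReal.ofReal_add (by positivity) (by positivity)]
    gcongr
    have hiff : t / 2 < |ε * x| ↔ c < |x| := by
      rw [abs_mul, abs_of_pos hε, htc, show 2 * ε * c / 2 = ε * c by ring,
        mul_lt_mul_iff_right₀ hε]
    by_cases hx : c < |x|
    · rw [if_pos (hiff.2 hx), Set.indicator_of_mem (by exact hx),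
        ← ENNReal.ofReal_mul (by positivity)]
      refine ENNReal.ofReal_le_ofReal ?_
      have h1 : σ ^ 2 ≤ x ^ 2 := by
        rw [← sq_abs x]
        exact pow_le_pow_left₀ hσ.le (hcσ.trans hx.le) 2
      have h2 : b ^ 2 ≤ b ^ 2 / σ ^ 2 * x ^ 2 := by
        rw [div_mul_eq_mul_div, le_div_iff₀ (by positivity)]
        gcongr
      linarith [mul_pow ε x 2, add_mul (ε ^ 2) (b ^ 2 / σ ^ 2) (x ^ 2)]
    · rw [if_neg (fun h => hx (hiff.1 h)), ENNReal.ofReal_zero]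
      exact bot_le
  refine (lintegral_mono fun ω => hpt (X ω)).trans ?_
  rw [lintegral_add_left measurable_const, lintegral_const, measure_univ, mul_one,
    lintegral_const_mul' _ _ ENNReal.ofReal_ne_top,
    ENNReal.ofReal_add (p := 9 / 4 * min (b ^ 2) (t ^ 2)) (by positivity) (by positivity)]
  refine add_le_add le_rfl ?_
  refine (mul_le_mul_right (lintegral_sq_indicator_gaussian_le hX hσ hv (by linarith) hcs)
    _).trans ?_
  rw [← ENNReal.ofReal_mul (by positivity)]
  refine ENNReal.ofReal_le_ofReal (le_of_eq ?_)
  field_simp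

section Risk

variable {w : WaveletSystem} {g : UnitAddCircle → UnitAddCircle → ℝ} {ν C₁ C₂ Cβ : ℝ}

/-- The upper bound `C₁⁻¹ (2π/3)^{2ν} 2^{2jν}` for the variance of the noise at level `j`. -/
def noiseVar (w : WaveletSystem) (ν C₁ : ℝ) (a : ℕ) : ℝ :=
  C₁⁻¹ * (2 * Real.pi / 3 * (2 : ℝ) ^ level w.m₀ a) ^ (2 * ν)

theorem noiseVar_pos (hC₁ : 0 < C₁) (a : ℕ) : 0 < noiseVar w ν C₁ a := by
  have := Real.pi_pos
  unfold noiseVar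
  positivity

theorem noiseVar_eq (a : ℕ) :
    noiseVar w ν C₁ a =
      C₁⁻¹ * (2 * Real.pi / 3) ^ (2 * ν) * ((2 : ℝ) ^ (level w.m₀ a * ν)) ^ 2 := by
  have := Real.pi_pos
  unfold noiseVar
  rw [Real.mul_rpow (by positivity) (by positivity), ← Real.rpow_mul two_pos.le,
    ← Real.rpow_natCast, ← Real.rpow_mul two_pos.le, mul_assoc]
  congr 3
  push_cast
  ring

/-- After squaring, the factor `20` of the tail bound and the square of `2ε` make up the `80` in the
condition on `Cβ`. -/
theorem sqrt_mul_noiseVar_le_threshold (hC₁ : 0 < C₁) (hCβ : 0 < Cβ)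
    (hCβ' : 80 * C₁⁻¹ * (2 * Real.pi / 3) ^ (2 * ν) ≤ Cβ ^ 2) {ε : ℝ} (hε : 0 < ε)
    (hL : 0 ≤ Real.log (1 / ε)) (a : ℕ) :
    √(20 * Real.log (1 / ε)) * √(noiseVar w ν C₁ a) * (2 * ε) ≤ threshold w ν Cβ ε a := by
  have hpos : 0 ≤ threshold w ν Cβ ε a := by unfold threshold; positivity
  refine abs_le_of_sq_le_sq' ?_ hpos |>.2
  rw [threshold, mul_pow, mul_pow, mul_pow, mul_pow, mul_pow, mul_pow, Real.sq_sqrt (by linarith),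
    Real.sq_sqrt (noiseVar_pos hC₁ a).le, Real.sq_sqrt hL, noiseVar_eq]
  have hnn : 0 ≤ Real.log (1 / ε) * ((2 : ℝ) ^ (level w.m₀ a * ν)) ^ 2 * ε ^ 2 := by positivity
  nlinarith [mul_le_mul_of_nonneg_right hCβ' hnn]

/-- The measurability clause is what allows expectation and the sums over coefficients to be
exchanged later. -/
theorem lintegral_coeffThr_le {Ω : Type*} [MeasurableSpace Ω] {P : Measure Ω}
    [IsProbabilityMeasure P] {Z : L2Torus2 → Ω → ℝ} (hZ : IsWhiteNoise P Z) (hν : 0 < ν)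
    (hC₁ : 0 < C₁) (hC₂ : 0 < C₂) (hg : IsRegularKernel g ν C₁ C₂) (hCβ : 0 < Cβ)
    (hCβ' : 80 * C₁⁻¹ * (2 * Real.pi / 3) ^ (2 * ν) ≤ Cβ ^ 2) {f : Torus2 → ℝ}
    (hf : MemLp f 2 volume) {ε : ℝ} (hε : 0 < ε) (hL : 1 ≤ Real.log (1 / ε))
    {a k a' k' : ℕ} (hk : k < translates w.m₀ a) (hk' : k' < translates w.m₀' a') :
    AEMeasurable (fun ω => ‖coeffThr w g ν Cβ ε (observation g f ε Z ω) a k a' k' -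
        (w.coeff f a k a' k' : ℂ)‖ₑ ^ 2) P ∧
      ∫⁻ ω, ‖coeffThr w g ν Cβ ε (observation g f ε Z ω) a k a' k' -
        (w.coeff f a k a' k' : ℂ)‖ₑ ^ 2 ∂P ≤
      ENNReal.ofReal (9 / 4 * min (w.coeff f a k a' k' ^ 2) (threshold w ν Cβ ε a ^ 2) +
        4 * Real.exp (3 / 2) * ε ^ 5 *
          (noiseVar w ν C₁ a * ε ^ 2 + w.coeff f a k a' k' ^ 2)) := by
  obtain ⟨χ, hχ, hχ'⟩ := exists_coeffEst_eq (w := w) hZ hν hC₁ hC₂ hg hf ε hk hk'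
  set b := w.coeff f a k a' k' with hb
  set t := threshold w ν Cβ ε a with ht
  set T : ℝ → ℝ≥0∞ := fun x => ‖(if t < |b + ε * x| then b + ε * x else 0) - b‖ₑ ^ 2 with hT
  have hTm : Measurable T := by
    refine Measurable.pow_const (Measurable.enorm (Measurable.sub_const ?_ _)) _
    refine Measurable.ite ?_ (by fun_prop) measurable_const
    exact measurableSet_lt measurable_const (by fun_prop)
  have hae : (fun ω => ‖coeffThr w g ν Cβ ε (observation g f ε Z ω) a k a' k' -
      (b : ℂ)‖ₑ ^ 2) =ᵐ[P] fun ω => T (Z χ ω) := by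
    filter_upwards [hχ'] with ω hω
    rw [coeffThr, hω, Complex.norm_real, Real.norm_eq_abs]
    simp only [hT, ← ht]
    rw [← enorm_complex_ofReal]
    split_ifs <;> push_cast <;> rfl
  have hZm : AEMeasurable (Z χ) P := (hZ.memLp χ).1.aemeasurable
  refine ⟨(hTm.comp_aemeasurable hZm).congr hae.symm, ?_⟩
  rw [lintegral_congr_ae hae]
  have hnv := noiseVar_pos (w := w) (ν := ν) hC₁ a
  have h := lintegral_hardThreshold_le (hZ.map_eq_gaussianReal χ) (σ := √(noiseVar w ν C₁ a))
    (t := t) b (Real.sqrt_pos.2 hnv)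
    (by rw [Real.sq_sqrt hnv.le, Real.coe_toNNReal _ (sq_nonneg _)]; exact hχ) hL hε
    (sqrt_mul_noiseVar_le_threshold hC₁ hCβ hCβ' hε (by linarith) a)
  -- The tail factor at `L = ln(1/ε)` is the power `ε⁵`.
  have he : Real.exp (-(5 * Real.log (1 / ε))) = ε ^ 5 := by
    rw [one_div, Real.log_inv, mul_neg, neg_neg, mul_comm, Real.exp_mul, Real.exp_log hε]
    norm_cast
  rwa [Real.sq_sqrt hnv.le, he] at h

theorem risk_le_tsum {Ω : Type*} [MeasurableSpace Ω] {P : Measure Ω}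
    [IsProbabilityMeasure P] {Z : L2Torus2 → Ω → ℝ} (hZ : IsWhiteNoise P Z) (hν : 0 < ν)
    (hC₁ : 0 < C₁) (hC₂ : 0 < C₂) (hg : IsRegularKernel g ν C₁ C₂) (hCβ : 0 < Cβ)
    (hCβ' : 80 * C₁⁻¹ * (2 * Real.pi / 3) ^ (2 * ν) ≤ Cβ ^ 2) {f : Torus2 → ℝ}
    (hf : MemLp f 2 volume) {ε : ℝ} (hε : 0 < ε) (hL : 1 ≤ Real.log (1 / ε)) (J J' : ℕ) :
    risk P Z w g ν Cβ ε J J' f ≤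
      ∑' a, ∑' a', ∑ k ∈ Finset.range (translates w.m₀ a),
        ∑ k' ∈ Finset.range (translates w.m₀' a'), ENNReal.ofReal
          (if a < J + 1 - w.m₀ ∧ a' < J' + 1 - w.m₀' then
            9 / 4 * min (w.coeff f a k a' k' ^ 2) (threshold w ν Cβ ε a ^ 2) +
              4 * Real.exp (3 / 2) * ε ^ 5 *
                (noiseVar w ν C₁ a * ε ^ 2 + w.coeff f a k a' k' ^ 2)
          else w.coeff f a k a' k' ^ 2) := by
  have hterm : ∀ a a' k k', k < translates w.m₀ a → k' < translates w.m₀' a' →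
      AEMeasurable (fun ω => ‖(if a < J + 1 - w.m₀ ∧ a' < J' + 1 - w.m₀' then
        coeffThr w g ν Cβ ε (observation g f ε Z ω) a k a' k' else 0) -
          (w.coeff f a k a' k' : ℂ)‖ₑ ^ 2) P ∧
      ∫⁻ ω, ‖(if a < J + 1 - w.m₀ ∧ a' < J' + 1 - w.m₀' then
        coeffThr w g ν Cβ ε (observation g f ε Z ω) a k a' k' else 0) -
          (w.coeff f a k a' k' : ℂ)‖ₑ ^ 2 ∂P ≤ ENNReal.ofReal
          (if a < J + 1 - w.m₀ ∧ a' < J' + 1 - w.m₀' then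
            9 / 4 * min (w.coeff f a k a' k' ^ 2) (threshold w ν Cβ ε a ^ 2) +
              4 * Real.exp (3 / 2) * ε ^ 5 *
                (noiseVar w ν C₁ a * ε ^ 2 + w.coeff f a k a' k' ^ 2)
          else w.coeff f a k a' k' ^ 2) := by
    intro a a' k k' hk hk'
    split_ifs
    · exact lintegral_coeffThr_le hZ hν hC₁ hC₂ hg hCβ hCβ' hf hε hL hk hk'
    · refine ⟨aemeasurable_const, ?_⟩
      rw [lintegral_const, measure_univ, mul_one, zero_sub, enorm_neg, enorm_complex_ofReal,
        enorm_sq_eq_ofReal]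
  unfold risk estimator
  simp_rw [lintegral_waveletSum_sub w _ _
    (fun a k a' k' => coeffThr w g ν Cβ ε (observation g f ε Z _) a k a' k') hf]
  rw [lintegral_tsum]
  · refine ENNReal.tsum_le_tsum fun a => ?_
    rw [lintegral_tsum]
    · refine ENNReal.tsum_le_tsum fun a' => ?_
      rw [lintegral_finsetSum']
      · refine Finset.sum_le_sum fun k hk => ?_
        rw [lintegral_finsetSum']
        · exact Finset.sum_le_sum fun k' hk' =>
            (hterm a a' k k' (Finset.mem_range.1 hk) (Finset.mem_range.1 hk')).2
        · exact fun k' hk' =>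
            (hterm a a' k k' (Finset.mem_range.1 hk) (Finset.mem_range.1 hk')).1
      · exact fun k hk => Finset.aemeasurable_fun_sum _ fun k' hk' =>
          (hterm a a' k k' (Finset.mem_range.1 hk) (Finset.mem_range.1 hk')).1
    · exact fun a' => Finset.aemeasurable_fun_sum _ fun k hk =>
        Finset.aemeasurable_fun_sum _ fun k' hk' =>
          (hterm a a' k k' (Finset.mem_range.1 hk) (Finset.mem_range.1 hk')).1
  · exact fun a => AEMeasurable.tsum fun a' => Finset.aemeasurable_fun_sum _ fun k hk =>
      Finset.aemeasurable_fun_sum _ fun k' hk' =>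
        (hterm a a' k k' (Finset.mem_range.1 hk) (Finset.mem_range.1 hk')).1

end Risk

/-! ### Sums of minima of exponentials -/

/-- The power `2 ^ z` as an extended nonnegative real. -/
def twoPow (z : ℝ) : ℝ≥0∞ := ENNReal.ofReal ((2 : ℝ) ^ z)

theorem twoPow_add (x y : ℝ) : twoPow (x + y) = twoPow x * twoPow y := by
  rw [twoPow, Real.rpow_add two_pos, ENNReal.ofReal_mul (by positivity)]
  rfl

theorem twoPow_mono {x y : ℝ} (h : x ≤ y) : twoPow x ≤ twoPow y :=
  ENNReal.ofReal_le_ofReal (Real.rpow_le_rpow_of_exponent_le one_le_two h)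

theorem twoPow_ne_top (x : ℝ) : twoPow x ≠ ∞ := ENNReal.ofReal_ne_top

theorem twoPow_zero : twoPow 0 = 1 := by simp [twoPow]

theorem tsum_twoPow_ne_top {α : ℝ} (hα : 0 < α) : ∑' n : ℕ, twoPow (-(α * n)) ≠ ∞ := by
  have h1 : (2 : ℝ) ^ (-α) < 1 := Real.rpow_lt_one_of_one_lt_of_neg one_lt_two (by linarith)
  have h2 := summable_geometric_of_lt_one (by positivity) h1
  have h3 : ∀ n : ℕ, twoPow (-(α * n)) = ENNReal.ofReal (((2 : ℝ) ^ (-α)) ^ n) := fun n => by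
    rw [twoPow, ← Real.rpow_natCast, ← Real.rpow_mul two_pos.le, neg_mul]
  simp_rw [h3]
  exact h2.tsum_ofReal_ne_top

theorem tsum_int_twoPow_ne_top {γ : ℝ} (hγ : 0 < γ) :
    ∑' n : ℤ, twoPow (-(γ * |(n : ℝ)|)) ≠ ∞ := by
  have h1 : (2 : ℝ) ^ (-γ) < 1 := Real.rpow_lt_one_of_one_lt_of_neg one_lt_two (by linarith)
  have h2 := summable_geometric_of_lt_one (by positivity) h1
  have h3 : ∀ n : ℕ, (2 : ℝ) ^ (-(γ * (n : ℝ))) = ((2 : ℝ) ^ (-γ)) ^ n := fun n => by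
    rw [← Real.rpow_natCast, ← Real.rpow_mul two_pos.le, neg_mul]
  have h4 : Summable fun n : ℤ => (2 : ℝ) ^ (-(γ * |(n : ℝ)|)) := by
    refine Summable.of_nat_of_neg ?_ ?_
    · simpa [h3] using h2
    · simpa [h3] using h2
  exact h4.tsum_ofReal_ne_top

/-- The decreasing and the increasing line cross at `z` with height `M`, and their minimum falls off
on both sides of `z` with slope at least `γ = min α β`. The sum is therefore geometric around the
crossing. -/
theorem tsum_min_twoPow_le {α β : ℝ} (hα : 0 < α) (hβ : 0 < β) :
    ∃ C : ℝ≥0∞, C ≠ ∞ ∧ ∀ X Y : ℝ, ∑' n : ℕ, twoPow (min (X - α * n) (Y + β * n)) ≤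
      C * twoPow ((β * X + α * Y) / (α + β)) := by
  set γ := min α β with hγ
  have hγ0 : 0 < γ := lt_min hα hβ
  refine ⟨twoPow γ * ∑' n : ℤ, twoPow (-(γ * |(n : ℝ)|)),
    ENNReal.mul_ne_top (twoPow_ne_top _) (tsum_int_twoPow_ne_top hγ0), fun X Y => ?_⟩
  set M := (β * X + α * Y) / (α + β) with hM
  set z := (X - Y) / (α + β) with hz
  have hab : α + β ≠ 0 := by positivity
  have hX : X = M + α * z := by rw [hM, hz]; field_simp; ring
  have hY : Y = M - β * z := by rw [hM, hz]; field_simp; ring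
  -- The crossing may be negative or fractional. Centring at `⌊z⌋` and summing over all integers
  -- makes the constant independent of `X` and `Y`, at the cost of a factor `2^γ`.
  have hpt : ∀ n : ℕ, twoPow (min (X - α * n) (Y + β * n)) ≤
      twoPow M * twoPow γ * twoPow (-(γ * |(((n : ℤ) - ⌊z⌋ : ℤ) : ℝ)|)) := by
    intro n
    rw [← twoPow_add, ← twoPow_add]
    refine twoPow_mono ?_
    have h1 : |(((n : ℤ) - ⌊z⌋ : ℤ) : ℝ)| ≤ |(n : ℝ) - z| + 1 := by
      have e : (((n : ℤ) - ⌊z⌋ : ℤ) : ℝ) = ((n : ℝ) - z) + Int.fract z := by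
        rw [Int.fract]
        push_cast
        ring
      rw [e]
      refine (abs_add_le _ _).trans ?_
      rw [Int.abs_fract]
      linarith [Int.fract_lt_one z]
    have h2 : min (X - α * n) (Y + β * n) ≤ M - γ * |(n : ℝ) - z| := by
      rcases abs_cases ((n : ℝ) - z) with ⟨h, h'⟩ | ⟨h, h'⟩ <;> rw [h]
      · refine (min_le_left _ _).trans ?_
        have h3 : γ ≤ α := min_le_left _ _
        rw [hX]
        nlinarith
      · refine (min_le_right _ _).trans ?_
        have h3 : γ ≤ β := min_le_right _ _
        rw [hY]
        nlinarith
    nlinarith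
  refine (ENNReal.tsum_le_tsum hpt).trans ?_
  rw [ENNReal.tsum_mul_left, mul_comm (twoPow M), mul_assoc, mul_assoc, mul_comm (twoPow M)]
  gcongr
  rw [← (Equiv.subRight ⌊z⌋).tsum_eq fun n : ℤ => twoPow (-(γ * |(n : ℝ)|))]
  exact ENNReal.tsum_comp_le_tsum_of_injective Nat.cast_injective
    fun n : ℤ => twoPow (-(γ * |((n - ⌊z⌋ : ℤ) : ℝ)|))

/-- The constant `Y` is the smaller exponent for about `-Y/α` terms, after which the sum is
geometric. These equal terms are the source of the logarithms in the rate. -/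
theorem tsum_min_const_twoPow_le {α : ℝ} (hα : 0 < α) :
    ∃ C : ℝ≥0∞, C ≠ ∞ ∧ ∀ Y : ℝ, Y ≤ 0 → ∑' n : ℕ, twoPow (min (-(α * n)) Y) ≤
      C * twoPow Y * ENNReal.ofReal (1 - Y) := by
  set G := ∑' n : ℕ, twoPow (-(α * n)) with hG
  refine ⟨ENNReal.ofReal (1 / α + 1) + G, ENNReal.add_ne_top.2 ⟨ENNReal.ofReal_ne_top,
    tsum_twoPow_ne_top hα⟩, fun Y hY => ?_⟩
  set N := ⌈-Y / α⌉₊ with hN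
  have h1 : -Y / α ≤ N := Nat.le_ceil _
  have h2 : (N : ℝ) < -Y / α + 1 := Nat.ceil_lt_add_one (div_nonneg (by linarith) hα.le)
  rw [← ENNReal.summable.sum_add_tsum_nat_add' (k := N)]
  have e1 : ∑ n ∈ Finset.range N, twoPow (min (-(α * n)) Y) ≤
      ENNReal.ofReal (1 / α + 1) * twoPow Y * ENNReal.ofReal (1 - Y) := by
    calc ∑ n ∈ Finset.range N, twoPow (min (-(α * n)) Y)
        ≤ ∑ n ∈ Finset.range N, twoPow Y :=
          Finset.sum_le_sum fun n _ => twoPow_mono (min_le_right _ _)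
      _ = ENNReal.ofReal N * twoPow Y := by
          rw [Finset.sum_const, Finset.card_range, nsmul_eq_mul, ENNReal.ofReal_natCast]
      _ ≤ ENNReal.ofReal ((1 / α + 1) * (1 - Y)) * twoPow Y := by
          gcongr
          have e : -Y / α = 1 / α * -Y := by ring
          have : 0 < 1 / α := by positivity
          nlinarith
      _ = _ := by
          rw [ENNReal.ofReal_mul (by positivity)]
          ring
  have e2 : ∑' n : ℕ, twoPow (min (-(α * ((n + N : ℕ) : ℝ))) Y) ≤
      G * twoPow Y * ENNReal.ofReal (1 - Y) := by
    calc ∑' n : ℕ, twoPow (min (-(α * ((n + N : ℕ) : ℝ))) Y)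
        ≤ ∑' n : ℕ, twoPow (-(α * n)) * twoPow Y := by
          refine ENNReal.tsum_le_tsum fun n => ?_
          rw [← twoPow_add]
          refine twoPow_mono ((min_le_left _ _).trans ?_)
          rw [div_le_iff₀ hα] at h1
          push_cast
          nlinarith
      _ = G * twoPow Y * 1 := by rw [ENNReal.tsum_mul_right, mul_one]
      _ ≤ _ := by
          gcongr
          rw [← ENNReal.ofReal_one]
          exact ENNReal.ofReal_le_ofReal (by linarith)
  refine (add_le_add e1 e2).trans_eq ?_
  ring

theorem tsum_twoPow_sub_eq (α X : ℝ) :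
    ∑' n : ℕ, twoPow (X - α * n) = (∑' n : ℕ, twoPow (-(α * n))) * twoPow X := by
  rw [← ENNReal.tsum_mul_right]
  refine tsum_congr fun n => ?_
  rw [← twoPow_add]
  congr 1
  ring

/-- The sum over the levels in the two variables of the minimum of the three bounds for the
thresholded energy, where `T = log₂ (1/τ)` is the logarithm of the inverse noise level, `r = p ∧ 2`
and `σᵢ = sᵢ + 1/2 - 1/r`. -/
theorem tsum_tsum_min_twoPow_le {r s₁ s₂ ν σ₁ σ₂ : ℝ} (hr : 1 ≤ r) (hr2 : r ≤ 2) (hν : 0 < ν)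
    (hs₁ : 1 / r ≤ s₁) (hs₂ : 1 / r ≤ s₂) (hσ₁ : σ₁ = s₁ + 1 / 2 - 1 / r)
    (hσ₂ : σ₂ = s₂ + 1 / 2 - 1 / r) {d : ℝ} (hd₁ : d ≤ 2 * s₂ / (2 * s₂ + 1))
    (hd₂ : d ≤ 2 * s₁ / (2 * s₁ + 2 * ν + 1)) (hd₃ : d ≤ 2 * σ₁ / (2 * σ₁ + 2 * ν)) {e : ℕ}
    (he : s₁ = s₂ * (2 * ν + 1) ∨ s₁ = (2 * ν + 1) * (1 / r - 1 / 2) → 1 ≤ e) :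
    ∃ C : ℝ≥0∞, C ≠ ∞ ∧ ∀ T : ℝ, 1 ≤ T →
      ∑' a : ℕ, ∑' a' : ℕ, twoPow (min (-(2 * (a * σ₁ + a' * σ₂)))
        (min (-(r * (a * σ₁ + a' * σ₂)) + (1 - r / 2) * (2 * a * ν - T))
          (a * (2 * ν + 1) + a' - T))) ≤
      C * twoPow (-(d * T)) * ENNReal.ofReal T ^ e := by
  have hr0 : 0 < r := by linarith
  have hi : r * (1 / r) = 1 := by field_simp
  have hi2 : 1 / 2 ≤ 1 / r := one_div_le_one_div_of_le hr0 hr2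
  have hs₁0 : 0 < s₁ := by linarith
  have hs₂0 : 0 < s₂ := by linarith
  have hσ₁0 : 0 < σ₁ := by linarith
  have hσ₂0 : 0 < σ₂ := by linarith
  have hrσ₁ : r * σ₁ = r * s₁ + r / 2 - 1 := by rw [hσ₁]; linear_combination (-1 : ℝ) * hi
  have hrσ₂ : r * σ₂ = r * s₂ + r / 2 - 1 := by rw [hσ₂]; linear_combination (-1 : ℝ) * hi
  -- As functions of `a'`, the second and third exponents cross at height `-θT + κa`; `μ` is the
  -- slope in `a` of the second one.
  set θ := 2 * s₂ / (2 * s₂ + 1) with hθ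
  set κ := 2 * (s₂ * (2 * ν + 1) - s₁) / (2 * s₂ + 1) with hκ
  set μ := -(r * σ₁) + (2 - r) * ν with hμ
  have hθ0 : 0 < θ := by positivity
  have hθ1 : θ ≤ 1 := by rw [hθ, div_le_one (by positivity)]; linarith
  -- summation over the second level
  obtain ⟨D, hD, hD'⟩ : ∃ D : ℝ≥0∞, D ≠ ∞ ∧ ∀ T : ℝ, ∀ a : ℕ,
      ∑' a' : ℕ, twoPow (min (-(2 * (a * σ₁ + a' * σ₂)))
        (min (-(r * (a * σ₁ + a' * σ₂)) + (1 - r / 2) * (2 * a * ν - T))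
          (a * (2 * ν + 1) + a' - T))) ≤
      D * twoPow (min (-(2 * σ₁ * a)) (min (-((1 - r / 2) * T) + μ * a) (-(θ * T) + κ * a))) := by
    obtain ⟨D, hD, hD'⟩ := tsum_min_twoPow_le (α := r * σ₂) (β := 1) (by positivity) one_pos
    set G₁ := ∑' n : ℕ, twoPow (-(2 * σ₂ * n)) with hG₁
    set G₂ := ∑' n : ℕ, twoPow (-(r * σ₂ * n)) with hG₂
    have hG₁t : G₁ ≠ ∞ := tsum_twoPow_ne_top (by positivity)
    have hG₂t : G₂ ≠ ∞ := tsum_twoPow_ne_top (by positivity)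
    refine ⟨max G₁ (max G₂ D), (max_lt hG₁t.lt_top (max_lt hG₂t.lt_top hD.lt_top)).ne,
      fun T a => ?_⟩
    set S := ∑' a' : ℕ, twoPow (min (-(2 * (a * σ₁ + a' * σ₂)))
        (min (-(r * (a * σ₁ + a' * σ₂)) + (1 - r / 2) * (2 * a * ν - T))
          (a * (2 * ν + 1) + a' - T))) with hS
    have b₁ : S ≤ G₁ * twoPow (-(2 * σ₁ * a)) := by
      rw [← tsum_twoPow_sub_eq]
      refine ENNReal.tsum_le_tsum fun a' => twoPow_mono ((min_le_left _ _).trans (le_of_eq ?_))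
      ring
    have b₂ : S ≤ G₂ * twoPow (-((1 - r / 2) * T) + μ * a) := by
      rw [← tsum_twoPow_sub_eq]
      refine ENNReal.tsum_le_tsum fun a' => twoPow_mono
        ((min_le_right _ _).trans ((min_le_left _ _).trans (le_of_eq ?_)))
      rw [hμ]
      ring
    have b₃ : S ≤ D * twoPow (-(θ * T) + κ * a) := by
      refine (ENNReal.tsum_le_tsum fun a' => twoPow_mono
        ((min_le_right _ _).trans (le_of_eq ?_))).trans
        ((hD' (-((1 - r / 2) * T) + μ * a) (a * (2 * ν + 1) - T)).trans_eq ?_)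
      · rw [hμ]
        congr 1 <;> ring
      · congr 2
        have e1 : r * σ₂ + 1 = r * (2 * s₂ + 1) / 2 := by rw [hrσ₂]; ring
        rw [hμ, hrσ₁, e1, hrσ₂, hθ, hκ]
        field_simp
        ring
    rcases min_choice (-(2 * σ₁ * a)) (min (-((1 - r / 2) * T) + μ * a) (-(θ * T) + κ * a))
      with h | h <;> rw [h]
    · exact b₁.trans (by gcongr; exact le_max_left _ _)
    · rcases min_choice (-((1 - r / 2) * T) + μ * a) (-(θ * T) + κ * a) with h | h <;> rw [h]
      · exact b₂.trans (by gcongr; exact (le_max_left _ _).trans (le_max_right _ _))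
      · exact b₃.trans (by gcongr; exact (le_max_right _ _).trans (le_max_right _ _))
  -- summation over the first level
  suffices h : ∃ C : ℝ≥0∞, C ≠ ∞ ∧ ∀ T : ℝ, 1 ≤ T →
      ∑' a : ℕ, twoPow (min (-(2 * σ₁ * a))
        (min (-((1 - r / 2) * T) + μ * a) (-(θ * T) + κ * a))) ≤
      C * twoPow (-(d * T)) * ENNReal.ofReal T ^ e by
    obtain ⟨C, hC, hC'⟩ := h
    refine ⟨D * C, ENNReal.mul_ne_top hD hC, fun T hT => ?_⟩
    refine (ENNReal.tsum_le_tsum fun a => hD' T a).trans ?_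
    rw [ENNReal.tsum_mul_left, mul_assoc D, mul_assoc D]
    gcongr
    exact hC' T hT
  have hdT : ∀ {x T : ℝ}, d ≤ x → 1 ≤ T → twoPow (-(x * T)) ≤ twoPow (-(d * T)) :=
    fun hx hT => twoPow_mono (by nlinarith)
  have hTe : ∀ {T : ℝ}, 1 ≤ T → 1 ≤ ENNReal.ofReal T ^ e := fun hT =>
    one_le_pow_of_one_le' (by rw [← ENNReal.ofReal_one]; exact ENNReal.ofReal_le_ofReal hT) e
  have hnolog : ∀ {x : ℝ} {C S : ℝ≥0∞} {T : ℝ}, d ≤ x → 1 ≤ T → S ≤ C * twoPow (-(x * T)) →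
      S ≤ C * twoPow (-(d * T)) * ENNReal.ofReal T ^ e := fun hx hT h =>
    (h.trans (by gcongr; exact hdT hx hT)).trans (le_mul_of_one_le_right' (hTe hT))
  have hlog : ∀ {x : ℝ} {C S : ℝ≥0∞} {T : ℝ}, d ≤ x → 0 ≤ x → x ≤ 1 → 1 ≤ e → 1 ≤ T →
      S ≤ C * twoPow (-(x * T)) * ENNReal.ofReal (1 - -(x * T)) →
      S ≤ C * 2 * twoPow (-(d * T)) * ENNReal.ofReal T ^ e := by
    intro x C S T hx hx0 hx1 he' hT h
    have h1 : ENNReal.ofReal (1 - -(x * T)) ≤ 2 * ENNReal.ofReal T ^ e := by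
      calc ENNReal.ofReal (1 - -(x * T)) ≤ ENNReal.ofReal (2 * T) :=
            ENNReal.ofReal_le_ofReal (by nlinarith)
        _ = 2 * ENNReal.ofReal T ^ 1 := by
            rw [ENNReal.ofReal_mul two_pos.le, pow_one, ENNReal.ofReal_ofNat]
        _ ≤ _ := by
            gcongr
            rw [← ENNReal.ofReal_one]
            exact ENNReal.ofReal_le_ofReal hT
    calc S ≤ C * twoPow (-(x * T)) * ENNReal.ofReal (1 - -(x * T)) := h
      _ ≤ C * twoPow (-(d * T)) * (2 * ENNReal.ofReal T ^ e) := by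
          gcongr
          exact hdT hx hT
      _ = _ := by ring
  -- For `κ < 0` the third bound alone is summable in `a`, with exponent `θ`. For `κ = 0` it is
  -- constant in `a`; the first bound cuts it off after order `T` levels and one logarithm appears.
  rcases lt_trichotomy κ 0 with hκ0 | hκ0 | hκ0
  · refine ⟨∑' n : ℕ, twoPow (-(-κ * n)), tsum_twoPow_ne_top (by linarith), fun T hT => ?_⟩
    refine hnolog hd₁ hT ?_
    rw [← tsum_twoPow_sub_eq]
    refine ENNReal.tsum_le_tsum fun a => twoPow_mono
      ((min_le_right _ _).trans ((min_le_right _ _).trans (le_of_eq ?_)))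
    ring
  · obtain ⟨C, hC, hC'⟩ := tsum_min_const_twoPow_le (α := 2 * σ₁) (by positivity)
    refine ⟨C * 2, ENNReal.mul_ne_top hC (by simp), fun T hT => ?_⟩
    have he' : 1 ≤ e := by
      refine he (Or.inl ?_)
      rw [hκ, div_eq_zero_iff] at hκ0
      rcases hκ0 with h | h <;> linarith
    refine hlog hd₁ hθ0.le hθ1 he' hT ((ENNReal.tsum_le_tsum fun a => twoPow_mono ?_).trans
      (hC' (-(θ * T)) (by nlinarith)))
    rw [hκ0, zero_mul, add_zero]
    exact min_le_min le_rfl (min_le_right _ _)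
  -- With `κ > 0` the third bound grows. If `μ < 0` it crosses the second one, giving
  -- `2s₁/(2s₁+2ν+1)`; if `μ > 0` the second crosses the first, giving `2σ₁/(2σ₁+2ν)`. At `μ = 0`
  -- the second is constant at `1 - r/2 = 2σ₁/(2σ₁+2ν)`, with one logarithm.
  rcases lt_trichotomy μ 0 with hμ0 | hμ0 | hμ0
  · obtain ⟨C, hC, hC'⟩ := tsum_min_twoPow_le (α := -μ) (β := κ) (by linarith) hκ0
    refine ⟨C, hC, fun T hT => ?_⟩
    refine hnolog hd₂ hT ((ENNReal.tsum_le_tsum fun a => twoPow_mono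
      ((min_le_right _ _).trans (le_of_eq ?_))).trans
      ((hC' (-((1 - r / 2) * T)) (-(θ * T))).trans_eq ?_))
    · congr 1
      ring
    · congr 2
      have hne : -μ + κ ≠ 0 := by linarith
      have hne' : 2 * s₁ + 2 * ν + 1 ≠ 0 := by positivity
      rw [div_eq_iff hne]
      rw [hκ, hθ, hμ, hrσ₁]
      field_simp
      ring
  · obtain ⟨C, hC, hC'⟩ := tsum_min_const_twoPow_le (α := 2 * σ₁) (by positivity)
    have hx : 2 * σ₁ / (2 * σ₁ + 2 * ν) = 1 - r / 2 := by
      rw [div_eq_iff (by positivity)]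
      rw [hμ] at hμ0
      linear_combination -hμ0
    have hμ1 : s₁ = (2 * ν + 1) * (1 / r - 1 / 2) := by
      have h1 : r * s₁ = r * ((2 * ν + 1) * (1 / r - 1 / 2)) := by
        rw [hμ, hrσ₁] at hμ0
        linear_combination -hμ0 - (2 * ν + 1) * hi
      exact mul_left_cancel₀ hr0.ne' h1
    rw [hx] at hd₃
    refine ⟨C * 2, ENNReal.mul_ne_top hC (by simp), fun T hT => ?_⟩
    refine hlog hd₃ (by linarith) (by linarith) (he (Or.inr hμ1)) hT
      ((ENNReal.tsum_le_tsum fun a => twoPow_mono ?_).trans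
      (hC' (-((1 - r / 2) * T)) (by nlinarith)))
    rw [hμ0, zero_mul, add_zero]
    exact min_le_min le_rfl (min_le_left _ _)
  · obtain ⟨C, hC, hC'⟩ := tsum_min_twoPow_le (α := 2 * σ₁) (β := μ) (by positivity) hμ0
    refine ⟨C, hC, fun T hT => ?_⟩
    refine hnolog hd₃ hT ((ENNReal.tsum_le_tsum fun a => twoPow_mono
      (min_le_min le_rfl (min_le_left _ _))).trans ?_)
    have h := hC' 0 (-((1 - r / 2) * T))
    simp only [zero_sub] at h
    refine h.trans_eq ?_
    congr 2
    rw [div_eq_iff (by positivity)]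
    rw [hμ]
    field_simp
    ring

/-! ### Coefficients of functions in a Besov ball -/

theorem le_ellNorm {ι : Type*} {p : ℝ≥0∞} (hp : 1 ≤ p) (c : ι → ℝ≥0∞) (i : ι) :
    c i ≤ ellNorm p c := by
  unfold ellNorm
  split_ifs with h
  · exact le_iSup c i
  · have hp0 : 0 < p.toReal := ENNReal.toReal_pos (by rintro rfl; simp at hp) h
    calc c i = (c i ^ p.toReal) ^ (1 / p.toReal) := by
          rw [← ENNReal.rpow_mul, mul_one_div_cancel hp0.ne', ENNReal.rpow_one]
      _ ≤ _ := by
          gcongr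
          exact ENNReal.le_tsum i

theorem sum_abs_rpow_le_of_ellNorm_le {ι : Type*} [Fintype ι] {p : ℝ≥0∞} (hp : p ≠ 0)
    (hp' : p ≠ ∞) {c : ι → ℝ} {B : ℝ} (hB : 0 ≤ B)
    (h : ellNorm p (fun i => ‖c i‖ₑ) ≤ ENNReal.ofReal B) :
    ∑ i, |c i| ^ p.toReal ≤ B ^ p.toReal := by
  have hp0 : 0 < p.toReal := ENNReal.toReal_pos hp hp'
  rw [ellNorm, if_neg hp', tsum_fintype, one_div, ENNReal.rpow_inv_le_iff hp0,
    ENNReal.ofReal_rpow_of_nonneg hB hp0.le] at h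
  have e : ∀ i, ‖c i‖ₑ ^ p.toReal = ENNReal.ofReal (|c i| ^ p.toReal) := fun i => by
    rw [← ofReal_norm, ENNReal.ofReal_rpow_of_nonneg (norm_nonneg _) hp0.le, Real.norm_eq_abs]
  simp_rw [e] at h
  rwa [← ENNReal.ofReal_sum_of_nonneg fun i _ => by positivity,
    ENNReal.ofReal_le_ofReal_iff (by positivity)] at h

/-- The `ℓ^r` norm, `r = p ∧ 2`, of a finite family of bounded `ℓ^p` norm. -/
theorem sum_abs_rpow_min_le {ι : Type*} [Fintype ι] {p : ℝ≥0∞} (hp : 1 ≤ p) {c : ι → ℝ} {B N : ℝ}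
    (hB : 0 ≤ B) (hN : 0 < N) (hcard : (Fintype.card ι : ℝ) ≤ N)
    (h : ellNorm p (fun i => ‖c i‖ₑ) ≤ ENNReal.ofReal B) :
    ∑ i, |c i| ^ (min p 2).toReal ≤
      (N ^ (1 / (min p 2).toReal - (p⁻¹).toReal) * B) ^ (min p 2).toReal := by
  have hp0 : p ≠ 0 := by rintro rfl; simp at hp
  rcases le_or_gt p 2 with hp2 | hp2
  · have hpt : p ≠ ∞ := ne_top_of_le_ne_top (by simp) hp2
    rw [min_eq_left hp2, ENNReal.toReal_inv, one_div, sub_self, Real.rpow_zero, one_mul]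
    exact sum_abs_rpow_le_of_ellNorm_le hp0 hpt hB h
  rw [min_eq_right hp2.le, ENNReal.toReal_ofNat]
  rcases eq_or_ne p ∞ with rfl | hpt
  · have h1 : ∀ i, |c i| ≤ B := fun i => by
      have := (le_ellNorm le_top (fun i => ‖c i‖ₑ) i).trans h
      rwa [← ofReal_norm, ENNReal.ofReal_le_ofReal_iff hB] at this
    calc ∑ i, |c i| ^ (2 : ℝ) ≤ ∑ i : ι, B ^ (2 : ℝ) :=
          Finset.sum_le_sum fun i _ => Real.rpow_le_rpow (abs_nonneg _) (h1 i) two_pos.le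
      _ = Fintype.card ι * B ^ (2 : ℝ) := by simp
      _ ≤ N * B ^ (2 : ℝ) := by gcongr
      _ = _ := by
          rw [Real.mul_rpow (by positivity) hB, ← Real.rpow_mul hN.le]
          norm_num
  · set P := p.toReal with hP
    have hP2 : 2 < P := by
      rw [hP, ← ENNReal.toReal_ofNat 2]
      exact (ENNReal.toReal_lt_toReal (by simp) hpt).2 hp2
    have h1 := sum_abs_rpow_le_of_ellNorm_le hp0 hpt hB h
    rw [← hP] at h1
    -- The power mean inequality with exponent `P/2 > 1` passes from `ℓ^p` to `ℓ²`, at the cost of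
    -- `N^{1/2 - 1/p}`.
    have h2 := Real.rpow_sum_le_const_mul_sum_rpow_of_nonneg Finset.univ
      (f := fun i => |c i| ^ (2 : ℝ)) (p := P / 2) (by linarith) fun i _ => by positivity
    have h3 : ∀ i, (|c i| ^ (2 : ℝ)) ^ (P / 2) = |c i| ^ P := fun i => by
      rw [← Real.rpow_mul (abs_nonneg _)]
      congr 1
      ring
    simp_rw [h3] at h2
    have h4 : (∑ i, |c i| ^ (2 : ℝ)) ^ (P / 2) ≤ N ^ (P / 2 - 1) * B ^ P := by
      refine h2.trans ?_
      rw [Finset.card_univ]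
      exact mul_le_mul (Real.rpow_le_rpow (by positivity) hcard (by linarith)) h1 (by positivity)
        (by positivity)
    have h5 : ((N ^ (1 / 2 - (p⁻¹).toReal) * B) ^ (2 : ℝ)) ^ (P / 2) =
        N ^ (P / 2 - 1) * B ^ P := by
      rw [← Real.rpow_mul (by positivity), Real.mul_rpow (by positivity) hB,
        ← Real.rpow_mul hN.le, ENNReal.toReal_inv, ← hP]
      congr 2
      · field_simp
      · ring
    rw [← h5] at h4
    exact (Real.rpow_le_rpow_iff (by positivity) (by positivity) (by linarith)).1 h4

theorem sum_range_range_eq (n n' : ℕ) {M : Type*} [AddCommMonoid M] (F : ℕ → ℕ → M) :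
    ∑ k ∈ Finset.range n, ∑ k' ∈ Finset.range n', F k k' =
      ∑ i : Fin n × Fin n', F i.1 i.2 := by
  rw [Fintype.sum_prod_type, Finset.sum_range]
  refine Finset.sum_congr rfl fun k _ => ?_
  rw [Finset.sum_range]

theorem translates_le (m₀ a : ℕ) : translates m₀ a ≤ 2 ^ (m₀ + a) := by
  cases a with
  | zero => exact le_rfl
  | succ a => exact Nat.pow_le_pow_right two_pos (by omega)

/-- The `+ 1` is needed only at `a = 0`, where `2^{m₀}` scaling functions sit at level `m₀ - 1`. -/
theorem translates_le_rpow (m₀ a : ℕ) : (translates m₀ a : ℝ) ≤ (2 : ℝ) ^ (level m₀ a + 1) := by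
  have h : (2 : ℝ) ^ (level m₀ a + 1) = ((2 ^ (m₀ + a) : ℕ) : ℝ) := by
    rw [level, show (m₀ : ℝ) - 1 + a + 1 = ((m₀ + a : ℕ) : ℝ) by push_cast; ring,
      Real.rpow_natCast]
    norm_num
  rw [h]
  exact_mod_cast translates_le m₀ a

/-- The bound of a Besov ball for the `ℓ^r` norm, `r = p ∧ 2`, of the coefficients of two
levels. -/
theorem sum_abs_coeff_rpow_le {w : WaveletSystem} {s₁ s₂ : ℝ} {p q : ℝ≥0∞} (hp : 1 ≤ p)
    (hq : 1 ≤ q) (hσ₁ : 0 ≤ shifted s₁ (min p 2)) (hσ₂ : 0 ≤ shifted s₂ (min p 2)) {A : ℝ}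
    (hA : 0 < A) {f : Torus2 → ℝ} (hf : f ∈ besovBall w s₁ s₂ p q A) (a a' : ℕ) :
    ∑ k ∈ Finset.range (translates w.m₀ a), ∑ k' ∈ Finset.range (translates w.m₀' a'),
        |w.coeff f a k a' k'| ^ (min p 2).toReal ≤
      (A * (2 : ℝ) ^ (1 + shifted s₁ (min p 2) + shifted s₂ (min p 2)) *
        (2 : ℝ) ^ (-(a * shifted s₁ (min p 2) + a' * shifted s₂ (min p 2)))) ^
          (min p 2).toReal := by
  have h1 := (le_ellNorm hq _ (a, a')).trans hf.2
  simp only at h1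
  set l := level w.m₀ a with hl
  set l' := level w.m₀' a' with hl'
  set E := l * shifted s₁ p + l' * shifted s₂ p with hE
  have h2 : ellNorm p (fun k : Fin (translates w.m₀ a) × Fin (translates w.m₀' a') =>
      ‖w.coeff f a k.1 a' k.2‖ₑ) ≤ ENNReal.ofReal ((2 : ℝ) ^ (-E) * A) := by
    rw [ENNReal.ofReal_mul (by positivity)]
    refine le_trans (le_of_eq ?_) (mul_le_mul_right h1 _)
    rw [← mul_assoc, ← ENNReal.ofReal_mul (by positivity), ← Real.rpow_add two_pos,
      neg_add_cancel, Real.rpow_zero, ENNReal.ofReal_one, one_mul]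
  have h3 := sum_abs_rpow_min_le hp (c := fun k : Fin (translates w.m₀ a) ×
    Fin (translates w.m₀' a') => w.coeff f a k.1 a' k.2) (by positivity)
    (N := (2 : ℝ) ^ (l + 1 + (l' + 1))) (by positivity) (by
      rw [Fintype.card_prod, Fintype.card_fin, Fintype.card_fin, Real.rpow_add two_pos]
      push_cast
      exact mul_le_mul (translates_le_rpow _ _) (translates_le_rpow _ _) (by positivity)
        (by positivity)) h2
  rw [sum_range_range_eq _ _ fun k k' => |w.coeff f a k a' k'| ^ (min p 2).toReal]
  refine h3.trans (Real.rpow_le_rpow (by positivity) ?_ ENNReal.toReal_nonneg)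
  -- With `δ = 1/r - 1/p`, the factor `N^δ` turns the weights with `1/p` into weights with `1/r`,
  -- leaving `2^{2δ} ≤ 2`. Replacing the levels by `a - 1` and `a' - 1` costs the rest of the
  -- constant.
  have hδ : 1 / (min p 2).toReal - (p⁻¹).toReal ≤ 1 / 2 := by
    rcases le_or_gt p 2 with hp2 | hp2
    · rw [min_eq_left hp2, ENNReal.toReal_inv, one_div, sub_self]
      norm_num
    · rw [min_eq_right hp2.le, ENNReal.toReal_ofNat]
      linarith [ENNReal.toReal_nonneg (a := p⁻¹)]
  have hs : ∀ s, shifted s p = shifted s (min p 2) + (1 / (min p 2).toReal - (p⁻¹).toReal) := by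
    intro s
    simp only [shifted, ENNReal.toReal_inv]
    ring
  rw [← Real.rpow_mul two_pos.le, ← mul_assoc, ← Real.rpow_add two_pos, mul_comm, mul_assoc A,
    ← Real.rpow_add two_pos]
  refine mul_le_mul_of_nonneg_left (Real.rpow_le_rpow_of_exponent_le one_le_two ?_) hA.le
  rw [hE, hs s₁, hs s₂]
  have hla : (a : ℝ) - 1 ≤ l := by
    rw [hl, level]
    linarith [Nat.cast_nonneg (α := ℝ) w.m₀]
  have hla' : (a' : ℝ) - 1 ≤ l' := by
    rw [hl', level]
    linarith [Nat.cast_nonneg (α := ℝ) w.m₀']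
  nlinarith [mul_le_mul_of_nonneg_right hla hσ₁, mul_le_mul_of_nonneg_right hla' hσ₂]

/-! ### Thresholded energy of a finite family -/

section Energy

variable {ι : Type*} {s : Finset ι} {c : ι → ℝ} {r W t : ℝ}

theorem abs_le_of_sum_rpow_le (hr : 0 < r) (hW : 0 ≤ W) (h : ∑ i ∈ s, |c i| ^ r ≤ W ^ r) {i : ι}
    (hi : i ∈ s) : |c i| ≤ W := by
  have h1 : |c i| ^ r ≤ W ^ r :=
    (Finset.single_le_sum (f := fun i => |c i| ^ r) (fun _ _ => by positivity) hi).trans h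
  exact (Real.rpow_le_rpow_iff (abs_nonneg _) hW hr).1 h1

theorem rpow_mul_rpow_two_sub {x : ℝ} (hx : 0 ≤ x) : x ^ r * x ^ (2 - r) = x ^ 2 := by
  rw [← Real.rpow_natCast, ← Real.rpow_add' hx (by norm_num)]
  congr 1
  push_cast
  ring

/-- Interpolation: `min(c², t²) ≤ |c|^r t^{2-r}`, whichever of `|c|` and `t` is larger. -/
theorem sum_min_sq_le_rpow (hr : 0 < r) (hr2 : r ≤ 2) (ht : 0 ≤ t)
    (h : ∑ i ∈ s, |c i| ^ r ≤ W ^ r) :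
    ∑ i ∈ s, min (c i ^ 2) (t ^ 2) ≤ W ^ r * t ^ (2 - r) := by
  calc ∑ i ∈ s, min (c i ^ 2) (t ^ 2) ≤ ∑ i ∈ s, |c i| ^ r * t ^ (2 - r) := by
        refine Finset.sum_le_sum fun i _ => ?_
        rcases le_total |c i| t with hi | hi
        · refine (min_le_left _ _).trans ?_
          rw [← sq_abs, ← rpow_mul_rpow_two_sub (r := r) (abs_nonneg (c i))]
          gcongr
        · refine (min_le_right _ _).trans ?_
          rw [← rpow_mul_rpow_two_sub (r := r) ht]
          gcongr
    _ = (∑ i ∈ s, |c i| ^ r) * t ^ (2 - r) := by rw [Finset.sum_mul]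
    _ ≤ _ := by gcongr

/-- The interpolation bound with cut-off `W`, which cuts off nothing because every `|c i|` is at
most `W`. -/
theorem sum_sq_le_of_sum_rpow_le (hr : 0 < r) (hr2 : r ≤ 2) (hW : 0 ≤ W)
    (h : ∑ i ∈ s, |c i| ^ r ≤ W ^ r) : ∑ i ∈ s, c i ^ 2 ≤ W ^ 2 := by
  have h1 := sum_min_sq_le_rpow hr hr2 hW h
  rw [rpow_mul_rpow_two_sub hW] at h1
  refine le_trans (Finset.sum_le_sum fun i hi => le_min le_rfl ?_) h1
  rw [← sq_abs]
  exact pow_le_pow_left₀ (abs_nonneg _) (abs_le_of_sum_rpow_le hr hW h hi) 2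

end Energy

/-! ### Sums over the levels -/

theorem ofReal_rpow_two (z : ℝ) : ENNReal.ofReal ((2 : ℝ) ^ z) = twoPow z := rfl

theorem sum_range_twoPow_le {c : ℝ} (hc : 1 ≤ c) (R : ℕ) :
    ∑ a ∈ Finset.range R, twoPow (c * a) ≤ twoPow (c * R) := by
  induction R with
  | zero => simp
  | succ R ih =>
    rw [Finset.sum_range_succ]
    calc _ ≤ twoPow (c * R) + twoPow (c * R) := by gcongr
      _ = twoPow 1 * twoPow (c * R) := by
          rw [← two_mul]
          congr 1
          simp [twoPow]
      _ = twoPow (1 + c * R) := (twoPow_add _ _).symm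
      _ ≤ _ := twoPow_mono (by push_cast; linarith)

theorem tsum_ite_lt_eq (R : ℕ) (F : ℕ → ℝ≥0∞) :
    ∑' a, (if a < R then F a else 0) = ∑ a ∈ Finset.range R, F a := by
  rw [tsum_eq_sum (s := Finset.range R) fun a ha => if_neg (by simpa using ha)]
  exact Finset.sum_congr rfl fun a ha => if_pos (Finset.mem_range.1 ha)

theorem tsum_ite_le_eq (R : ℕ) (F : ℕ → ℝ≥0∞) :
    ∑' a, (if R ≤ a then F a else 0) = ∑' n, F (n + R) := by
  rw [← ENNReal.summable.sum_add_tsum_nat_add' (k := R), Finset.sum_eq_zero, zero_add]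
  · exact tsum_congr fun n => if_pos (Nat.le_add_left _ _)
  · exact fun a ha => if_neg (by simpa using ha)

/-- Sum of a product of exponentials over the levels outside a rectangle. -/
theorem tsum_tsum_outside_le {α β : ℝ} (hα : 0 < α) (hβ : 0 < β) :
    ∃ C : ℝ≥0∞, C ≠ ∞ ∧ ∀ R R' : ℕ, ∑' a : ℕ, ∑' a' : ℕ,
      (if a < R ∧ a' < R' then 0 else twoPow (-(α * a) + -(β * a'))) ≤
        C * (twoPow (-(α * R)) + twoPow (-(β * R'))) := by
  set G := ∑' n : ℕ, twoPow (-(α * n)) with hG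
  set G' := ∑' n : ℕ, twoPow (-(β * n)) with hG'
  refine ⟨G * G', ENNReal.mul_ne_top (tsum_twoPow_ne_top hα) (tsum_twoPow_ne_top hβ),
    fun R R' => ?_⟩
  have hshift : ∀ (c : ℝ) (N : ℕ), ∑' n : ℕ, (if N ≤ n then twoPow (-(c * n)) else 0) =
      (∑' n : ℕ, twoPow (-(c * n))) * twoPow (-(c * N)) := fun c N => by
    rw [tsum_ite_le_eq N fun n => twoPow (-(c * n)), ← tsum_twoPow_sub_eq]
    refine tsum_congr fun n => ?_
    congr 1
    push_cast
    ring
  -- Outside the rectangle `a ≥ R` or `a' ≥ R'`; the two half-planes are summed separately.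
  calc _ ≤ ∑' a : ℕ, ∑' a' : ℕ,
        ((if R ≤ a then twoPow (-(α * a)) else 0) * twoPow (-(β * a')) +
          twoPow (-(α * a)) * (if R' ≤ a' then twoPow (-(β * a')) else 0)) := by
        refine ENNReal.tsum_le_tsum fun a => ENNReal.tsum_le_tsum fun a' => ?_
        split_ifs with h1 h2 h3 h4 h5
        all_goals first | exact bot_le | skip
        · rw [twoPow_add]; exact le_self_add
        · rw [twoPow_add]; exact le_self_add
        · rw [twoPow_add]; exact le_add_self
        · omega
    _ = _ := by
        simp_rw [ENNReal.tsum_add, ENNReal.tsum_mul_left, ENNReal.tsum_mul_right]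
        rw [hshift, hshift]
        ring

theorem tsum_tsum_inside_le {c c' : ℝ} (hc : 1 ≤ c) (hc' : 1 ≤ c') (R R' : ℕ) :
    ∑' a : ℕ, ∑' a' : ℕ, (if a < R ∧ a' < R' then twoPow (c * a + c' * a') else 0) ≤
      twoPow (c * R + c' * R') := by
  calc _ = ∑' a : ℕ, ∑' a' : ℕ, (if a < R then twoPow (c * a) else 0) *
        (if a' < R' then twoPow (c' * a') else 0) := by
        refine tsum_congr fun a => tsum_congr fun a' => ?_
        rw [twoPow_add]
        by_cases h1 : a < R <;> by_cases h2 : a' < R' <;> simp [h1, h2]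
    _ = (∑ a ∈ Finset.range R, twoPow (c * a)) * ∑ a' ∈ Finset.range R', twoPow (c' * a') := by
        simp_rw [ENNReal.tsum_mul_left, ENNReal.tsum_mul_right]
        rw [tsum_ite_lt_eq R fun a => twoPow (c * a), tsum_ite_lt_eq R' fun a => twoPow (c' * a)]
    _ ≤ _ := by
        rw [twoPow_add]
        gcongr <;> exact sum_range_twoPow_le (by assumption) _

/-- Thresholded energy of a finite family as a minimum of three exponentials. -/
theorem sum_min_sq_le_min_twoPow {ι : Type*} {s : Finset ι} {c : ι → ℝ}
    {r A K Λ M u z y n : ℝ} (hr : 1 ≤ r) (hr2 : r ≤ 2) (hA : 0 < A) (hK : 0 < K) (hΛ : 0 < Λ)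
    (hKM : K ≤ M) (hΛM : Λ ≤ M) (hn : 0 ≤ n) (hcard : (s.card : ℝ) ≤ 2 ^ (n + y))
    (h : ∑ i ∈ s, |c i| ^ r ≤ (A * K * 2 ^ (-u)) ^ r) :
    ∑ i ∈ s, ENNReal.ofReal (min (c i ^ 2) ((A * Λ * 2 ^ z) ^ 2)) ≤
      ENNReal.ofReal (A ^ 2) * ENNReal.ofReal (2 ^ n * M ^ 2) *
        twoPow (min (-(2 * u)) (min (-(r * u) + (2 - r) * z) (y + 2 * z))) := by
  have hr0 : 0 < r := by linarith
  have hM : 0 < M := hK.trans_le hKM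
  rw [← ENNReal.ofReal_sum_of_nonneg fun i _ => le_min (sq_nonneg _) (sq_nonneg _),
    ← ENNReal.ofReal_mul (by positivity), ← ofReal_rpow_two, ← ENNReal.ofReal_mul (by positivity)]
  refine ENNReal.ofReal_le_ofReal ?_
  have h2n : (1 : ℝ) ≤ 2 ^ n := Real.one_le_rpow one_le_two hn
  have hpow : ∀ x : ℝ, ((2 : ℝ) ^ x) ^ 2 = 2 ^ (2 * x) := fun x => by
    rw [← Real.rpow_natCast, ← Real.rpow_mul two_pos.le]
    congr 1
    push_cast
    ring
  -- The three bounds are the full energy, the interpolation with `λ^{2-r}`, and the count times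
  -- `λ²`.
  have b₁ : ∑ i ∈ s, min (c i ^ 2) ((A * Λ * 2 ^ z) ^ 2) ≤
      A ^ 2 * (2 ^ n * M ^ 2) * 2 ^ (-(2 * u)) := by
    calc _ ≤ ∑ i ∈ s, c i ^ 2 := Finset.sum_le_sum fun i _ => min_le_left _ _
      _ ≤ (A * K * 2 ^ (-u)) ^ 2 := sum_sq_le_of_sum_rpow_le hr0 hr2 (by positivity) h
      _ = A ^ 2 * (1 * K ^ 2) * 2 ^ (-(2 * u)) := by
          rw [mul_pow, mul_pow, hpow, mul_neg, one_mul]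
      _ ≤ _ := by gcongr
  have b₂ : ∑ i ∈ s, min (c i ^ 2) ((A * Λ * 2 ^ z) ^ 2) ≤
      A ^ 2 * (2 ^ n * M ^ 2) * 2 ^ (-(r * u) + (2 - r) * z) := by
    calc _ ≤ (A * K * 2 ^ (-u)) ^ r * (A * Λ * 2 ^ z) ^ (2 - r) :=
          sum_min_sq_le_rpow hr0 hr2 (by positivity) h
      _ ≤ (A * M * 2 ^ (-u)) ^ r * (A * M * 2 ^ z) ^ (2 - r) := by
          gcongr
      _ = (A * M) ^ 2 * 2 ^ (-(r * u) + (2 - r) * z) := by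
          rw [Real.mul_rpow (by positivity) (by positivity),
            Real.mul_rpow (x := A * M) (by positivity) (by positivity),
            ← rpow_mul_rpow_two_sub (r := r) (x := A * M) (by positivity),
            ← Real.rpow_mul two_pos.le, ← Real.rpow_mul two_pos.le, Real.rpow_add two_pos]
          ring_nf
      _ = A ^ 2 * (1 * M ^ 2) * 2 ^ (-(r * u) + (2 - r) * z) := by ring
      _ ≤ _ := by gcongr
  have b₃ : ∑ i ∈ s, min (c i ^ 2) ((A * Λ * 2 ^ z) ^ 2) ≤
      A ^ 2 * (2 ^ n * M ^ 2) * 2 ^ (y + 2 * z) := by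
    calc _ ≤ ∑ i ∈ s, (A * Λ * 2 ^ z) ^ 2 := Finset.sum_le_sum fun i _ => min_le_right _ _
      _ = s.card * (A * Λ * 2 ^ z) ^ 2 := by rw [Finset.sum_const, nsmul_eq_mul]
      _ ≤ 2 ^ (n + y) * (A * M * 2 ^ z) ^ 2 := by gcongr
      _ = _ := by
          rw [mul_pow, hpow, Real.rpow_add two_pos, Real.rpow_add two_pos]
          ring
  rcases min_choice (-(2 * u)) (min (-(r * u) + (2 - r) * z) (y + 2 * z)) with h' | h' <;> rw [h']
  · exact b₁
  · rcases min_choice (-(r * u) + (2 - r) * z) (y + 2 * z) with h' | h' <;> rw [h']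
    · exact b₂
    · exact b₃

/-! ### The risk over a Besov ball -/

theorem two_rpow_logb_half {A ε : ℝ} (hA : 0 < A) (hε : 0 < ε) (hL : 0 < Real.log (1 / ε)) :
    (2 : ℝ) ^ (Real.logb 2 (ε ^ 2 * Real.log (1 / ε) / A ^ 2) / 2) =
      ε * √(Real.log (1 / ε)) / A := by
  have hτ : 0 < ε ^ 2 * Real.log (1 / ε) / A ^ 2 := by positivity
  rw [div_eq_mul_one_div (Real.logb _ _), Real.rpow_mul two_pos.le,
    Real.rpow_logb two_pos (by norm_num) hτ, ← Real.sqrt_eq_rpow, Real.sqrt_div (by positivity),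
    Real.sqrt_mul (by positivity), Real.sqrt_sq hε.le, Real.sqrt_sq hA.le]

/-- Writing the threshold as `A √τ 2^{aν}` up to a constant makes `A²` factor out of every level
bound, so the final constant does not depend on `A`. -/
theorem threshold_eq (w : WaveletSystem) (ν Cβ : ℝ) {A ε : ℝ} (hA : 0 < A) (hε : 0 < ε)
    (hL : 0 < Real.log (1 / ε)) (a : ℕ) :
    threshold w ν Cβ ε a = A * (Cβ * (2 : ℝ) ^ (((w.m₀ : ℝ) - 1) * ν)) *
      (2 : ℝ) ^ (a * ν + Real.logb 2 (ε ^ 2 * Real.log (1 / ε) / A ^ 2) / 2) := by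
  rw [Real.rpow_add two_pos, two_rpow_logb_half hA hε hL, threshold, level, add_mul,
    Real.rpow_add two_pos]
  field_simp

theorem card_translates_le (m₀ m₀' a a' : ℕ) :
    ((translates m₀ a * translates m₀' a' : ℕ) : ℝ) ≤
      (2 : ℝ) ^ (((m₀ : ℝ) + m₀') + ((a : ℝ) + a')) := by
  rw [show ((m₀ : ℝ) + m₀') + ((a : ℝ) + a') = ((m₀ + a + (m₀' + a') : ℕ) : ℝ) by push_cast; ring,
    Real.rpow_natCast, pow_add]
  exact_mod_cast Nat.mul_le_mul (translates_le m₀ a) (translates_le m₀' a')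

section Levels

variable {w : WaveletSystem} {s₁ s₂ : ℝ} {p q : ℝ≥0∞}

theorem one_le_toReal_min_two (hp : 1 ≤ p) : 1 ≤ (min p 2).toReal := by
  have h : (1 : ℝ≥0∞) ≤ min p 2 := le_min hp one_le_two
  simpa using ENNReal.toReal_mono (ne_top_of_le_ne_top ENNReal.ofNat_ne_top (min_le_right p 2)) h

theorem toReal_min_two_le : (min p 2).toReal ≤ 2 := by
  simpa using ENNReal.toReal_mono ENNReal.ofNat_ne_top (min_le_right p 2)

/-- The energy of the coefficients of two levels. -/
theorem sum_ofReal_coeff_sq_le (hp : 1 ≤ p) (hq : 1 ≤ q) (hσ₁ : 0 ≤ shifted s₁ (min p 2))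
    (hσ₂ : 0 ≤ shifted s₂ (min p 2)) {A : ℝ} (hA : 0 < A) {f : Torus2 → ℝ}
    (hf : f ∈ besovBall w s₁ s₂ p q A) (a a' : ℕ) :
    ∑ k ∈ Finset.range (translates w.m₀ a), ∑ k' ∈ Finset.range (translates w.m₀' a'),
        ENNReal.ofReal (w.coeff f a k a' k' ^ 2) ≤
      ENNReal.ofReal (A ^ 2) *
        ENNReal.ofReal (((2 : ℝ) ^ (1 + shifted s₁ (min p 2) + shifted s₂ (min p 2))) ^ 2) *
        twoPow (-(2 * shifted s₁ (min p 2) * a) + -(2 * shifted s₂ (min p 2) * a')) := by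
  have h := sum_abs_coeff_rpow_le hp hq hσ₁ hσ₂ hA hf a a'
  rw [sum_range_range_eq _ _ fun k k' => |w.coeff f a k a' k'| ^ (min p 2).toReal] at h
  have h2 := sum_sq_le_of_sum_rpow_le (by linarith [one_le_toReal_min_two hp]) toReal_min_two_le
    (by positivity) h
  rw [sum_range_range_eq _ _ fun k k' => ENNReal.ofReal (w.coeff f a k a' k' ^ 2),
    ← ENNReal.ofReal_sum_of_nonneg fun i _ => sq_nonneg _, ← ENNReal.ofReal_mul (by positivity),
    ← ofReal_rpow_two, ← ENNReal.ofReal_mul (by positivity)]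
  refine ENNReal.ofReal_le_ofReal (h2.trans_eq ?_)
  rw [mul_pow, mul_pow, ← Real.rpow_natCast ((2 : ℝ) ^ (-_)), ← Real.rpow_mul two_pos.le]
  congr 2
  push_cast
  ring

/-- The coefficients of two levels, cut off at the threshold. -/
theorem sum_ofReal_min_threshold_le (hp : 1 ≤ p) (hq : 1 ≤ q) (hσ₁ : 0 ≤ shifted s₁ (min p 2))
    (hσ₂ : 0 ≤ shifted s₂ (min p 2)) {A : ℝ} (hA : 0 < A) {f : Torus2 → ℝ}
    (hf : f ∈ besovBall w s₁ s₂ p q A) {ν Cβ ε : ℝ} (hCβ : 0 < Cβ) (hε : 0 < ε)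
    (hL : 0 < Real.log (1 / ε)) (a a' : ℕ) :
    ∑ k ∈ Finset.range (translates w.m₀ a), ∑ k' ∈ Finset.range (translates w.m₀' a'),
        ENNReal.ofReal (min (w.coeff f a k a' k' ^ 2) (threshold w ν Cβ ε a ^ 2)) ≤
      ENNReal.ofReal (A ^ 2) *
        ENNReal.ofReal ((2 : ℝ) ^ ((w.m₀ : ℝ) + w.m₀') *
          (max ((2 : ℝ) ^ (1 + shifted s₁ (min p 2) + shifted s₂ (min p 2)))
            (Cβ * (2 : ℝ) ^ (((w.m₀ : ℝ) - 1) * ν))) ^ 2) *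
        twoPow (min (-(2 * (a * shifted s₁ (min p 2) + a' * shifted s₂ (min p 2))))
          (min (-((min p 2).toReal * (a * shifted s₁ (min p 2) + a' * shifted s₂ (min p 2))) +
            (1 - (min p 2).toReal / 2) *
              (2 * a * ν - -Real.logb 2 (ε ^ 2 * Real.log (1 / ε) / A ^ 2)))
            (a * (2 * ν + 1) + a' - -Real.logb 2 (ε ^ 2 * Real.log (1 / ε) / A ^ 2)))) := by
  have h := sum_abs_coeff_rpow_le hp hq hσ₁ hσ₂ hA hf a a'
  rw [sum_range_range_eq _ _ fun k k' => |w.coeff f a k a' k'| ^ (min p 2).toReal] at h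
  rw [sum_range_range_eq _ _ fun k k' =>
    ENNReal.ofReal (min (w.coeff f a k a' k' ^ 2) (threshold w ν Cβ ε a ^ 2)),
    threshold_eq w ν Cβ hA hε hL]
  refine (sum_min_sq_le_min_twoPow (y := (a : ℝ) + a') (n := (w.m₀ : ℝ) + w.m₀')
    (one_le_toReal_min_two hp) toReal_min_two_le hA (by positivity) (by positivity)
    (le_max_left _ _) (le_max_right _ _) (by positivity) ?_ h).trans_eq ?_
  · simpa using card_translates_le w.m₀ w.m₀' a a'
  · congr 4 <;> ring

theorem sum_noiseVar_le {ν C₁ : ℝ} (hC₁ : 0 < C₁) (a a' : ℕ) :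
    ∑ _k ∈ Finset.range (translates w.m₀ a), ∑ _k' ∈ Finset.range (translates w.m₀' a'),
        ENNReal.ofReal (noiseVar w ν C₁ a) ≤
      ENNReal.ofReal (C₁⁻¹ * (2 * Real.pi / 3) ^ (2 * ν) *
        (2 : ℝ) ^ (2 * ((w.m₀ : ℝ) - 1) * ν + ((w.m₀ : ℝ) + w.m₀'))) *
        twoPow ((2 * ν + 1) * a + 1 * a') := by
  have hpi := Real.pi_pos
  have hV := (noiseVar_pos (w := w) (ν := ν) hC₁ a).le
  rw [Finset.sum_const, Finset.sum_const, Finset.card_range, Finset.card_range, smul_smul,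
    nsmul_eq_mul, ← ENNReal.ofReal_natCast, ← ENNReal.ofReal_mul (by positivity),
    ← ofReal_rpow_two, ← ENNReal.ofReal_mul (by positivity)]
  refine ENNReal.ofReal_le_ofReal
    ((mul_le_mul_of_nonneg_right (card_translates_le w.m₀ w.m₀' a a') hV).trans_eq ?_)
  rw [noiseVar_eq, level, ← Real.rpow_natCast ((2 : ℝ) ^ _), ← Real.rpow_mul two_pos.le,
    mul_left_comm, ← Real.rpow_add two_pos, mul_assoc _ ((2 : ℝ) ^ _),
    ← Real.rpow_add two_pos]
  congr 2
  push_cast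
  ring

/-- The risk over a Besov ball, as a sum over the levels of explicit exponentials. -/
theorem exists_risk_le_levels {Ω : Type*} [MeasurableSpace Ω] {P : Measure Ω}
    [IsProbabilityMeasure P] {Z : L2Torus2 → Ω → ℝ} (hZ : IsWhiteNoise P Z)
    {g : UnitAddCircle → UnitAddCircle → ℝ} {ν C₁ C₂ Cβ : ℝ} (hν : 0 < ν)
    (hC₁ : 0 < C₁) (hC₂ : 0 < C₂) (hg : IsRegularKernel g ν C₁ C₂) (hCβ : 0 < Cβ)
    (hCβ' : 80 * C₁⁻¹ * (2 * Real.pi / 3) ^ (2 * ν) ≤ Cβ ^ 2) (hp : 1 ≤ p) (hq : 1 ≤ q)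
    {r σ₁ σ₂ : ℝ} (hr : (min p 2).toReal = r) (hs₁ : shifted s₁ (min p 2) = σ₁)
    (hs₂ : shifted s₂ (min p 2) = σ₂) (hσ₁ : 0 ≤ σ₁) (hσ₂ : 0 ≤ σ₂) :
    ∃ D : ℝ≥0∞, D ≠ ∞ ∧ ∀ A > 0, ∀ f ∈ besovBall w s₁ s₂ p q A, ∀ ε > 0,
      1 ≤ Real.log (1 / ε) → ∀ J J' : ℕ, risk P Z w g ν Cβ ε J J' f ≤
        D * (ENNReal.ofReal (A ^ 2) * (∑' a : ℕ, ∑' a' : ℕ,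
            twoPow (min (-(2 * (a * σ₁ + a' * σ₂))) (min (-(r * (a * σ₁ + a' * σ₂)) +
              (1 - r / 2) * (2 * a * ν - -Real.logb 2 (ε ^ 2 * Real.log (1 / ε) / A ^ 2)))
              (a * (2 * ν + 1) + a' - -Real.logb 2 (ε ^ 2 * Real.log (1 / ε) / A ^ 2))))) +
          ENNReal.ofReal (ε ^ 7) * (∑' a : ℕ, ∑' a' : ℕ,
            if a < J + 1 - w.m₀ ∧ a' < J' + 1 - w.m₀' then twoPow ((2 * ν + 1) * a + 1 * a')
            else 0) +
          ENNReal.ofReal (A ^ 2) * ENNReal.ofReal (ε ^ 5) * (∑' a : ℕ, ∑' a' : ℕ,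
            if a < 0 ∧ a' < 0 then 0 else twoPow (-(2 * σ₁ * a) + -(2 * σ₂ * a'))) +
          ENNReal.ofReal (A ^ 2) * (∑' a : ℕ, ∑' a' : ℕ,
            if a < J + 1 - w.m₀ ∧ a' < J' + 1 - w.m₀' then 0
            else twoPow (-(2 * σ₁ * a) + -(2 * σ₂ * a')))) := by
  subst hr hs₁ hs₂
  set c : ℝ := 4 * Real.exp (3 / 2) with hc
  have hc0 : 0 < c := by positivity
  set M := ENNReal.ofReal ((2 : ℝ) ^ ((w.m₀ : ℝ) + w.m₀') *
          (max ((2 : ℝ) ^ (1 + shifted s₁ (min p 2) + shifted s₂ (min p 2)))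
            (Cβ * (2 : ℝ) ^ (((w.m₀ : ℝ) - 1) * ν))) ^ 2) with hM
  set N := ENNReal.ofReal (C₁⁻¹ * (2 * Real.pi / 3) ^ (2 * ν) *
        (2 : ℝ) ^ (2 * ((w.m₀ : ℝ) - 1) * ν + ((w.m₀ : ℝ) + w.m₀'))) with hN
  set K := ENNReal.ofReal
    (((2 : ℝ) ^ (1 + shifted s₁ (min p 2) + shifted s₂ (min p 2))) ^ 2) with hK
  set D := ENNReal.ofReal (9 / 4) * M + ENNReal.ofReal c * N + ENNReal.ofReal c * K + K with hD
  have hD1 : ENNReal.ofReal (9 / 4) * M ≤ D := by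
    rw [hD, add_assoc, add_assoc]; exact le_self_add
  have hD2 : ENNReal.ofReal c * N ≤ D := by
    rw [hD]; exact le_add_self.trans (le_self_add.trans le_self_add)
  have hD3 : ENNReal.ofReal c * K ≤ D := by
    rw [hD]; exact le_add_self.trans le_self_add
  have hD4 : K ≤ D := by rw [hD]; exact le_add_self
  refine ⟨D, by simp [hD, hM, hN, hK, ENNReal.mul_eq_top], fun A hA f hf ε hε hL J J' => ?_⟩
  have hL0 : 0 < Real.log (1 / ε) := by linarith
  refine (risk_le_tsum hZ hν hC₁ hC₂ hg hCβ hCβ' hf.1 hε hL J J').trans ?_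
  simp only [mul_add D, ← ENNReal.tsum_mul_left, ← ENNReal.tsum_add]
  refine ENNReal.tsum_le_tsum fun a => ENNReal.tsum_le_tsum fun a' => ?_
  have h1 := sum_ofReal_min_threshold_le (ν := ν) hp hq hσ₁ hσ₂ hA hf hCβ hε hL0 a a'
  have h2 := sum_noiseVar_le (w := w) (ν := ν) hC₁ a a'
  have h3 := sum_ofReal_coeff_sq_le hp hq hσ₁ hσ₂ hA hf a a'
  rw [← hM] at h1
  rw [← hN] at h2
  rw [← hK] at h3
  have hV := (noiseVar_pos (w := w) (ν := ν) hC₁ a).le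
  by_cases hin : a < J + 1 - w.m₀ ∧ a' < J' + 1 - w.m₀'
  -- The third sum runs over all levels: it is written as the outside of an empty rectangle, so that
  -- `tsum_tsum_outside_le` serves for both energy sums.
  · simp only [if_pos hin, not_lt_zero, false_and, if_false]
    have hterm : ∀ k k', ENNReal.ofReal
          (9 / 4 * min (w.coeff f a k a' k' ^ 2) (threshold w ν Cβ ε a ^ 2) +
            c * ε ^ 5 * (noiseVar w ν C₁ a * ε ^ 2 + w.coeff f a k a' k' ^ 2)) =
        ENNReal.ofReal (9 / 4) *
          ENNReal.ofReal (min (w.coeff f a k a' k' ^ 2) (threshold w ν Cβ ε a ^ 2)) +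
        ENNReal.ofReal c * ENNReal.ofReal (ε ^ 7) * ENNReal.ofReal (noiseVar w ν C₁ a) +
        ENNReal.ofReal c * ENNReal.ofReal (ε ^ 5) *
          ENNReal.ofReal (w.coeff f a k a' k' ^ 2) := fun k k' => by
      have hm : 0 ≤ min (w.coeff f a k a' k' ^ 2) (threshold w ν Cβ ε a ^ 2) :=
        le_min (sq_nonneg _) (sq_nonneg _)
      rw [← ENNReal.ofReal_mul (by positivity), ← ENNReal.ofReal_mul (by positivity),
        ← ENNReal.ofReal_mul (by positivity), ← ENNReal.ofReal_mul (by positivity),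
        ← ENNReal.ofReal_mul (by positivity), ← ENNReal.ofReal_add (by positivity) (by positivity),
        ← ENNReal.ofReal_add (by positivity) (by positivity)]
      congr 1
      ring
    simp only [← hc, hterm, Finset.sum_add_distrib, ← Finset.mul_sum]
    rw [mul_zero, mul_zero, add_zero]
    refine add_le_add (add_le_add ?_ ?_) ?_
    · calc _ ≤ _ := mul_le_mul_right h1 _
        _ = (ENNReal.ofReal (9 / 4) * M) * (ENNReal.ofReal (A ^ 2) * _) := by ring
        _ ≤ _ := mul_le_mul_left hD1 _
    · calc _ ≤ _ := mul_le_mul_right h2 _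
        _ = (ENNReal.ofReal c * N) * (ENNReal.ofReal (ε ^ 7) * _) := by ring
        _ ≤ _ := mul_le_mul_left hD2 _
    · calc _ ≤ _ := mul_le_mul_right h3 _
        _ = (ENNReal.ofReal c * K) * (ENNReal.ofReal (A ^ 2) * ENNReal.ofReal (ε ^ 5) * _) := by
          ring
        _ ≤ _ := mul_le_mul_left hD3 _
  · simp only [if_neg hin]
    refine le_trans ?_ le_add_self
    calc _ ≤ _ := h3
      _ = K * (ENNReal.ofReal (A ^ 2) * _) := by ring
      _ ≤ _ := mul_le_mul_left hD4 _

end Levels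

/-! ### The rate -/

section Rate

theorem logb_one_div_nonneg {ε : ℝ} (hL : 1 ≤ Real.log (1 / ε)) : 0 ≤ Real.logb 2 (1 / ε) :=
  div_nonneg (by linarith) (Real.log_nonneg one_le_two)

theorem ofReal_pow_eq_twoPow {ε : ℝ} (hε : 0 < ε) (n : ℕ) :
    ENNReal.ofReal (ε ^ n) = twoPow (-(n * Real.logb 2 (1 / ε))) := by
  rw [twoPow, one_div, Real.logb_inv, mul_neg, neg_neg, mul_comm, Real.rpow_mul two_pos.le,
    Real.rpow_logb two_pos (by norm_num) hε, Real.rpow_natCast]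

/-- From `ln(1/ε) ≤ 1/ε` one gets `τ ≤ ε/A² ≤ 1/2`, and from `ln(1/ε) ≥ A²` one gets `τ ≥ ε²`. -/
theorem logb_two_rate_bounds {A ε : ℝ} (hA : 0 < A) (hε : 0 < ε) (hεA : ε ≤ A ^ 2 / 2)
    (hL : 1 ≤ Real.log (1 / ε)) (hLA : A ^ 2 ≤ Real.log (1 / ε)) :
    1 ≤ -Real.logb 2 (ε ^ 2 * Real.log (1 / ε) / A ^ 2) ∧
      -Real.logb 2 (ε ^ 2 * Real.log (1 / ε) / A ^ 2) ≤ 2 * Real.logb 2 (1 / ε) := by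
  have hA2 : 0 < A ^ 2 := by positivity
  have hL0 : 0 < Real.log (1 / ε) := by linarith
  constructor
  · have h : ε ^ 2 * Real.log (1 / ε) / A ^ 2 ≤ (2 : ℝ) ^ (-1 : ℝ) := by
      rw [Real.rpow_neg_one, div_le_iff₀ hA2]
      have h1 : Real.log (1 / ε) ≤ 1 / ε := (Real.log_le_sub_one_of_pos (by positivity)).trans
        (by linarith)
      calc ε ^ 2 * Real.log (1 / ε) ≤ ε ^ 2 * (1 / ε) := by gcongr
        _ = ε := by field_simp
        _ ≤ _ := by linarith
    have h2 := (Real.logb_le_iff_le_rpow one_lt_two (by positivity)).2 h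
    linarith
  · have h : ε ^ 2 ≤ ε ^ 2 * Real.log (1 / ε) / A ^ 2 := by
      rw [le_div_iff₀ hA2]
      gcongr
    have h2 := Real.logb_le_logb_of_le one_lt_two (by positivity) h
    rw [Real.logb_pow] at h2
    rw [one_div, Real.logb_inv]
    rw [one_div] at h2
    push_cast at h2
    linarith

theorem logb_two_le {x : ℝ} (hx : 0 ≤ Real.log x) : Real.logb 2 x ≤ 2 * Real.log x := by
  have h := Real.log_two_gt_d9
  rw [Real.logb, div_le_iff₀ (by linarith)]
  nlinarith

theorem IsLevelFor.bounds_of_sq_inv {ε : ℝ} {J : ℕ} (h : IsLevelFor J ((ε ^ 2)⁻¹)) :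
    2 * Real.logb 2 (1 / ε) - 1 ≤ J ∧ (J : ℝ) ≤ 2 * Real.logb 2 (1 / ε) + 1 := by
  rw [IsLevelFor, Real.logb_inv, Real.logb_pow, abs_lt] at h
  rw [one_div, Real.logb_inv]
  push_cast at h
  constructor <;> linarith

theorem IsLevelFor.bounds_of_sq_rpow {ε ν : ℝ} (hε : 0 < ε) {J : ℕ}
    (h : IsLevelFor J ((ε ^ 2) ^ (-(1 / (2 * ν + 1))))) :
    2 * Real.logb 2 (1 / ε) / (2 * ν + 1) - 1 ≤ J ∧
      (J : ℝ) ≤ 2 * Real.logb 2 (1 / ε) / (2 * ν + 1) + 1 := by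
  rw [IsLevelFor, Real.logb_rpow_eq_mul_logb_of_pos (by positivity), Real.logb_pow, abs_lt] at h
  have e : -(1 / (2 * ν + 1)) * (((2 : ℕ) : ℝ) * Real.logb 2 ε) =
      2 * Real.logb 2 (1 / ε) / (2 * ν + 1) := by
    rw [one_div ε, Real.logb_inv]
    push_cast
    ring
  rw [e] at h
  constructor <;> linarith

variable {s₁ s₂ ν : ℝ} {p : ℝ≥0∞}

theorem inv_toReal_min_two_le (hs : max (p⁻¹).toReal (1 / 2) ≤ min s₁ s₂) :
    1 / (min p 2).toReal ≤ s₁ ∧ 1 / (min p 2).toReal ≤ s₂ := by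
  rw [max_le_iff, le_min_iff, le_min_iff] at hs
  rcases le_or_gt p 2 with h | h
  · rw [min_eq_left h, one_div, ← ENNReal.toReal_inv]
    exact hs.1
  · rw [min_eq_right h.le]
    simpa using hs.2

theorem shifted_min_two (s : ℝ) :
    shifted s (min p 2) = s + 1 / 2 - 1 / (min p 2).toReal := by
  rw [shifted, ENNReal.toReal_inv, one_div (min p 2).toReal]

/-- The critical case written with `r = min(p, 2)` is the one written with `p` when `p ≤ 2`; for `p
> 2` it would force `s₁ = 0`, against `s₁ ≥ 1/2`. -/
theorem one_le_logExp (hs : max (p⁻¹).toReal (1 / 2) ≤ min s₁ s₂)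
    (h : s₁ = s₂ * (2 * ν + 1) ∨ s₁ = (2 * ν + 1) * (1 / (min p 2).toReal - 1 / 2)) :
    1 ≤ logExp s₁ s₂ ν p := by
  rw [logExp]
  rcases h with h | h
  · rw [if_pos h]
    exact Nat.le_add_right _ _
  · rcases le_or_gt p 2 with h2 | h2
    · rw [min_eq_left h2, one_div, ← ENNReal.toReal_inv] at h
      rw [if_pos h]
      exact Nat.le_add_left _ _
    · rw [min_eq_right h2.le] at h
      have := (le_max_right _ _).trans hs |>.trans (min_le_left _ _)
      norm_num at h this
      linarith

theorem rateExp_nonneg (hν : 0 < ν) (h₁ : 0 ≤ s₁) (h₂ : 0 ≤ s₂)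
    (h₃ : 0 ≤ shifted s₁ (min p 2)) : 0 ≤ rateExp s₁ s₂ ν p :=
  le_min (by positivity) (le_min (by positivity) (by positivity))

theorem rateExp_le_one (h₂ : 0 ≤ s₂) : rateExp s₁ s₂ ν p ≤ 1 :=
  (min_le_left _ _).trans (div_le_one_of_le₀ (by linarith) (by linarith))

/-- The risk over a Besov ball, with the rate written in powers of two. -/
theorem exists_risk_le_rate {Ω : Type*} [MeasurableSpace Ω] {P : Measure Ω}
    [IsProbabilityMeasure P] {Z : L2Torus2 → Ω → ℝ} (hZ : IsWhiteNoise P Z) {w : WaveletSystem}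
    {g : UnitAddCircle → UnitAddCircle → ℝ} {C₁ C₂ Cβ : ℝ} (hν : 0 < ν)
    (hC₁ : 0 < C₁) (hC₂ : 0 < C₂) (hg : IsRegularKernel g ν C₁ C₂) (hCβ : 0 < Cβ)
    (hCβ' : 80 * C₁⁻¹ * (2 * Real.pi / 3) ^ (2 * ν) ≤ Cβ ^ 2) {q : ℝ≥0∞} (hp : 1 ≤ p)
    (hq : 1 ≤ q) (hs : max (p⁻¹).toReal (1 / 2) ≤ min s₁ s₂) :
    ∃ D : ℝ≥0∞, D ≠ ∞ ∧ ∀ A > 0, ∀ ε > 0, ε ≤ A ^ 2 / 2 → 1 ≤ Real.log (1 / ε) →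
      A ^ 2 ≤ Real.log (1 / ε) → ∀ J J' : ℕ,
      IsLevelFor J ((ε ^ 2) ^ (-(1 / (2 * ν + 1)))) → IsLevelFor J' ((ε ^ 2)⁻¹) →
      ∀ f ∈ besovBall w s₁ s₂ p q A, risk P Z w g ν Cβ ε J J' f ≤
        D * (ENNReal.ofReal (A ^ 2) * twoPow (-(rateExp s₁ s₂ ν p *
          -Real.logb 2 (ε ^ 2 * Real.log (1 / ε) / A ^ 2))) *
          ENNReal.ofReal (Real.log (1 / ε)) ^ logExp s₁ s₂ ν p) := by
  obtain ⟨hr₁, hr₂⟩ := inv_toReal_min_two_le hs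
  have hσ₁e := shifted_min_two (p := p) s₁
  have hσ₂e := shifted_min_two (p := p) s₂
  have hd₀ : ∀ _ : 0 ≤ shifted s₁ (min p 2), 0 ≤ rateExp s₁ s₂ ν p := fun h =>
    rateExp_nonneg hν ((by positivity : (0 : ℝ) ≤ 1 / (min p 2).toReal).trans hr₁)
      ((by positivity : (0 : ℝ) ≤ 1 / (min p 2).toReal).trans hr₂) h
  have hd1 := rateExp_le_one (s₁ := s₁) (ν := ν) (p := p)
    ((by positivity : (0 : ℝ) ≤ 1 / (min p 2).toReal).trans hr₂)
  have hda : rateExp s₁ s₂ ν p ≤ 2 * s₂ / (2 * s₂ + 1) := min_le_left _ _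
  have hdb : rateExp s₁ s₂ ν p ≤ 2 * s₁ / (2 * s₁ + 2 * ν + 1) :=
    (min_le_right _ _).trans (min_le_left _ _)
  have hdc : rateExp s₁ s₂ ν p ≤
      2 * shifted s₁ (min p 2) / (2 * shifted s₁ (min p 2) + 2 * ν) :=
    (min_le_right _ _).trans (min_le_right _ _)
  have he := one_le_logExp (ν := ν) hs
  have hr1 := one_le_toReal_min_two hp
  have hr2 := toReal_min_two_le (p := p)
  set d := rateExp s₁ s₂ ν p
  set e := logExp s₁ s₂ ν p
  set σ₁ := shifted s₁ (min p 2) with hσ₁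
  set σ₂ := shifted s₂ (min p 2) with hσ₂
  set r := (min p 2).toReal with hr
  -- This and the next bound are `sᵢ ≥ 1/r`; they are what makes the truncation error harmless.
  have hσ₁h : 1 / 2 ≤ σ₁ := by linarith
  have hσ₂h : 1 / 2 ≤ σ₂ := by linarith
  have hd0 := hd₀ (by linarith)
  obtain ⟨D, hD, hrisk⟩ := exists_risk_le_levels (w := w) (s₁ := s₁) (s₂ := s₂) (q := q) hZ hν hC₁
    hC₂ hg hCβ hCβ' hp hq hr.symm hσ₁.symm hσ₂.symm (by linarith) (by linarith)
  obtain ⟨B, hB, hmin⟩ := tsum_tsum_min_twoPow_le (e := e) hr1 hr2 hν hr₁ hr₂ hσ₁e hσ₂e hda hdb hdc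
    he
  obtain ⟨G, hG, hout⟩ := tsum_tsum_outside_le (α := 2 * σ₁) (β := 2 * σ₂) (by linarith)
    (by linarith)
  refine ⟨D * (B * 4 ^ e + twoPow (4 * ν + 4) + G * 2 +
    G * (twoPow (2 * σ₁ * w.m₀) + twoPow (2 * σ₂ * w.m₀'))), ?_, ?_⟩
  · have h4 : (4 : ℝ≥0∞) ^ e ≠ ∞ := ENNReal.pow_ne_top (by simp)
    simp only [ENNReal.mul_eq_top, ENNReal.add_eq_top, twoPow_ne_top, hD, hB, hG, h4, ne_eq,
      not_false_eq_true, and_false, or_false, false_and, ENNReal.ofNat_ne_top]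
  intro A hA ε hε hεA hL hLA J J' hJ hJ' f hf
  refine (hrisk A hA f hf ε hε hL J J').trans ?_
  obtain ⟨hT1, hT2⟩ := logb_two_rate_bounds hA hε hεA hL hLA
  have hℓ0 := logb_one_div_nonneg hL
  have hℓL := logb_two_le (x := 1 / ε) (by linarith)
  obtain ⟨hJ1, hJ2⟩ := hJ.bounds_of_sq_rpow hε
  obtain ⟨hJ'1, hJ'2⟩ := hJ'.bounds_of_sq_inv
  have hε1 := ofReal_pow_eq_twoPow hε 1
  rw [ofReal_pow_eq_twoPow hε 7, ofReal_pow_eq_twoPow hε 5]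
  set T := -Real.logb 2 (ε ^ 2 * Real.log (1 / ε) / A ^ 2) with hT
  set ℓ := Real.logb 2 (1 / ε) with hℓ
  set L := Real.log (1 / ε) with hLdef
  set Q := ENNReal.ofReal (A ^ 2) * twoPow (-(d * T)) * ENNReal.ofReal L ^ e with hQ
  have hL1 : 1 ≤ ENNReal.ofReal L := by simpa using hL
  -- Every term except the main one is compared with `A² ε^{2d}`, which lies below the rate because
  -- `T ≤ 2ℓ` and `d ≥ 0`.
  have hBase : ENNReal.ofReal (A ^ 2) * twoPow (-(2 * d * ℓ)) ≤ Q := by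
    rw [hQ, ← mul_one (ENNReal.ofReal (A ^ 2) * twoPow (-(2 * d * ℓ)))]
    refine mul_le_mul' (mul_le_mul' le_rfl (twoPow_mono ?_)) (one_le_pow₀ hL1)
    nlinarith [mul_le_mul_of_nonneg_left hT2 hd0]
  have hεA' : twoPow (-ℓ) ≤ ENNReal.ofReal (A ^ 2) := by
    have h : twoPow (-ℓ) = ENNReal.ofReal ε := by
      rw [← pow_one ε, hε1]
      simp
    rw [h]
    exact ENNReal.ofReal_le_ofReal (by nlinarith)
  have hdℓ : d * ℓ ≤ ℓ := by nlinarith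
  have h2ν : 0 < 2 * ν + 1 := by linarith
  -- Since `2σ₁ ≥ 1`, the denominator `2σ₁ + 2ν` is at least `2ν + 1`, the number that fixes `J`.
  have hdσ : d ≤ 2 * σ₁ / (2 * ν + 1) := 
    hdc.trans (div_le_div_of_nonneg_left (by linarith) h2ν (by linarith))
  rw [mul_assoc D]
  refine mul_le_mul' le_rfl ?_
  rw [add_mul, add_mul, add_mul]
  refine add_le_add (add_le_add (add_le_add ?_ ?_) ?_) ?_
  · refine (mul_le_mul' le_rfl (hmin T hT1)).trans ?_
    -- `T ≤ 2 log₂(1/ε) ≤ 4 ln(1/ε)`, hence the factor `4 ^ e` in the constant.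
    have hTL : ENNReal.ofReal T ≤ 4 * ENNReal.ofReal L := by
      rw [← ENNReal.ofReal_ofNat, ← ENNReal.ofReal_mul (by norm_num)]
      exact ENNReal.ofReal_le_ofReal (by linarith)
    calc _ ≤ ENNReal.ofReal (A ^ 2) * (B * twoPow (-(d * T)) * (4 * ENNReal.ofReal L) ^ e) := by
          gcongr
      _ = _ := by rw [hQ, mul_pow]; ring
  · refine (mul_le_mul' le_rfl (tsum_tsum_inside_le (by linarith) le_rfl _ _)).trans ?_
    have hR : ((J + 1 - w.m₀ : ℕ) : ℝ) ≤ 2 * ℓ / (2 * ν + 1) + 2 := by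
      have : ((J + 1 - w.m₀ : ℕ) : ℝ) ≤ ((J + 1 : ℕ) : ℝ) := by exact_mod_cast Nat.sub_le _ _
      push_cast at this
      linarith
    have hR' : ((J' + 1 - w.m₀' : ℕ) : ℝ) ≤ 2 * ℓ + 2 := by
      have : ((J' + 1 - w.m₀' : ℕ) : ℝ) ≤ ((J' + 1 : ℕ) : ℝ) := by exact_mod_cast Nat.sub_le _ _
      push_cast at this
      linarith
    have hR2 : (2 * ν + 1) * ((J + 1 - w.m₀ : ℕ) : ℝ) ≤ 2 * ℓ + 2 * (2 * ν + 1) := by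
      refine (mul_le_mul_of_nonneg_left hR h2ν.le).trans_eq ?_
      field_simp
    -- The two levels cost at most `2ℓ` each, plus `4ν + 4` for rounding, so the exponent is at most
    -- `-3ℓ` plus a constant. Of the `3ℓ`, a part `2dℓ ≤ 2ℓ` gives the rate, and one `ℓ` gives `ε ≤
    -- A²`, the missing factor `A²`.
    calc _ = twoPow (-((7 : ℕ) * ℓ) + ((2 * ν + 1) * ((J + 1 - w.m₀ : ℕ) : ℝ) +
            1 * ((J' + 1 - w.m₀' : ℕ) : ℝ))) := (twoPow_add _ _).symm
      _ ≤ twoPow (4 * ν + 4 + (-ℓ + -(2 * d * ℓ))) := twoPow_mono (by push_cast; linarith)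
      _ = twoPow (4 * ν + 4) * (twoPow (-ℓ) * twoPow (-(2 * d * ℓ))) := by
          rw [twoPow_add _ (_ + -(2 * d * ℓ)), twoPow_add (-ℓ)]
      _ ≤ twoPow (4 * ν + 4) * (ENNReal.ofReal (A ^ 2) * twoPow (-(2 * d * ℓ))) := by gcongr
      _ ≤ _ := by gcongr
  · have h0 := hout 0 0
    simp only [Nat.cast_zero, mul_zero, neg_zero, twoPow_zero, one_add_one_eq_two] at h0
    calc _ ≤ ENNReal.ofReal (A ^ 2) * twoPow (-(2 * d * ℓ)) * (G * 2) :=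
          mul_le_mul' (mul_le_mul' le_rfl (twoPow_mono (by push_cast; linarith))) h0
      _ ≤ Q * (G * 2) := by gcongr
      _ = _ := mul_comm _ _
  -- Levels are counted from the lowest one, so the cut-off in `a` is `J + 1 - m₀`; this shift
  -- produces the powers of two with `m₀` and `m₀'` in the constant.
  · have hR : 2 * ℓ / (2 * ν + 1) - w.m₀ ≤ ((J + 1 - w.m₀ : ℕ) : ℝ) := by
      have : ((J + 1 : ℕ) : ℝ) - w.m₀ ≤ ((J + 1 - w.m₀ : ℕ) : ℝ) := by
        rw [sub_le_iff_le_add]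
        exact_mod_cast le_tsub_add
      push_cast at this
      linarith
    have hR' : 2 * ℓ - w.m₀' ≤ ((J' + 1 - w.m₀' : ℕ) : ℝ) := by
      have : ((J' + 1 : ℕ) : ℝ) - w.m₀' ≤ ((J' + 1 - w.m₀' : ℕ) : ℝ) := by
        rw [sub_le_iff_le_add]
        exact_mod_cast le_tsub_add
      push_cast at this
      linarith
    have h1 : twoPow (-(2 * σ₁ * ((J + 1 - w.m₀ : ℕ) : ℝ))) ≤
        twoPow (2 * σ₁ * w.m₀) * twoPow (-(2 * d * ℓ)) := by
      rw [← twoPow_add]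
      refine twoPow_mono ?_
      have e1 := mul_le_mul_of_nonneg_left hR (by linarith : 0 ≤ 2 * σ₁)
      have e2 := mul_le_mul_of_nonneg_right hdσ (by linarith : 0 ≤ 2 * ℓ)
      have e3 : 2 * σ₁ / (2 * ν + 1) * (2 * ℓ) = 2 * σ₁ * (2 * ℓ / (2 * ν + 1)) := by ring
      linarith
    have h2 : twoPow (-(2 * σ₂ * ((J' + 1 - w.m₀' : ℕ) : ℝ))) ≤
        twoPow (2 * σ₂ * w.m₀') * twoPow (-(2 * d * ℓ)) := by
      rw [← twoPow_add]
      refine twoPow_mono ?_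
      have e1 := mul_le_mul_of_nonneg_left hR' (by linarith : 0 ≤ 2 * σ₂)
      have e2 : 1 * ℓ ≤ 2 * σ₂ * ℓ := mul_le_mul_of_nonneg_right (by linarith) hℓ0
      linarith
    calc _ ≤ ENNReal.ofReal (A ^ 2) * (G * (twoPow (2 * σ₁ * w.m₀) * twoPow (-(2 * d * ℓ)) +
            twoPow (2 * σ₂ * w.m₀') * twoPow (-(2 * d * ℓ)))) :=
          mul_le_mul' le_rfl ((hout _ _).trans (mul_le_mul' le_rfl (add_le_add h1 h2)))
      _ = G * (twoPow (2 * σ₁ * w.m₀) + twoPow (2 * σ₂ * w.m₀')) *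
          (ENNReal.ofReal (A ^ 2) * twoPow (-(2 * d * ℓ))) := by ring
      _ ≤ _ := by gcongr

theorem eventually_small_noise {A : ℝ} (hA : 0 < A) : ∀ᶠ ε in 𝓝[>] (0 : ℝ),
    0 < ε ∧ ε ≤ A ^ 2 / 2 ∧ 1 ≤ Real.log (1 / ε) ∧ A ^ 2 ≤ Real.log (1 / ε) := by
  have h : Tendsto (fun ε : ℝ => Real.log (1 / ε)) (𝓝[>] 0) atTop := by
    simp_rw [one_div]
    exact Real.tendsto_log_atTop.comp tendsto_inv_nhdsGT_zero
  have h2 : ∀ᶠ ε in 𝓝[>] (0 : ℝ), ε < A ^ 2 / 2 :=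
    nhdsWithin_le_nhds (gt_mem_nhds (by positivity))
  filter_upwards [self_mem_nhdsWithin, h2, h.eventually_ge_atTop 1, h.eventually_ge_atTop (A ^ 2)]
    with ε h1 h2 h3 h4
  exact ⟨h1, h2.le, h3, h4⟩

end Rate

end FunctionalDeconvolution

end

/-! ### The theorem: the risk bound over a Besov ball -/

open FunctionalDeconvolution in
theorem theorem2 {Ω : Type*} [MeasurableSpace Ω] (P : Measure Ω) [IsProbabilityMeasure P]
    (Z : L2Torus2 → Ω → ℝ) (hZ : IsWhiteNoise P Z)
    (w : WaveletSystem)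
    (g : UnitAddCircle → UnitAddCircle → ℝ) (ν C₁ C₂ : ℝ)
    (hν : 0 < ν) (hC₁ : 0 < C₁) (hC₂ : 0 < C₂) (hg : IsRegularKernel g ν C₁ C₂)
    (Cβ : ℝ) (hCβ : 0 < Cβ) (hCβ' : 80 * C₁⁻¹ * (2 * Real.pi / 3) ^ (2 * ν) ≤ Cβ ^ 2)
    (s₁ s₂ : ℝ) (p q : ℝ≥0∞) (hp : 1 ≤ p) (hq : 1 ≤ q)
    (hs : max (p⁻¹).toReal (1 / 2) ≤ min s₁ s₂) :
    ∃ C : ℝ, 0 < C ∧ ∀ A : ℝ, 0 < A → ∀ᶠ ε in 𝓝[>] (0 : ℝ), ∀ J J' : ℕ,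
      IsLevelFor J ((ε ^ 2) ^ (-(1 / (2 * ν + 1)))) → IsLevelFor J' ((ε ^ 2)⁻¹) →
        (⨆ f ∈ besovBall w s₁ s₂ p q A, risk P Z w g ν Cβ ε J J' f) ≤
          ENNReal.ofReal (C * A ^ 2 *
            (ε ^ 2 * Real.log (1 / ε) / A ^ 2) ^ rateExp s₁ s₂ ν p *
            Real.log (1 / ε) ^ logExp s₁ s₂ ν p) := by
  obtain ⟨D, hD, h⟩ := exists_risk_le_rate (w := w) hZ hν hC₁ hC₂ hg hCβ hCβ' hp hq hs
  -- The `+ 1` ensures that the constant is strictly positive. `D` was obtained before `A` and `ε`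
  -- were introduced.
  refine ⟨D.toReal + 1, by positivity, fun A hA => ?_⟩
  filter_upwards [eventually_small_noise hA] with ε ⟨hε, hεA, hL, hLA⟩ J J' hJ hJ'
  refine iSup₂_le fun f hf => (h A hA ε hε hεA hL hLA J J' hJ hJ' f hf).trans ?_
  have hL0 : 0 < Real.log (1 / ε) := by linarith
  have hτ : 0 < ε ^ 2 * Real.log (1 / ε) / A ^ 2 := by positivity
  have hrate : twoPow (-(rateExp s₁ s₂ ν p *
      -Real.logb 2 (ε ^ 2 * Real.log (1 / ε) / A ^ 2))) =
      ENNReal.ofReal ((ε ^ 2 * Real.log (1 / ε) / A ^ 2) ^ rateExp s₁ s₂ ν p) := by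
    rw [twoPow, mul_neg, neg_neg, mul_comm, Real.rpow_mul two_pos.le,
      Real.rpow_logb two_pos (by norm_num) hτ]
  rw [hrate, ← ENNReal.ofReal_pow hL0.le, mul_assoc (D.toReal + 1), mul_assoc (D.toReal + 1),
    ENNReal.ofReal_mul (by positivity), ENNReal.ofReal_mul (by positivity),
    ENNReal.ofReal_mul (by positivity)]
  refine mul_le_mul' ?_ le_rfl
  rw [← ENNReal.ofReal_toReal hD, ENNReal.toReal_ofReal ENNReal.toReal_nonneg]
  exact ENNReal.ofReal_le_ofReal (by linarith)
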